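/- **Theorem 3.2.** Let $a<b$, $\Omega=(a,b)$, let $m\ge 2$ be an integer, let $V,A_1\in W^{m,\infty}_{\rm per}(\Omega)$ be real-valued and let $K\in\mathbb R$. Here $W^{m,p}_{\rm per}(\Omega)=\{u\in W^{m,p}(\Omega):\ \partial_x^l u(a)=\partial_x^l u(b),\ 0\le l\le m-1\}$ and $H^m_{\rm per}(\Omega)=W^{m,2}_{\rm per}(\Omega)$, normed by $\|\phi\|_{H^m}=\big(\sum_{l\in\mathbb Z}(1+\mu_l^2)^m|\widehat\phi_l|^2\big)^{1/2}$ with $\mu_l=\frac{2\pi l}{b-a}$ and $\widehat\phi_l=\frac1{b-a}\int_a^b\phi(x)e^{-i\mu_l(x-a)}\,dx$. Let $\sigma_1=\begin{pmatrix}0&1\\1&0\end{pmatrix}$ and $\sigma_3=\begin{pmatrix}1&0\\0&-1\end{pmatrix}$. There are constants $C_0,C_1>0$, depending only on $a,b,m,V,A_1,K$, such that the following holds for all $T>0$ and $0<\varepsilon\le 1$. Let $\Phi:[0,T/\varepsilon]\times[a,b]\to\mathbb C^2$ be a (continuous, classical) solution of the Dirac equation $$i\partial_t\Phi=(-i\sigma_1\partial_x+\sigma_3)\Phi+\varepsilon\,(V(x)I_2-A_1(x)\sigma_1)\Phi,\qquad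 \Phi(t,a)=\Phi(t,b),\qquad \Phi(0,x)=\Phi_0(x),$$ with $\|\Phi\|_{L^\infty([0,T/\varepsilon];(H^m_{\rm per}(\Omega))^2)}\le K$. Let $M$ be a positive even integer, $h=(b-a)/M$, $x_j=a+jh$ for $0\le j\le M$, $\mathcal T_M=\{-M/2,\dots,M/2-1\}$, $\tau>0$ and $t_n=n\tau$. For $U=(U_0,\dots,U_M)$ with $U_j\in\mathbb C^2$ put $$\widetilde U_l=\frac1M\sum_{j=0}^{M-1}U_je^{-2ijl\pi/M},\qquad (I_MU)(x)=\sum_{l\in\mathcal T_M}\widetilde U_l\,e^{i\mu_l(x-a)},$$ and let $\Phi^n$ be given by the time-splitting Fourier pseudospectral method: $\Phi^0_j=\Phi_0(x_j)$ and, with $\Gamma_l=\mu_l\sigma_1+\sigma_3$ and $G(x)=V(x)I_2-A_1(x)\sigma_1$, for $0\le j\le M$, $$\Phi^{(1)}_j=\sum_{l\in\mathcal T_M}e^{-i\tau\Gamma_l/2}\,\widetilde{(\Phi^n)}_l\,e^{i\mu_l(x_j-a)},\qquad \Phi^{(2)}_j=e^{-i\varepsilon\tau G(x_j)}\Phi^{(1)}_j,\qquad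 \Phi^{n+1}_j=\sum_{l\in\mathcal T_M}e^{-i\tau\Gamma_l/2}\,\widetilde{(\Phi^{(2)})}_l\,e^{i\mu_l(x_j-a)}.$$ Then, with $C(t)=C_0+C_1\varepsilon t$, $$\|\Phi(t_n,\cdot)-I_M\Phi^n\|_{L^2(\Omega)}\le C(t_n)\,(h^m+\tau^2)\quad\text{and}\quad C(t_n)\le C_0+C_1T\qquad\text{for all integers } 0\le n\le\frac{T/\varepsilon}{\tau}.$$ In particular $C_0,C_1$ are independent of $h,\tau,n,\varepsilon$, so the bound is uniform in $\varepsilon$ and its constant grows at most linearly in $t$. -/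

import Mathlib

open MeasureTheory Set
open scoped ENNReal ContDiff

noncomputable section

namespace DiracTSFP

/-! ### Periodic Sobolev spaces on `(a, b)` -/

/-- `v` is the weak derivative of `u` on the open interval `(a, b)`:
`∫ φ' u = - ∫ φ v` for every smooth `φ` with compact support in `(a, b)`. -/
def IsWeakDeriv {E : Type*} [NormedAddCommGroup E] [NormedSpace ℝ E] [CompleteSpace E]
    (a b : ℝ) (u v : ℝ → E) : Prop :=
  ∀ φ : ℝ → ℝ, ContDiff ℝ ∞ φ → HasCompactSupport φ → tsupport φ ⊆ Ioo a b →
    ∫ x in Ioo a b, deriv φ x • u x = -∫ x in Ioo a b, φ x • v x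

/-- `u ∈ W^{m,p}_per(a, b)`: the weak derivatives `g k = ∂ₓᵏ u` of order `k ≤ m` exist and lie in
`L^p(a, b)`, and `∂ₓᵏ u(a) = ∂ₓᵏ u(b)` for `k < m`. The boundary values are those of the
representatives continuous on `[a, b]`; for `m ≥ 1`, `u` itself is required to be this continuous
representative on `[a, b]`, so that its point values are meaningful. -/
def MemSobolevPer {E : Type*} [NormedAddCommGroup E] [NormedSpace ℝ E] [CompleteSpace E]
    (m : ℕ) (p : ℝ≥0∞) (a b : ℝ) (u : ℝ → E) : Prop :=
  ∃ g : ℕ → ℝ → E,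
    EqOn (g 0) u (Icc a b) ∧
    (∀ k ≤ m, MemLp (g k) p (volume.restrict (Ioo a b))) ∧
    (∀ k < m, IsWeakDeriv a b (g k) (g (k + 1))) ∧
    (∀ k < m, ContinuousOn (g k) (Icc a b) ∧ g k a = g k b)

/-! ### Two-component wave functions and Fourier modes -/

/-- The values `ℂ²` of a wave function, with the Euclidean norm. -/
abbrev Spinor : Type := EuclideanSpace ℂ (Fin 2)

/-- The Pauli matrix `σ₁`. -/
def sigma1 : Matrix (Fin 2) (Fin 2) ℂ := !![0, 1; 1, 0]

/-- The Pauli matrix `σ₃`. -/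
def sigma3 : Matrix (Fin 2) (Fin 2) ℂ := !![1, 0; 0, -1]

/-- A `2 × 2` matrix applied to a spinor. -/
def act (A : Matrix (Fin 2) (Fin 2) ℂ) (v : Spinor) : Spinor := Matrix.toEuclideanLin A v

/-- The frequency `μ_l = 2 π l / (b - a)`. -/
def freq (a b : ℝ) (l : ℤ) : ℝ := 2 * Real.pi * l / (b - a)

/-- The Fourier coefficient `(b - a)⁻¹ ∫_a^b U(x) e^{-i μ_l (x - a)} dx`. -/
def fourierCoef (a b : ℝ) (U : ℝ → Spinor) (l : ℤ) : Spinor :=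
  ((1 / (b - a) : ℝ) : ℂ) •
    ∫ x in a..b, Complex.exp (-(Complex.I * (freq a b l : ℂ) * ((x - a : ℝ) : ℂ))) • U x

/-- The norm of `H^m_per(a, b)²`, `(∑_{l ∈ ℤ} (1 + μ_l²)^m |Û_l|²)^{1/2}`, with values in
`[0, ∞]`. -/
def sobolevNorm (a b : ℝ) (m : ℕ) (U : ℝ → Spinor) : ℝ≥0∞ :=
  (∑' l : ℤ, ENNReal.ofReal ((1 + freq a b l ^ 2) ^ m * ‖fourierCoef a b U l‖ ^ 2)) ^ (1 / 2 : ℝ)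

/-! ### The Dirac equation -/

/-- `Φ` is a solution on `[0, S] × [a, b]` of the Dirac equation
`i ∂ₜΦ = (-i σ₁ ∂ₓ + σ₃) Φ + ε (V I₂ - A₁ σ₁) Φ` with `Φ(t, a) = Φ(t, b)` and `Φ(0, x) = Φ₀(x)`. -/
structure IsDiracSolution (a b : ℝ) (V A₁ : ℝ → ℝ) (ε S : ℝ) (Φ₀ : ℝ → Spinor)
    (Φ : ℝ → ℝ → Spinor) : Prop where
  continuousOn : ContinuousOn (fun z : ℝ × ℝ => Φ z.1 z.2) (Icc 0 S ×ˢ Icc a b)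
  differentiable_time : ∀ t ∈ Ioo 0 S, ∀ x ∈ Ioo a b, DifferentiableAt ℝ (fun s => Φ s x) t
  differentiable_space : ∀ t ∈ Ioo 0 S, ∀ x ∈ Ioo a b, DifferentiableAt ℝ (fun y => Φ t y) x
  equation : ∀ t ∈ Ioo 0 S, ∀ x ∈ Ioo a b,
    Complex.I • deriv (fun s => Φ s x) t =
      -(Complex.I • act sigma1 (deriv (fun y => Φ t y) x)) + act sigma3 (Φ t x)
        + (ε : ℂ) • act ((V x : ℂ) • (1 : Matrix (Fin 2) (Fin 2) ℂ) - (A₁ x : ℂ) • sigma1) (Φ t x)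
  periodic : ∀ t ∈ Icc 0 S, Φ t a = Φ t b
  initial : ∀ x ∈ Icc a b, Φ 0 x = Φ₀ x

/-- `‖Φ‖_{L^∞([0, S]; H^m_per(a, b)²)} ≤ K`. -/
def SobolevBound (a b : ℝ) (m : ℕ) (S K : ℝ) (Φ : ℝ → ℝ → Spinor) : Prop :=
  ∀ᵐ t ∂(volume.restrict (Icc 0 S)),
    MemSobolevPer m 2 a b (Φ t) ∧ sobolevNorm a b m (Φ t) ≤ ENNReal.ofReal K

/-! ### The time-splitting Fourier pseudospectral method

Grid vectors `U = (U_0, …, U_M)` are functions `Fin (M + 1) → Spinor`. -/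

/-- The mesh size `h = (b - a) / M`. -/
def mesh (a b : ℝ) (M : ℕ) : ℝ := (b - a) / M

/-- The grid point `x_j = a + j h`. -/
def gridPoint (a b : ℝ) (M : ℕ) (j : ℕ) : ℝ := a + j * mesh a b M

/-- The index set `{-M/2, …, M/2 - 1}` (`M` even). -/
def modes (M : ℕ) : Finset ℤ := Finset.Ico (-((M : ℤ) / 2)) ((M : ℤ) / 2)

/-- The discrete Fourier coefficient `Ũ_l = M⁻¹ ∑_{j=0}^{M-1} U_j e^{-2 i j l π / M}`. -/
def discreteCoef (M : ℕ) (U : Fin (M + 1) → Spinor) (l : ℤ) : Spinor :=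
  (1 / (M : ℂ)) • ∑ j : Fin M,
    Complex.exp (-(2 * Complex.I * ((j : ℕ) : ℂ) * (l : ℂ) * (Real.pi : ℂ) / (M : ℂ))) •
      U j.castSucc

/-- The trigonometric interpolant `(I_M U)(x) = ∑_l Ũ_l e^{i μ_l (x - a)}`. -/
def interp (a b : ℝ) (M : ℕ) (U : Fin (M + 1) → Spinor) (x : ℝ) : Spinor :=
  ∑ l ∈ modes M,
    Complex.exp (Complex.I * (freq a b l : ℂ) * ((x - a : ℝ) : ℂ)) • discreteCoef M U l

/-- `Γ_l = μ_l σ₁ + σ₃`. -/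
def gammaMat (a b : ℝ) (l : ℤ) : Matrix (Fin 2) (Fin 2) ℂ :=
  (freq a b l : ℂ) • sigma1 + sigma3

/-- The free half step `U ↦ (∑_l e^{-i τ Γ_l / 2} Ũ_l e^{i μ_l (x_j - a)})_j`. -/
def freeHalfStep (a b τ : ℝ) (M : ℕ) (U : Fin (M + 1) → Spinor) : Fin (M + 1) → Spinor :=
  fun j => ∑ l ∈ modes M,
    Complex.exp (Complex.I * (freq a b l : ℂ) * ((gridPoint a b M j - a : ℝ) : ℂ)) •
      act (NormedSpace.exp (-(Complex.I * (τ : ℂ) / 2) • gammaMat a b l)) (discreteCoef M U l)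

/-- The potential step `U ↦ (e^{-i ε τ G(x_j)} U_j)_j` with `G(x) = V(x) I₂ - A₁(x) σ₁`. -/
def potentialStep (a b : ℝ) (V A₁ : ℝ → ℝ) (ε τ : ℝ) (M : ℕ) (U : Fin (M + 1) → Spinor) :
    Fin (M + 1) → Spinor :=
  fun j => act (NormedSpace.exp (-(Complex.I * (ε : ℂ) * (τ : ℂ)) •
    ((V (gridPoint a b M j) : ℂ) • (1 : Matrix (Fin 2) (Fin 2) ℂ)
      - (A₁ (gridPoint a b M j) : ℂ) • sigma1))) (U j)

/-- The TSFP approximations `Φⁿ = (Φⁿ_0, …, Φⁿ_M)`, with `Φ⁰_j = Φ₀(x_j)`. -/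
def tsfp (a b : ℝ) (V A₁ : ℝ → ℝ) (ε τ : ℝ) (M : ℕ) (Φ₀ : ℝ → Spinor) :
    ℕ → Fin (M + 1) → Spinor
  | 0 => fun j => Φ₀ (gridPoint a b M j)
  | n + 1 => freeHalfStep a b τ M
      (potentialStep a b V A₁ ε τ M (freeHalfStep a b τ M (tsfp a b V A₁ ε τ M Φ₀ n)))

end DiracTSFP

end

open DiracTSFP

noncomputable section
namespace DiracTSFP

/-! ### Square-summable sequences -/

section SquareSummable

variable {E : Type*} [NormedAddCommGroup E]

/-- Square-summable sequences indexed by `ℤ`. -/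
abbrev ellTwo (E : Type*) [NormedAddCommGroup E] : Type _ := lp (fun _ : ℤ => E) 2

lemma memℓp_two_of_sum_le {f : ℤ → E} {C : ℝ} (h : ∀ s : Finset ℤ, ∑ l ∈ s, ‖f l‖ ^ 2 ≤ C) :
    Memℓp f 2 := by
  refine memℓp_gen' (C := C) fun s => ?_
  simpa using h s

lemma memℓp_two_of_summable {f : ℤ → E} (h : Summable fun l => ‖f l‖ ^ 2) : Memℓp f 2 := by
  refine memℓp_gen ?_
  simpa using h

lemma ellTwo.hasSum_sq (v : ellTwo E) : HasSum (fun l => ‖v l‖ ^ 2) (‖v‖ ^ 2) := by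
  have := lp.hasSum_norm (p := 2) (by simp) v
  simpa using this

lemma ellTwo.sum_sq_le (v : ellTwo E) (s : Finset ℤ) : ∑ l ∈ s, ‖v l‖ ^ 2 ≤ ‖v‖ ^ 2 :=
  sum_le_hasSum s (fun _ _ => by positivity) v.hasSum_sq

lemma ellTwo.norm_le_of_sum_sq_le {v : ellTwo E} {B : ℝ} (hB : 0 ≤ B)
    (h : ∀ s : Finset ℤ, ∑ l ∈ s, ‖v l‖ ^ 2 ≤ B ^ 2) : ‖v‖ ≤ B := by
  refine lp.norm_le_of_forall_sum_le (p := 2) (by simp) hB fun s => ?_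
  simpa using h s

lemma ellTwo.norm_mono {F : Type*} [NormedAddCommGroup F] {v : ellTwo E} {w : ellTwo F}
    (h : ∀ l, ‖v l‖ ≤ ‖w l‖) : ‖v‖ ≤ ‖w‖ :=
  lp.norm_mono (by simp) h

lemma ellTwo.ext {v w : ellTwo E} (h : ∀ l, v l = w l) : v = w := lp.ext (funext h)

@[simp] lemma ellTwo.add_apply (v w : ellTwo E) (l : ℤ) : (v + w) l = v l + w l := rfl

@[simp] lemma ellTwo.sub_apply (v w : ellTwo E) (l : ℤ) : (v - w) l = v l - w l := rfl

@[simp] lemma ellTwo.smul_apply {𝕜 : Type*} [NormedField 𝕜] [NormedSpace 𝕜 E] (c : 𝕜)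
    (v : ellTwo E) (l : ℤ) : (c • v) l = c • v l := rfl

end SquareSummable

section Operators

variable {E : Type*} [NormedAddCommGroup E] [NormedSpace ℂ E]

lemma memℓp_diag {D : ℤ → E →L[ℂ] E} {C : ℝ} (hC : ∀ l, ‖D l‖ ≤ C) (v : ellTwo E) :
    Memℓp (fun l => D l (v l)) 2 := by
  refine memℓp_two_of_sum_le (C := (C * ‖v‖) ^ 2) fun s => ?_
  calc ∑ l ∈ s, ‖D l (v l)‖ ^ 2 ≤ ∑ l ∈ s, C ^ 2 * ‖v l‖ ^ 2 := by
        refine Finset.sum_le_sum fun l _ => ?_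
        rw [← mul_pow]
        gcongr
        exact (D l).le_of_opNorm_le (hC l) _
    _ = C ^ 2 * ∑ l ∈ s, ‖v l‖ ^ 2 := by rw [Finset.mul_sum]
    _ ≤ C ^ 2 * ‖v‖ ^ 2 := by gcongr; exact v.sum_sq_le s
    _ = _ := by ring

open Classical in
/-- The operator `v ↦ (D_l v_l)_l` defined by a bounded family of operators. -/
def diagOp (D : ℤ → E →L[ℂ] E) : ellTwo E →L[ℂ] ellTwo E :=
  if h : ∃ C, 0 ≤ C ∧ ∀ l, ‖D l‖ ≤ C then
    LinearMap.mkContinuous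
      { toFun := fun v => ⟨fun l => D l (v l), memℓp_diag h.choose_spec.2 v⟩
        map_add' := fun v w => ellTwo.ext fun l => by
          change D l ((v + w : ellTwo E) l) = D l (v l) + D l (w l)
          rw [ellTwo.add_apply, map_add]
        map_smul' := fun c v => ellTwo.ext fun l => by
          change D l ((c • v : ellTwo E) l) = c • D l (v l)
          rw [ellTwo.smul_apply, map_smul] } h.choose
      fun v => by
        refine ellTwo.norm_le_of_sum_sq_le (mul_nonneg h.choose_spec.1 (norm_nonneg _))
          fun s => ?_
        calc ∑ l ∈ s, ‖D l (v l)‖ ^ 2 ≤ ∑ l ∈ s, h.choose ^ 2 * ‖v l‖ ^ 2 := by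
              refine Finset.sum_le_sum fun l _ => ?_
              rw [← mul_pow]
              gcongr
              exact (D l).le_of_opNorm_le (h.choose_spec.2 l) _
          _ = h.choose ^ 2 * ∑ l ∈ s, ‖v l‖ ^ 2 := by rw [Finset.mul_sum]
          _ ≤ h.choose ^ 2 * ‖v‖ ^ 2 := by gcongr; exact v.sum_sq_le s
          _ = _ := by ring
  else 0

lemma diagOp_apply {D : ℤ → E →L[ℂ] E} {C : ℝ} (hC : ∀ l, ‖D l‖ ≤ C) (v : ellTwo E) (l : ℤ) :
    diagOp D v l = D l (v l) := by
  have h : ∃ C, 0 ≤ C ∧ ∀ l, ‖D l‖ ≤ C := ⟨C, (norm_nonneg _).trans (hC 0), hC⟩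
  rw [diagOp, dif_pos h]
  rfl

lemma norm_diagOp_le {D : ℤ → E →L[ℂ] E} {C : ℝ} (hC : ∀ l, ‖D l‖ ≤ C) : ‖diagOp D‖ ≤ C := by
  have hC0 : 0 ≤ C := (norm_nonneg _).trans (hC 0)
  refine ContinuousLinearMap.opNorm_le_bound _ hC0 fun v => ?_
  refine ellTwo.norm_le_of_sum_sq_le (by positivity) fun s => ?_
  calc ∑ l ∈ s, ‖diagOp D v l‖ ^ 2 ≤ ∑ l ∈ s, C ^ 2 * ‖v l‖ ^ 2 := by
        refine Finset.sum_le_sum fun l _ => ?_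
        rw [← mul_pow, diagOp_apply hC]
        gcongr
        exact (D l).le_of_opNorm_le (hC l) _
    _ = C ^ 2 * ∑ l ∈ s, ‖v l‖ ^ 2 := by rw [Finset.mul_sum]
    _ ≤ C ^ 2 * ‖v‖ ^ 2 := by gcongr; exact v.sum_sq_le s
    _ = _ := by ring

/-- The shift `v ↦ (v_{l - j})_l`. -/
def shiftOp (j : ℤ) : ellTwo E →L[ℂ] ellTwo E :=
  LinearMap.mkContinuous
    { toFun := fun v => ⟨fun l => v (l - j), memℓp_two_of_summable
        ((Equiv.subRight j).summable_iff.2 v.hasSum_sq.summable)⟩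
      map_add' := fun v w => rfl
      map_smul' := fun c v => rfl } 1
    fun v => by
      rw [one_mul]
      refine ellTwo.norm_le_of_sum_sq_le (norm_nonneg v) fun s => ?_
      have := (Equiv.subRight j).hasSum_iff.2 v.hasSum_sq
      exact sum_le_hasSum s (fun _ _ => sq_nonneg _) this

lemma shiftOp_apply (j : ℤ) (v : ellTwo E) (l : ℤ) : shiftOp j v l = v (l - j) := rfl

lemma norm_shiftOp_le (j : ℤ) : ‖(shiftOp j : ellTwo E →L[ℂ] ellTwo E)‖ ≤ 1 :=
  LinearMap.mkContinuous_norm_le _ zero_le_one _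

/-- Convolution `v ↦ (∑_j g_j v_{l - j})_l` with a summable sequence of operators. -/
def convOp (g : ℤ → E →L[ℂ] E) : ellTwo E →L[ℂ] ellTwo E :=
  ∑' j, (diagOp fun _ => g j) ∘L shiftOp j

lemma norm_convOp_term_le (g : ℤ → E →L[ℂ] E) (j : ℤ) :
    ‖(diagOp fun _ => g j) ∘L shiftOp j‖ ≤ ‖g j‖ := by
  refine (ContinuousLinearMap.opNorm_comp_le _ _).trans ?_
  have h1 : ‖diagOp fun _ => g j‖ ≤ ‖g j‖ := norm_diagOp_le fun _ => le_rfl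
  have h2 := norm_shiftOp_le (E := E) j
  nlinarith [norm_nonneg (diagOp fun _ => g j), norm_nonneg (shiftOp (E := E) j)]

lemma norm_convOp_le {g : ℤ → E →L[ℂ] E} (hg : Summable fun j => ‖g j‖) :
    ‖convOp g‖ ≤ ∑' j, ‖g j‖ :=
  tsum_of_norm_bounded hg.hasSum (norm_convOp_term_le g)

variable [CompleteSpace E]

lemma hasSum_convOp {g : ℤ → E →L[ℂ] E} (hg : Summable fun j => ‖g j‖) :
    HasSum (fun j => (diagOp fun _ => g j) ∘L shiftOp j) (convOp g) :=
  (Summable.of_norm_bounded hg (norm_convOp_term_le g)).hasSum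

lemma hasSum_convOp_apply {g : ℤ → E →L[ℂ] E} (hg : Summable fun j => ‖g j‖) (v : ellTwo E)
    (l : ℤ) : HasSum (fun j => g j (v (l - j))) (convOp g v l) := by
  have h1 := (hasSum_convOp hg).mapL ((ContinuousLinearMap.apply ℂ (ellTwo E)) v)
  have h2 := h1.mapL (lp.evalCLM ℂ (fun _ : ℤ => E) 2 l)
  have h3 : (fun j => g j (v (l - j))) = fun j => (diagOp (fun _ => g j) (shiftOp j v)) l := by
    funext j
    rw [diagOp_apply fun _ => le_rfl, shiftOp_apply]
  rw [h3]
  exact h2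

lemma intertwine_exp {X Y : Type*} [NormedAddCommGroup X] [NormedSpace ℂ X] [CompleteSpace X]
    [NormedAddCommGroup Y] [NormedSpace ℂ Y] [CompleteSpace Y] (L : X →L[ℂ] Y) (A : X →L[ℂ] X)
    (B : Y →L[ℂ] Y) (h : L ∘L A = B ∘L L) :
    L ∘L NormedSpace.exp A = NormedSpace.exp B ∘L L := by
  have hpow : ∀ n : ℕ, L ∘L (A ^ n) = (B ^ n) ∘L L := by
    intro n
    induction n with
    | zero => rfl
    | succ n ih =>
      ext x
      have h1 := DFunLike.congr_fun ih (A x)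
      have h2 := DFunLike.congr_fun h x
      simp only [ContinuousLinearMap.comp_apply] at h1 h2
      rw [pow_succ, pow_succ]
      simp only [ContinuousLinearMap.comp_apply, mul_apply_eq_comp]
      rw [h1, h2]
  have hA := (NormedSpace.exp_series_hasSum_exp' (𝕂 := ℂ) A).mapL (ContinuousLinearMap.compL ℂ X X Y L)
  have hB := (NormedSpace.exp_series_hasSum_exp' (𝕂 := ℂ) B).mapL
    ((ContinuousLinearMap.compL ℂ X Y Y).flip L)
  have hterm : ∀ n : ℕ, ContinuousLinearMap.compL ℂ X X Y L (((n.factorial : ℂ)⁻¹) • A ^ n)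
      = (ContinuousLinearMap.compL ℂ X Y Y).flip L (((n.factorial : ℂ)⁻¹) • B ^ n) := by
    intro n
    change L ∘L (_ • A ^ n) = (_ • B ^ n) ∘L L
    rw [ContinuousLinearMap.comp_smul, ContinuousLinearMap.smul_comp, hpow]
  simp only [hterm] at hA
  exact hA.unique hB

lemma norm_exp_sub_one_le {X : Type*} [NormedRing X] [NormedAlgebra ℂ X] [CompleteSpace X]
    (A : X) : ‖NormedSpace.exp A - 1‖ ≤ ‖A‖ * Real.exp ‖A‖ := by
  have h := (hasSum_nat_add_iff' 1).2 (NormedSpace.exp_series_hasSum_exp' (𝕂 := ℂ) A)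
  have hr := (NormedSpace.expSeries_div_hasSum_exp (𝔸 := ℝ) ‖A‖).mul_left ‖A‖
  rw [← Real.exp_eq_exp_ℝ] at hr
  have : NormedSpace.exp A - 1
      = NormedSpace.exp A - ∑ i ∈ Finset.range 1, ((Nat.factorial i : ℂ)⁻¹) • A ^ i := by simp
  rw [this, ← h.tsum_eq]
  refine tsum_of_norm_bounded hr fun n => ?_
  rw [norm_smul, norm_inv, Complex.norm_natCast, ← mul_div_assoc, ← pow_succ', div_eq_inv_mul]
  have h1 : ‖A ^ (n + 1)‖ ≤ ‖A‖ ^ (n + 1) := norm_pow_le' A (Nat.succ_pos n)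
  have h2 : ((Nat.factorial (n + 1) : ℝ))⁻¹ ≤ ((Nat.factorial n : ℝ))⁻¹ := by
    gcongr
    exact Nat.le_succ n
  gcongr

end Operators

end DiracTSFP
end

noncomputable section
namespace DiracTSFP

set_option linter.unusedSectionVars false

/-! ### Sobolev weights -/

/-- The weight `(1 + μ_l²)^{1/2}`. -/
def weight (a b : ℝ) (l : ℤ) : ℝ := √(1 + freq a b l ^ 2)

lemma weight_sq (a b : ℝ) (l : ℤ) : weight a b l ^ 2 = 1 + freq a b l ^ 2 :=
  Real.sq_sqrt (by positivity)

lemma one_le_weight (a b : ℝ) (l : ℤ) : 1 ≤ weight a b l :=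
  Real.one_le_sqrt.2 (by nlinarith [sq_nonneg (freq a b l)])

lemma weight_pos (a b : ℝ) (l : ℤ) : 0 < weight a b l :=
  zero_lt_one.trans_le (one_le_weight a b l)

lemma abs_freq_le_weight (a b : ℝ) (l : ℤ) : |freq a b l| ≤ weight a b l :=
  Real.abs_le_sqrt (by linarith)

lemma freq_add (a b : ℝ) (j l : ℤ) : freq a b (j + l) = freq a b j + freq a b l := by
  simp only [freq, Int.cast_add]
  ring

lemma freq_sub (a b : ℝ) (j l : ℤ) : freq a b (j - l) = freq a b j - freq a b l := by
  simp only [freq, Int.cast_sub]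
  ring

lemma weight_le_add (a b : ℝ) (j l : ℤ) : weight a b l ≤ weight a b (l - j) + weight a b j := by
  have h1 := weight_pos a b (l - j)
  have h2 := weight_pos a b j
  refine Real.sqrt_le_iff.2 ⟨by positivity, ?_⟩
  have e1 := weight_sq a b (l - j)
  have e2 := weight_sq a b j
  have e3 := abs_freq_le_weight a b (l - j)
  have e4 := abs_freq_le_weight a b j
  have e5 : freq a b l = freq a b (l - j) + freq a b j := by rw [freq_sub]; ring
  have e6 : freq a b (l - j) * freq a b j ≤ weight a b (l - j) * weight a b j :=
    (le_abs_self _).trans (by rw [abs_mul]; gcongr)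
  rw [e5]
  nlinarith

lemma weight_pow_le_add (a b : ℝ) (k : ℕ) (j l : ℤ) :
    weight a b l ^ k ≤ 2 ^ k * (weight a b (l - j) ^ k + weight a b j ^ k) := by
  have h1 := weight_pos a b (l - j)
  have h2 := weight_pos a b j
  calc weight a b l ^ k ≤ (weight a b (l - j) + weight a b j) ^ k := by
        gcongr
        · exact (weight_pos a b l).le
        · exact weight_le_add a b j l
    _ ≤ 2 ^ (k - 1) * (weight a b (l - j) ^ k + weight a b j ^ k) :=
        add_pow_le h1.le h2.le k
    _ ≤ _ := by
        gcongr
        · norm_num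
        · omega

lemma summable_inv_weight_sq {a b : ℝ} (hab : a < b) :
    Summable fun l : ℤ => (weight a b l ^ 2)⁻¹ := by
  have h : Summable fun l : ℤ => (2 * Real.pi / (b - a))⁻¹ ^ 2 * |(l : ℝ)| ^ (-2 : ℝ) :=
    (Real.summable_abs_int_rpow one_lt_two).mul_left _
  have h' : Summable fun l : ℤ =>
      (2 * Real.pi / (b - a))⁻¹ ^ 2 * |(l : ℝ)| ^ (-2 : ℝ) + if l = 0 then 1 else 0 :=
    h.add (hasSum_ite_eq 0 1).summable
  refine h'.of_nonneg_of_le (fun l => by have := weight_pos a b l; positivity) fun l => ?_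
  have hba : 0 < b - a := sub_pos.2 hab
  by_cases hl : l = 0
  · subst hl
    rw [weight_sq]
    simp [freq]
  · rw [if_neg hl, add_zero, Real.rpow_neg (abs_nonneg _), weight_sq, Real.rpow_two]
    have hl' : (0 : ℝ) < |(l : ℝ)| := by positivity
    have e : freq a b l ^ 2 = (2 * Real.pi / (b - a)) ^ 2 * |(l : ℝ)| ^ 2 := by
      rw [sq_abs, freq]; ring
    have hpi := Real.pi_pos
    rw [inv_pow, ← mul_inv, e]
    gcongr
    linarith

section Sobolev

variable {E : Type*} [NormedAddCommGroup E] [NormedSpace ℂ E]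

/-- The sequence `v` lies in `H^k` with norm at most `B`. -/
def SobolevLE (a b : ℝ) (k : ℕ) (v : ellTwo E) (B : ℝ) : Prop :=
  0 ≤ B ∧ ∀ s : Finset ℤ, ∑ l ∈ s, (weight a b l ^ k * ‖v l‖) ^ 2 ≤ B ^ 2

/-- The isomorphism `(v_l) ↦ ((1 + μ_l²)^{-k/2} v_l)` of `L²` onto `H^k`, as an operator on
`L²`. -/
def lift (a b : ℝ) (k : ℕ) : ellTwo E →L[ℂ] ellTwo E :=
  diagOp fun l => ((((weight a b l) ^ k)⁻¹ : ℝ) : ℂ) • ContinuousLinearMap.id ℂ E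

lemma norm_lift_symbol_le (a b : ℝ) (k : ℕ) (l : ℤ) :
    ‖((((weight a b l) ^ k)⁻¹ : ℝ) : ℂ) • ContinuousLinearMap.id ℂ E‖ ≤ 1 := by
  have h := one_le_weight a b l
  refine ContinuousLinearMap.opNorm_le_bound _ zero_le_one fun v => ?_
  change ‖((((weight a b l) ^ k)⁻¹ : ℝ) : ℂ) • v‖ ≤ _
  rw [norm_smul, Complex.norm_real, Real.norm_of_nonneg (by positivity)]
  gcongr
  exact inv_le_one_of_one_le₀ (one_le_pow₀ h)

lemma lift_apply (a b : ℝ) (k : ℕ) (v : ellTwo E) (l : ℤ) :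
    lift a b k v l = ((((weight a b l) ^ k)⁻¹ : ℝ) : ℂ) • v l := by
  rw [lift, diagOp_apply (norm_lift_symbol_le a b k)]
  rfl

lemma weight_mul_norm_lift_apply (a b : ℝ) (k : ℕ) (v : ellTwo E) (l : ℤ) :
    weight a b l ^ k * ‖lift a b k v l‖ = ‖v l‖ := by
  have h := weight_pos a b l
  rw [lift_apply, norm_smul, Complex.norm_real, Real.norm_of_nonneg (by positivity)]
  field_simp

lemma lift_injective (a b : ℝ) (k : ℕ) : Function.Injective (lift (E := E) a b k) := by
  intro v w hvw
  refine ellTwo.ext fun l => ?_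
  have h : lift a b k v l = lift a b k w l := by rw [hvw]
  have hw := weight_pos a b l
  rw [lift_apply, lift_apply] at h
  refine (smul_right_injective E (r := ((((weight a b l) ^ k)⁻¹ : ℝ) : ℂ)) ?_) h
  exact Complex.ofReal_ne_zero.2 (by positivity)

namespace SobolevLE

variable {a b : ℝ} {k : ℕ} {v w : ellTwo E} {B B' : ℝ}

lemma of_lift (y : ellTwo E) (h : ‖y‖ ≤ B) : SobolevLE a b k (lift a b k y) B := by
  refine ⟨(norm_nonneg y).trans h, fun s => ?_⟩
  simp_rw [weight_mul_norm_lift_apply]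
  refine (y.sum_sq_le s).trans ?_
  gcongr

lemma exists_lift (h : SobolevLE a b k v B) : ∃ y : ellTwo E, ‖y‖ ≤ B ∧ lift a b k y = v := by
  have hn : ∀ l, ‖((weight a b l ^ k : ℝ) : ℂ) • v l‖ = weight a b l ^ k * ‖v l‖ := fun l => by
    have := weight_pos a b l
    rw [norm_smul, Complex.norm_real, Real.norm_of_nonneg (by positivity)]
  have hm : Memℓp (fun l => ((weight a b l ^ k : ℝ) : ℂ) • v l) 2 :=
    memℓp_two_of_sum_le (C := B ^ 2) fun s => by simpa only [hn] using h.2 s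
  refine ⟨⟨_, hm⟩, ellTwo.norm_le_of_sum_sq_le h.1 fun s => ?_, ellTwo.ext fun l => ?_⟩
  · change ∑ l ∈ s, ‖((weight a b l ^ k : ℝ) : ℂ) • v l‖ ^ 2 ≤ _
    simpa only [hn] using h.2 s
  · rw [lift_apply]
    change _ • (((weight a b l ^ k : ℝ) : ℂ) • v l) = v l
    have := weight_pos a b l
    rw [smul_smul, ← Complex.ofReal_mul, inv_mul_cancel₀ (by positivity), Complex.ofReal_one,
      one_smul]

lemma mono (h : SobolevLE a b k v B) (hB : B ≤ B') : SobolevLE a b k v B' :=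
  ⟨h.1.trans hB, fun s => (h.2 s).trans (by have := h.1; gcongr)⟩

lemma of_le {F : Type*} [NormedAddCommGroup F] [NormedSpace ℂ F] {k' : ℕ} {v' : ellTwo F}
    (h : SobolevLE a b k v B) {C : ℝ} (hC : 0 ≤ C)
    (hle : ∀ l, weight a b l ^ k' * ‖v' l‖ ≤ C * (weight a b l ^ k * ‖v l‖)) :
    SobolevLE a b k' v' (C * B) := by
  refine ⟨mul_nonneg hC h.1, fun s => ?_⟩
  calc ∑ l ∈ s, (weight a b l ^ k' * ‖v' l‖) ^ 2
      ≤ ∑ l ∈ s, C ^ 2 * (weight a b l ^ k * ‖v l‖) ^ 2 := by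
        refine Finset.sum_le_sum fun l _ => ?_
        rw [← mul_pow]
        have := weight_pos a b l
        exact pow_le_pow_left₀ (by positivity) (hle l) 2
    _ = C ^ 2 * ∑ l ∈ s, (weight a b l ^ k * ‖v l‖) ^ 2 := by rw [Finset.mul_sum]
    _ ≤ C ^ 2 * B ^ 2 := by gcongr; exact h.2 s
    _ = _ := by ring

lemma of_order_le {k' : ℕ} (h : SobolevLE a b k v B) (hk : k' ≤ k) : SobolevLE a b k' v B := by
  have := h.of_le (k' := k') (v' := v) zero_le_one fun l => by
    have := one_le_weight a b l
    rw [one_mul]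
    gcongr
  rwa [one_mul] at this

lemma norm_le (h : SobolevLE a b k v B) : ‖v‖ ≤ B := by
  refine ellTwo.norm_le_of_sum_sq_le h.1 fun s => ?_
  simpa using (h.of_order_le (Nat.zero_le k)).2 s

lemma of_norm_le (h : ‖v‖ ≤ B) : SobolevLE a b 0 v B := by
  refine ⟨(norm_nonneg v).trans h, fun s => ?_⟩
  simp only [pow_zero, one_mul]
  refine (v.sum_sq_le s).trans ?_
  gcongr

lemma add (h : SobolevLE a b k v B) (h' : SobolevLE a b k w B') :
    SobolevLE a b k (v + w) (B + B') := by
  obtain ⟨y, hy, rfl⟩ := h.exists_lift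
  obtain ⟨z, hz, rfl⟩ := h'.exists_lift
  rw [← map_add]
  exact of_lift _ ((norm_add_le y z).trans (add_le_add hy hz))

lemma smul (h : SobolevLE a b k v B) (c : ℂ) : SobolevLE a b k (c • v) (‖c‖ * B) := by
  refine h.of_le (norm_nonneg c) fun l => le_of_eq ?_
  rw [ellTwo.smul_apply, norm_smul]
  ring

lemma neg (h : SobolevLE a b k v B) : SobolevLE a b k (-v) B := by
  simpa using h.smul (-1)

end SobolevLE

/-- The constant of the embedding of `H¹` into the sequences with absolutely summable Fourier
coefficients. -/
def embConst (a b : ℝ) : ℝ := √(∑' l : ℤ, (weight a b l ^ 2)⁻¹)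

lemma embConst_nonneg (a b : ℝ) : 0 ≤ embConst a b := Real.sqrt_nonneg _

lemma SobolevLE.sum_weight_mul_norm_le {a b : ℝ} (hab : a < b) {k : ℕ} {v : ellTwo E} {B : ℝ}
    (h : SobolevLE a b (k + 1) v B) (s : Finset ℤ) :
    ∑ l ∈ s, weight a b l ^ k * ‖v l‖ ≤ embConst a b * B := by
  have hcs := Finset.sum_mul_sq_le_sq_mul_sq s (fun l => (weight a b l)⁻¹)
    fun l => weight a b l ^ (k + 1) * ‖v l‖
  have e : ∀ l, (weight a b l)⁻¹ * (weight a b l ^ (k + 1) * ‖v l‖) = weight a b l ^ k * ‖v l‖ := by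
    intro l
    have := weight_pos a b l
    rw [pow_succ]
    field_simp
  simp_rw [e] at hcs
  refine abs_le_of_sq_le_sq' ?_ (mul_nonneg (embConst_nonneg a b) h.1) |>.2
  refine hcs.trans ?_
  rw [mul_pow]
  gcongr
  · rw [embConst, Real.sq_sqrt (tsum_nonneg fun l => by have := weight_pos a b l; positivity)]
    simp_rw [inv_pow]
    exact (summable_inv_weight_sq hab).sum_le_tsum s
      (fun l _ => by have := weight_pos a b l; positivity)
  · exact h.2 s

lemma SobolevLE.summable_weight_mul_norm {a b : ℝ} (hab : a < b) {k : ℕ} {v : ellTwo E} {B : ℝ}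
    (h : SobolevLE a b (k + 1) v B) : Summable fun l => weight a b l ^ k * ‖v l‖ :=
  summable_of_sum_le (fun l => by have := weight_pos a b l; positivity)
    (h.sum_weight_mul_norm_le hab)

lemma SobolevLE.summable_norm {a b : ℝ} (hab : a < b) {k : ℕ} (hk : 1 ≤ k) {v : ellTwo E} {B : ℝ}
    (h : SobolevLE a b k v B) : Summable fun l => ‖v l‖ := by
  simpa using (h.of_order_le hk).summable_weight_mul_norm (k := 0) hab

lemma SobolevLE.tsum_norm_le {a b : ℝ} (hab : a < b) {k : ℕ} (hk : 1 ≤ k) {v : ellTwo E} {B : ℝ}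
    (h : SobolevLE a b k v B) : ∑' l, ‖v l‖ ≤ embConst a b * B := by
  refine (h.summable_norm hab hk).tsum_le_of_sum_le fun s => ?_
  simpa using (h.of_order_le hk).sum_weight_mul_norm_le (k := 0) hab s

end Sobolev

end DiracTSFP
end

noncomputable section
namespace DiracTSFP

set_option linter.unusedSectionVars false

section Convolution

variable {E : Type*} [NormedAddCommGroup E] [NormedSpace ℂ E]

/-- The sequence of the norms of a square-summable sequence. -/
def normSeq (v : ellTwo E) : ellTwo ℂ :=
  ⟨fun l => (‖v l‖ : ℂ), memℓp_two_of_summable (by simpa using v.hasSum_sq.summable)⟩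

lemma norm_normSeq (v : ellTwo E) : ‖normSeq v‖ = ‖v‖ :=
  le_antisymm (ellTwo.norm_mono fun l => le_of_eq (by simp [normSeq]))
    (ellTwo.norm_mono fun l => le_of_eq (by simp [normSeq]))

/-- Young's inequality for the convolution of a summable with a square-summable sequence. -/
lemma exists_conv_norm {α : ℤ → ℝ} (hα0 : ∀ j, 0 ≤ α j) (hα : Summable α) (y : ellTwo E) :
    ∃ p : ellTwo ℂ, ‖p‖ ≤ (∑' j, α j) * ‖y‖ ∧
      ∀ l, HasSum (fun j => α j * ‖y (l - j)‖) (p l).re := by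
  have hn : ∀ j, ‖(α j : ℂ) • ContinuousLinearMap.id ℂ ℂ‖ = α j := fun j => by
    rw [norm_smul, Complex.norm_real, Real.norm_of_nonneg (hα0 j), ContinuousLinearMap.norm_id,
      mul_one]
  have hs : Summable fun j => ‖(α j : ℂ) • ContinuousLinearMap.id ℂ ℂ‖ := by simpa only [hn]
  refine ⟨convOp (fun j => (α j : ℂ) • ContinuousLinearMap.id ℂ ℂ) (normSeq y), ?_, fun l => ?_⟩
  · refine (ContinuousLinearMap.le_opNorm _ _).trans ?_
    rw [norm_normSeq]
    gcongr
    refine (norm_convOp_le hs).trans ?_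
    simp only [hn]
    exact le_rfl
  · have h := (hasSum_convOp_apply hs (normSeq y) l).mapL Complex.reCLM
    have e : ∀ j, Complex.reCLM (((α j : ℂ) • ContinuousLinearMap.id ℂ ℂ) (normSeq y (l - j)))
        = α j * ‖y (l - j)‖ := fun j => by
      change ((α j : ℂ) * (‖y (l - j)‖ : ℂ)).re = _
      rw [← Complex.ofReal_mul, Complex.ofReal_re]
    simp only [e] at h
    exact h

variable [CompleteSpace E]

lemma SobolevLE.convOp {a b : ℝ} (hab : a < b) {k : ℕ} (hk : 1 ≤ k) {g : ℤ → E →L[ℂ] E}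
    (hg : Summable fun j => ‖g j‖) {γ : ellTwo ℂ} (hγ : ∀ j, ‖γ j‖ = weight a b j ^ k * ‖g j‖)
    {v : ellTwo E} {B : ℝ} (h : SobolevLE a b k v B) :
    SobolevLE a b k (convOp g v) (2 ^ k * (∑' j, ‖g j‖ + embConst a b * ‖γ‖) * B) := by
  obtain ⟨y, hy, rfl⟩ := h.exists_lift
  obtain ⟨p, hp, hpl⟩ := exists_conv_norm (fun j => norm_nonneg (g j)) hg y
  have hvs := h.summable_norm hab hk
  obtain ⟨q, hq, hql⟩ := exists_conv_norm (fun j => norm_nonneg _) hvs γ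
  have hB := h.1
  have hgs : 0 ≤ ∑' j, ‖g j‖ := tsum_nonneg fun j => norm_nonneg _
  have hpq : SobolevLE a b 0 (p + q) ((∑' j, ‖g j‖ + embConst a b * ‖γ‖) * B) := by
    refine SobolevLE.of_norm_le ((norm_add_le p q).trans ?_)
    have h1 : ‖p‖ ≤ (∑' j, ‖g j‖) * B := hp.trans (by gcongr)
    have h2 : ‖q‖ ≤ (embConst a b * B) * ‖γ‖ := hq.trans (by gcongr; exact h.tsum_norm_le hab hk)
    linarith
  rw [mul_assoc]
  refine hpq.of_le (by positivity) fun l => ?_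
  have hql' : HasSum (fun j => ‖lift a b k y (l - j)‖ * (weight a b j ^ k * ‖g j‖)) (q l).re := by
    have := (Equiv.subLeft l).hasSum_iff.2 (hql l)
    simpa [Function.comp_def, hγ] using this
  have hsum := ((hpl l).add hql').mul_left ((2 : ℝ) ^ k)
  have hconv := (hasSum_convOp_apply hg (lift a b k y) l).const_smul ((weight a b l ^ k : ℝ) : ℂ)
  have hw := weight_pos a b l
  rw [pow_zero, one_mul]
  calc weight a b l ^ k * ‖DiracTSFP.convOp g (lift a b k y) l‖
      = ‖((weight a b l ^ k : ℝ) : ℂ) • DiracTSFP.convOp g (lift a b k y) l‖ := by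
        rw [norm_smul, Complex.norm_real, Real.norm_of_nonneg (by positivity)]
    _ ≤ 2 ^ k * ((p l).re + (q l).re) := by
        rw [← hconv.tsum_eq]
        refine tsum_of_norm_bounded hsum fun j => ?_
        rw [norm_smul, Complex.norm_real, Real.norm_of_nonneg (by positivity),
          ← weight_mul_norm_lift_apply a b k y (l - j)]
        have h1 : ‖g j (lift a b k y (l - j))‖ ≤ ‖g j‖ * ‖lift a b k y (l - j)‖ :=
          (g j).le_opNorm _
        have h2 := weight_pow_le_add a b k j l
        calc weight a b l ^ k * ‖g j (lift a b k y (l - j))‖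
            ≤ (2 ^ k * (weight a b (l - j) ^ k + weight a b j ^ k)) *
              (‖g j‖ * ‖lift a b k y (l - j)‖) := by
                have := weight_pos a b (l - j)
                have := weight_pos a b j
                gcongr
          _ = _ := by ring
    _ ≤ 2 ^ k * ‖(p + q) l‖ := by
        gcongr
        rw [← Complex.add_re, ellTwo.add_apply]
        exact Complex.re_le_norm _

lemma exists_lift_intertwine {a b : ℝ} {k : ℕ} {G : ellTwo E →L[ℂ] ellTwo E} {C : ℝ}
    (hG : ∀ v B, SobolevLE a b k v B → SobolevLE a b k (G v) (C * B)) :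
    ∃ G' : ellTwo E →L[ℂ] ellTwo E,
      (∀ y, ‖G' y‖ ≤ C * ‖y‖) ∧ lift a b k ∘L G' = G ∘L lift a b k := by
  have h : ∀ y : ellTwo E, ∃ z, ‖z‖ ≤ C * ‖y‖ ∧ lift a b k z = G (lift a b k y) := fun y =>
    (hG _ _ (SobolevLE.of_lift y le_rfl)).exists_lift
  choose f hf hfG using h
  refine ⟨LinearMap.mkContinuous
    { toFun := f
      map_add' := fun y z => lift_injective a b k (by simp only [map_add, hfG])
      map_smul' := fun c y => lift_injective a b k (by simp only [map_smul, hfG,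
        RingHom.id_apply]) } C hf, hf, ?_⟩
  ext1 y
  exact hfG y

lemma SobolevLE.exp_sub_one {a b : ℝ} {k : ℕ} {G : ellTwo E →L[ℂ] ellTwo E} {C : ℝ}
    (hC : 0 ≤ C) (hG : ∀ v B, SobolevLE a b k v B → SobolevLE a b k (G v) (C * B)) (c : ℂ)
    {v : ellTwo E} {B : ℝ} (h : SobolevLE a b k v B) :
    SobolevLE a b k ((NormedSpace.exp (c • G) - 1) v) (‖c‖ * C * Real.exp (‖c‖ * C) * B) := by
  obtain ⟨G', hG', hint⟩ := exists_lift_intertwine hG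
  obtain ⟨y, hy, rfl⟩ := h.exists_lift
  have hint' : lift a b k ∘L (c • G') = (c • G) ∘L lift a b k := by
    rw [ContinuousLinearMap.comp_smul, ContinuousLinearMap.smul_comp, hint]
  have he := DFunLike.congr_fun (intertwine_exp _ _ _ hint') y
  have hn : ‖c • G'‖ ≤ ‖c‖ * C := by
    rw [norm_smul]
    gcongr
    exact ContinuousLinearMap.opNorm_le_bound _ hC hG'
  have e : (NormedSpace.exp (c • G) - 1) (lift a b k y)
      = lift a b k ((NormedSpace.exp (c • G') - 1) y) := by
    change NormedSpace.exp (c • G) (lift a b k y) - lift a b k y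
      = lift a b k (NormedSpace.exp (c • G') y - y)
    rw [map_sub]
    exact congrArg (· - lift a b k y) he.symm
  rw [e]
  refine SobolevLE.of_lift _ ?_
  refine (ContinuousLinearMap.le_opNorm _ _).trans ?_
  gcongr
  refine (norm_exp_sub_one_le _).trans ?_
  gcongr

/-! ### Point values of Fourier series -/

/-- The Fourier mode `e^{i μ_l (x - a)}`. -/
def mode (a b : ℝ) (l : ℤ) (x : ℝ) : ℂ :=
  Complex.exp (Complex.I * (freq a b l : ℂ) * ((x - a : ℝ) : ℂ))

lemma mode_eq_exp_mul_I (a b : ℝ) (l : ℤ) (x : ℝ) :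
    mode a b l x = Complex.exp (((freq a b l * (x - a) : ℝ) : ℂ) * Complex.I) := by
  rw [mode]
  congr 1
  push_cast
  ring

@[simp] lemma norm_mode (a b : ℝ) (l : ℤ) (x : ℝ) : ‖mode a b l x‖ = 1 := by
  rw [mode_eq_exp_mul_I, Complex.norm_exp_ofReal_mul_I]

lemma mode_add (a b : ℝ) (j l : ℤ) (x : ℝ) :
    mode a b (j + l) x = mode a b j x * mode a b l x := by
  rw [mode, mode, mode, ← Complex.exp_add, freq_add]
  congr 1
  push_cast
  ring

/-- The value at `x` of the Fourier series with coefficients `v`. -/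
def evalSeries (a b x : ℝ) (v : ellTwo E) : E := ∑' l, mode a b l x • v l

lemma hasSum_evalSeries (a b x : ℝ) {v : ellTwo E} (hv : Summable fun l => ‖v l‖) :
    HasSum (fun l => mode a b l x • v l) (evalSeries a b x v) :=
  (Summable.of_norm_bounded hv fun l => by rw [norm_smul, norm_mode, one_mul]).hasSum

/-- The value at `x` of the operator-valued Fourier series with coefficients `g`. -/
def opValue (a b x : ℝ) (g : ℤ → E →L[ℂ] E) : E →L[ℂ] E := ∑' j, mode a b j x • g j

lemma hasSum_opValue (a b x : ℝ) {g : ℤ → E →L[ℂ] E} (hg : Summable fun l => ‖g l‖) :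
    HasSum (fun l => mode a b l x • g l) (opValue a b x g) :=
  (Summable.of_norm_bounded hg fun l => by rw [norm_smul, norm_mode, one_mul]).hasSum

lemma evalSeries_convOp (a b x : ℝ) {g : ℤ → E →L[ℂ] E} (hg : Summable fun l => ‖g l‖)
    {v : ellTwo E} (hv : Summable fun l => ‖v l‖) :
    evalSeries a b x (convOp g v) = opValue a b x g (evalSeries a b x v) := by
  obtain ⟨f, hfdef⟩ : ∃ f : ℤ × ℤ → E,
      ∀ j l, f (j, l) = (mode a b j x * mode a b l x) • g j (v l) :=
    ⟨fun p => (mode a b p.1 x * mode a b p.2 x) • g p.1 (v p.2), fun _ _ => rfl⟩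
  have hf : Summable f := by
    refine Summable.of_norm_bounded (hg.mul_of_nonneg hv (fun _ => norm_nonneg _)
      fun _ => norm_nonneg _) fun p => ?_
    obtain ⟨j, l⟩ := p
    rw [hfdef, norm_smul, norm_mul, norm_mode, norm_mode, one_mul, one_mul]
    exact (g j).le_opNorm _
  have h1 : ∑' p, f p = opValue a b x g (evalSeries a b x v) := by
    rw [hf.tsum_prod]
    have : ∀ j, ∑' l, f (j, l) = (mode a b j x • g j) (evalSeries a b x v) := fun j => by
      rw [← ((hasSum_evalSeries a b x hv).mapL (mode a b j x • g j)).tsum_eq]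
      refine tsum_congr fun l => ?_
      rw [hfdef, map_smul, smul_apply, smul_smul, mul_comm]
    simp_rw [this]
    exact ((hasSum_opValue a b x hg).mapL
      (ContinuousLinearMap.apply ℂ E (evalSeries a b x v))).tsum_eq
  obtain ⟨e, he⟩ : ∃ e : ℤ × ℤ ≃ ℤ × ℤ, ∀ l j, e (l, j) = (j, l - j) :=
    ⟨{ toFun := fun p => (p.2, p.1 - p.2)
       invFun := fun p => (p.1 + p.2, p.1)
       left_inv := fun p => by simp
       right_inv := fun p => by simp }, fun _ _ => rfl⟩
  have hfe : Summable fun p => f (e p) := e.summable_iff.2 hf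
  rw [← h1, ← e.tsum_eq f, hfe.tsum_prod]
  refine tsum_congr fun l => ?_
  have h2 := (hasSum_convOp_apply hg v l).const_smul (mode a b l x)
  rw [← h2.tsum_eq]
  refine tsum_congr fun j => ?_
  rw [he, hfdef, ← mode_add, add_sub_cancel]

/-- Point evaluation as a bounded functional on `H^k`, `k ≥ 1`. -/
lemma exists_evalCLM {a b : ℝ} (hab : a < b) {k : ℕ} (hk : 1 ≤ k) (x : ℝ) :
    ∃ L : ellTwo E →L[ℂ] E, ∀ y, L y = evalSeries a b x (lift a b k y) := by
  have hs : ∀ y : ellTwo E, Summable fun l => ‖lift a b k y l‖ := fun y =>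
    (SobolevLE.of_lift y le_rfl).summable_norm hab hk
  refine ⟨LinearMap.mkContinuous
    { toFun := fun y => evalSeries a b x (lift a b k y)
      map_add' := fun y z => ?_
      map_smul' := fun c y => ?_ } (embConst a b) fun y => ?_, fun y => rfl⟩
  · rw [← ((hasSum_evalSeries a b x (hs y)).add (hasSum_evalSeries a b x (hs z))).tsum_eq]
    refine tsum_congr fun l => ?_
    rw [map_add, ellTwo.add_apply, smul_add]
  · rw [RingHom.id_apply, ← ((hasSum_evalSeries a b x (hs y)).const_smul c).tsum_eq]
    refine tsum_congr fun l => ?_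
    rw [map_smul, ellTwo.smul_apply, smul_comm]
  · refine le_trans ?_ ((SobolevLE.of_lift y le_rfl).tsum_norm_le hab hk)
    refine tsum_of_norm_bounded (hs y).hasSum fun l => ?_
    rw [norm_smul, norm_mode, one_mul]

lemma evalSeries_exp_convOp {a b : ℝ} (hab : a < b) {k : ℕ} (hk : 1 ≤ k) (x : ℝ)
    {g : ℤ → E →L[ℂ] E} (hg : Summable fun l => ‖g l‖) {C : ℝ}
    (hG : ∀ v B, SobolevLE a b k v B → SobolevLE a b k (convOp g v) (C * B)) (c : ℂ)
    {v : ellTwo E} {B : ℝ} (h : SobolevLE a b k v B) :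
    evalSeries a b x (NormedSpace.exp (c • convOp g) v)
      = NormedSpace.exp (c • opValue a b x g) (evalSeries a b x v) := by
  obtain ⟨G', hG', hint⟩ := exists_lift_intertwine hG
  obtain ⟨y, hy, rfl⟩ := h.exists_lift
  obtain ⟨L, hL⟩ := exists_evalCLM (E := E) hab hk x
  have hint' : lift a b k ∘L (c • G') = (c • convOp g) ∘L lift a b k := by
    rw [ContinuousLinearMap.comp_smul, ContinuousLinearMap.smul_comp, hint]
  have hint2 : L ∘L (c • G') = (c • opValue a b x g) ∘L L := by
    ext y
    have h1 := DFunLike.congr_fun hint y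
    simp only [ContinuousLinearMap.comp_apply] at h1
    change L (c • G' y) = c • opValue a b x g (L y)
    rw [map_smul, hL, hL, h1,
      evalSeries_convOp a b x hg ((SobolevLE.of_lift y le_rfl).summable_norm hab hk)]
  have e1 := DFunLike.congr_fun (intertwine_exp _ _ _ hint') y
  have e2 := DFunLike.congr_fun (intertwine_exp _ _ _ hint2) y
  simp only [ContinuousLinearMap.comp_apply] at e1 e2
  rw [← e1, ← hL, e2, hL]

end Convolution

end DiracTSFP
end

noncomputable section
namespace DiracTSFP

set_option linter.unusedSectionVars false

/-! ### Unitary groups -/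

section UnitaryGroup

variable {E : Type*} [NormedAddCommGroup E]

section NormedSpace

variable [NormedSpace ℂ E]

/-- The operator `e^{-i s A}`. -/
def expI (A : E →L[ℂ] E) (s : ℝ) : E →L[ℂ] E := NormedSpace.exp ((-(Complex.I * s)) • A)

variable [CompleteSpace E]

lemma hasDerivAt_expI (A : E →L[ℂ] E) (s : ℝ) :
    HasDerivAt (fun s : ℝ => expI A s) (-(Complex.I • (expI A s * A))) s := by
  have h := (hasDerivAt_exp_smul_const (𝕂 := ℂ) A (-(Complex.I * s)))
  have h1 : HasDerivAt (fun s : ℝ => -(Complex.I * (s : ℂ))) (-(Complex.I * 1)) s :=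
    ((Complex.ofRealCLM.hasDerivAt (x := s)).const_mul Complex.I).neg
  have h2 := h.scomp s h1
  rw [mul_one, neg_smul] at h2
  exact h2

lemma expI_add (A : E →L[ℂ] E) (s t : ℝ) : expI A (s + t) = expI A s * expI A t := by
  let _ : NormedAlgebra ℚ (E →L[ℂ] E) := NormedAlgebra.restrictScalars ℚ ℂ _
  have hc : Commute ((-(Complex.I * s)) • A) ((-(Complex.I * t)) • A) :=
    ((Commute.refl A).smul_right _).smul_left _
  rw [expI, expI, expI, ← NormedSpace.exp_add_of_commute hc, ← add_smul]
  congr 2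
  push_cast
  ring

lemma expI_zero (A : E →L[ℂ] E) : expI A 0 = 1 := by
  rw [expI, Complex.ofReal_zero, mul_zero, neg_zero, zero_smul, NormedSpace.exp_zero]

lemma hasDerivAt_expI_apply (A : E →L[ℂ] E) (s : ℝ) (v : E) :
    HasDerivAt (fun s : ℝ => expI A s v) (expI A s (-(Complex.I • A v))) s := by
  have h : HasDerivAt (fun s : ℝ => expI A s v) ((-(Complex.I • (expI A s * A))) v) s :=
    ((ContinuousLinearMap.apply ℂ E v).restrictScalars ℝ).hasFDerivAt.comp_hasDerivAt s
      (hasDerivAt_expI A s)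
  convert h using 1
  rw [map_neg, map_smul]
  rfl

end NormedSpace

lemma norm_expI_apply [InnerProductSpace ℂ E] [CompleteSpace E] {A : E →L[ℂ] E}
    (hA : IsSelfAdjoint A) (s : ℝ) (v : E) :
    ‖expI A s v‖ = ‖v‖ := by
  have h : (-(Complex.I * s)) • A ∈ skewAdjoint (E →L[ℂ] E) := by
    rw [skewAdjoint.mem_iff, star_smul, hA.star_eq, ← neg_smul]
    congr 1
    simp
  let _ : NormedAlgebra ℚ (E →L[ℂ] E) := NormedAlgebra.restrictScalars ℚ ℂ _
  have hu := NormedSpace.exp_mem_unitary_of_mem_skewAdjoint h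
  exact ContinuousLinearMap.norm_map_of_mem_unitary hu v

end UnitaryGroup

/-! ### The free propagator -/

/-- A `2 × 2` matrix as a bounded operator on spinors. -/
abbrev matOp (A : Matrix (Fin 2) (Fin 2) ℂ) : Spinor →L[ℂ] Spinor :=
  Matrix.toEuclideanCLM (n := Fin 2) (𝕜 := ℂ) A

lemma act_eq_matOp (A : Matrix (Fin 2) (Fin 2) ℂ) (v : Spinor) : act A v = matOp A v := rfl

lemma matOp_exp (A : Matrix (Fin 2) (Fin 2) ℂ) :
    matOp (NormedSpace.exp A) = NormedSpace.exp (matOp A) := by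
  let _ : SeminormedRing (Matrix (Fin 2) (Fin 2) ℂ) := Matrix.linftyOpSemiNormedRing
  let _ : NormedRing (Matrix (Fin 2) (Fin 2) ℂ) := Matrix.linftyOpNormedRing
  let _ : NormedAlgebra ℂ (Matrix (Fin 2) (Fin 2) ℂ) := Matrix.linftyOpNormedAlgebra
  let _ : NormedAlgebra ℚ (Matrix (Fin 2) (Fin 2) ℂ) := NormedAlgebra.restrictScalars ℚ ℂ _
  let _ : Algebra ℚ (Spinor →L[ℂ] Spinor) := Algebra.compHom _ (algebraMap ℚ ℂ)
  have hc : Continuous (Matrix.toEuclideanCLM (n := Fin 2) (𝕜 := ℂ)) :=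
    LinearMap.continuous_of_finiteDimensional
      (Matrix.toEuclideanCLM (n := Fin 2) (𝕜 := ℂ)).toAlgEquiv.toLinearMap
  exact NormedSpace.map_exp (Matrix.toEuclideanCLM (n := Fin 2) (𝕜 := ℂ)) hc A

lemma matOp_smul (c : ℂ) (A : Matrix (Fin 2) (Fin 2) ℂ) : matOp (c • A) = c • matOp A :=
  map_smul (Matrix.toEuclideanCLM (n := Fin 2) (𝕜 := ℂ)) c A

lemma matOp_expI (A : Matrix (Fin 2) (Fin 2) ℂ) (s : ℝ) :
    matOp (NormedSpace.exp ((-(Complex.I * s)) • A)) = expI (matOp A) s := by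
  rw [matOp_exp, matOp_smul]
  rfl

lemma isSelfAdjoint_matOp {A : Matrix (Fin 2) (Fin 2) ℂ} (hA : A.IsHermitian) :
    IsSelfAdjoint (matOp A) := by
  rw [isSelfAdjoint_iff, ← map_star]
  exact congrArg _ hA

lemma sigma1_isHermitian : sigma1.IsHermitian := by
  ext i j
  fin_cases i <;> fin_cases j <;> simp [sigma1]

lemma sigma3_isHermitian : sigma3.IsHermitian := by
  ext i j
  fin_cases i <;> fin_cases j <;> simp [sigma3]

lemma gammaMat_isHermitian (a b : ℝ) (l : ℤ) : (gammaMat a b l).IsHermitian := by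
  refine Matrix.IsHermitian.add ?_ sigma3_isHermitian
  rw [Matrix.IsHermitian, Matrix.conjTranspose_smul, sigma1_isHermitian.eq]
  simp

lemma matOp_apply (A : Matrix (Fin 2) (Fin 2) ℂ) (v : Spinor) (i : Fin 2) :
    matOp A v i = A i 0 * v 0 + A i 1 * v 1 := by
  change (A.mulVec v.ofLp) i = _
  rw [Matrix.mulVec, dotProduct, Fin.sum_univ_two]

lemma norm_gammaMat_apply (a b : ℝ) (l : ℤ) (v : Spinor) :
    ‖matOp (gammaMat a b l) v‖ = weight a b l * ‖v‖ := by
  have hw := weight_pos a b l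
  refine (pow_left_inj₀ (norm_nonneg _) (by positivity) two_ne_zero).1 ?_
  rw [mul_pow, EuclideanSpace.norm_sq_eq, EuclideanSpace.norm_sq_eq, Fin.sum_univ_two,
    Fin.sum_univ_two, matOp_apply, matOp_apply, weight_sq]
  simp only [gammaMat, sigma1, sigma3, Matrix.add_apply, Matrix.smul_apply, Matrix.of_apply,
    Matrix.cons_val', Matrix.cons_val_zero, Matrix.cons_val_one, Matrix.cons_val_fin_one,
    smul_eq_mul, ← Complex.normSq_eq_norm_sq, Complex.normSq_apply]
  simp
  ring

/-- The free propagator `e^{-i s Γ_l}` of the mode `l`. -/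
def freeMode (a b s : ℝ) (l : ℤ) : Spinor →L[ℂ] Spinor := expI (matOp (gammaMat a b l)) s

lemma norm_freeMode_apply (a b s : ℝ) (l : ℤ) (v : Spinor) : ‖freeMode a b s l v‖ = ‖v‖ :=
  norm_expI_apply (isSelfAdjoint_matOp (gammaMat_isHermitian a b l)) s v

lemma norm_freeMode_le (a b s : ℝ) (l : ℤ) : ‖freeMode a b s l‖ ≤ 1 :=
  ContinuousLinearMap.opNorm_le_bound _ zero_le_one fun v => by
    rw [norm_freeMode_apply, one_mul]

lemma freeMode_add (a b s t : ℝ) (l : ℤ) (v : Spinor) :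
    freeMode a b (s + t) l v = freeMode a b s l (freeMode a b t l v) :=
  DFunLike.congr_fun (expI_add (matOp (gammaMat a b l)) s t) v

lemma freeMode_zero (a b : ℝ) (l : ℤ) (v : Spinor) : freeMode a b 0 l v = v :=
  DFunLike.congr_fun (expI_zero (matOp (gammaMat a b l))) v

lemma hasDerivAt_freeMode (a b s : ℝ) (l : ℤ) (v : Spinor) :
    HasDerivAt (fun s : ℝ => freeMode a b s l v)
      (freeMode a b s l (-(Complex.I • matOp (gammaMat a b l) v))) s :=
  hasDerivAt_expI_apply _ s v

lemma norm_freeMode_sub_le (a b s : ℝ) (l : ℤ) (v : Spinor) :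
    ‖freeMode a b s l v - v‖ ≤ |s| * (weight a b l * ‖v‖) := by
  have h := convex_univ.norm_image_sub_le_of_norm_hasDerivWithin_le (C := weight a b l * ‖v‖)
    (f := fun s : ℝ => freeMode a b s l v)
    (fun s _ => (hasDerivAt_freeMode a b s l v).hasDerivWithinAt)
    (fun s _ => by
      rw [norm_freeMode_apply, norm_neg, norm_smul, Complex.norm_I, one_mul, norm_gammaMat_apply])
    (mem_univ 0) (mem_univ s)
  simp only [freeMode_zero, sub_zero, Real.norm_eq_abs] at h
  rw [mul_comm]
  exact h

/-- The free propagator `e^{-i s T}`, `T = -i σ₁ ∂ₓ + σ₃`, on Fourier coefficients. -/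
def propagator (a b s : ℝ) : ellTwo Spinor →L[ℂ] ellTwo Spinor := diagOp (freeMode a b s)

@[simp] lemma propagator_apply (a b s : ℝ) (v : ellTwo Spinor) (l : ℤ) :
    propagator a b s v l = freeMode a b s l (v l) :=
  diagOp_apply (norm_freeMode_le a b s) v l

lemma propagator_add (a b s t : ℝ) (v : ellTwo Spinor) :
    propagator a b (s + t) v = propagator a b s (propagator a b t v) :=
  ellTwo.ext fun l => by simp [freeMode_add]

lemma propagator_zero (a b : ℝ) (v : ellTwo Spinor) : propagator a b 0 v = v :=
  ellTwo.ext fun l => by simp [freeMode_zero]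

lemma norm_propagator (a b s : ℝ) (v : ellTwo Spinor) : ‖propagator a b s v‖ = ‖v‖ :=
  le_antisymm (ellTwo.norm_mono fun l => by simp [norm_freeMode_apply])
    (ellTwo.norm_mono fun l => by simp [norm_freeMode_apply])

lemma SobolevLE.propagator {a b : ℝ} {k : ℕ} {v : ellTwo Spinor} {B : ℝ}
    (h : SobolevLE a b k v B) (s : ℝ) : SobolevLE a b k (propagator a b s v) B := by
  simpa using h.of_le (k' := k) (v' := DiracTSFP.propagator a b s v) zero_le_one fun l => by
    simp [norm_freeMode_apply]

lemma SobolevLE.propagator_sub {a b : ℝ} {k : ℕ} {v : ellTwo Spinor} {B : ℝ}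
    (h : SobolevLE a b (k + 1) v B) (s : ℝ) :
    SobolevLE a b k (DiracTSFP.propagator a b s v - v) (|s| * B) := by
  refine h.of_le (abs_nonneg s) fun l => ?_
  rw [ellTwo.sub_apply, propagator_apply]
  have h1 := norm_freeMode_sub_le a b s l (v l)
  have hw := weight_pos a b l
  calc weight a b l ^ k * ‖freeMode a b s l (v l) - v l‖
      ≤ weight a b l ^ k * (|s| * (weight a b l * ‖v l‖)) := by gcongr
    _ = _ := by ring

end DiracTSFP
end

noncomputable section
namespace DiracTSFP

/-! ### Differentiation of sequence-valued functions -/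

section Calculus

open Filter Topology

lemma norm_sub_le_of_hasDerivAt_Ioo {E : Type*} [NormedAddCommGroup E] [NormedSpace ℝ E]
    {f f' : ℝ → E} {p q B : ℝ} (hpq : p ≤ q) (hc : ContinuousOn f (Icc p q))
    (hd : ∀ t ∈ Ioo p q, HasDerivAt f (f' t) t) (hB : ∀ t ∈ Ioo p q, ‖f' t‖ ≤ B) :
    ‖f q - f p‖ ≤ B * (q - p) := by
  rcases hpq.eq_or_lt with rfl | hlt
  · simp
  obtain ⟨r, hr⟩ := nonempty_Ioo.2 hlt
  have hB0 : 0 ≤ B := (norm_nonneg _).trans (hB r hr)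
  have hl : LipschitzOnWith ⟨B, hB0⟩ f (Ioo p q) :=
    (convex_Ioo p q).lipschitzOnWith_of_nnnorm_hasDerivWithin_le
      (fun t ht => (hd t ht).hasDerivWithinAt) fun t ht => hB t ht
  rw [← closure_Ioo hlt.ne] at hc
  have hl' := (lipschitzOnWith_closure_iff hc).2 hl
  rw [closure_Ioo hlt.ne] at hl'
  have := hl'.dist_le_mul q (right_mem_Icc.2 hpq) p (left_mem_Icc.2 hpq)
  rwa [dist_eq_norm, Real.dist_eq, abs_of_nonneg (sub_nonneg.2 hpq)] at this

lemma hasDerivAt_clm_apply_complex {E F : Type*} [NormedAddCommGroup E] [NormedSpace ℂ E]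
    [NormedAddCommGroup F] [NormedSpace ℂ F] {A : ℝ → E →L[ℂ] F} {A' : E →L[ℂ] F} {u : ℝ → E}
    {u' : E} {s : ℝ} (hA : HasDerivAt A A' s) (hu : HasDerivAt u u' s) :
    HasDerivAt (fun s => A s (u s)) (A' (u s) + A s u') s := by
  have h : HasDerivAt (fun s => (A s).restrictScalars ℝ) (A'.restrictScalars ℝ) s :=
    (ContinuousLinearMap.restrictScalarsL ℂ E F ℝ ℝ).hasFDerivAt.comp_hasDerivAt s hA
  exact h.clm_apply hu

variable {E : Type*} [NormedAddCommGroup E] [NormedSpace ℂ E] {a b p q B : ℝ} {k : ℕ}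
  {f g : ℝ → ellTwo E}

/-- The mean value inequality in `H^k` for functions with differentiable Fourier coefficients. -/
lemma SobolevLE.sub_of_hasDerivAt (hpq : p ≤ q) (hB0 : 0 ≤ B)
    (hc : ∀ l, ContinuousOn (fun t => f t l) (Icc p q))
    (hd : ∀ t ∈ Ioo p q, ∀ l, HasDerivAt (fun t => f t l) (g t l) t)
    (hB : ∀ t ∈ Ioo p q, SobolevLE a b k (g t) B) :
    SobolevLE a b k (f q - f p) (B * (q - p)) := by
  refine ⟨mul_nonneg hB0 (sub_nonneg.2 hpq), fun s => ?_⟩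
  let T : (s → E) →L[ℝ] PiLp 2 (fun _ : s => E) :=
    (PiLp.continuousLinearEquiv 2 ℝ (fun _ : s => E)).symm.toContinuousLinearMap
  let F : ℝ → (s → E) := fun t l => (weight a b l ^ k) • f t l
  let F' : ℝ → (s → E) := fun t l => (weight a b l ^ k) • g t l
  have hn : ∀ v : ellTwo E, ‖T fun l : s => (weight a b l ^ k) • v l‖ ^ 2
      = ∑ l ∈ s, (weight a b l ^ k * ‖v l‖) ^ 2 := by
    intro v
    rw [PiLp.norm_sq_eq_of_L2, ← Finset.sum_coe_sort s]
    refine Finset.sum_congr rfl fun l _ => ?_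
    change ‖(weight a b l ^ k) • v l‖ ^ 2 = _
    have := weight_pos a b l
    rw [norm_smul, Real.norm_of_nonneg (by positivity)]
  have hFc : ContinuousOn F (Icc p q) :=
    continuousOn_pi.2 fun l => (hc l).const_smul (weight a b l ^ k)
  have hFd : ∀ t ∈ Ioo p q, HasDerivAt F (F' t) t := fun t ht =>
    hasDerivAt_pi.2 fun l => (hd t ht l).const_smul (weight a b l ^ k)
  have h := norm_sub_le_of_hasDerivAt_Ioo (f := fun t => T (F t)) (f' := fun t => T (F' t))
    (B := B) hpq
    (T.continuous.comp_continuousOn hFc) (fun t ht => T.hasFDerivAt.comp_hasDerivAt t (hFd t ht))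
    fun t ht => by
      refine abs_le_of_sq_le_sq' ?_ hB0 |>.2
      rw [hn]
      exact (hB t ht).2 s
  have e : T (F q) - T (F p) = T fun l : s => (weight a b l ^ k) • (f q - f p) l := by
    rw [← map_sub]
    congr 1
    funext l
    exact (smul_sub _ _ _).symm
  rw [e] at h
  rw [← hn]
  gcongr

lemma hasDerivAt_of_forall_apply {t₀ : ℝ} (ht₀ : t₀ ∈ Ioo p q)
    (hd : ∀ t ∈ Ioo p q, ∀ l, HasDerivAt (fun t => f t l) (g t l) t) (hg : ContinuousAt g t₀) :
    HasDerivAt f (g t₀) t₀ := by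
  rw [hasDerivAt_iff_isLittleO, Asymptotics.isLittleO_iff]
  intro ε hε
  have h1 : ∀ᶠ t in 𝓝 t₀, ‖g t - g t₀‖ ≤ ε := by
    have := Metric.tendsto_nhds.1 hg ε hε
    filter_upwards [this] with t ht
    rw [← dist_eq_norm]
    exact ht.le
  obtain ⟨δ, hδ, hball⟩ := Metric.eventually_nhds_iff_ball.1 (h1.and (Ioo_mem_nhds ht₀.1 ht₀.2))
  have hconv := convex_ball t₀ δ
  have key : ∀ r s, r ∈ Metric.ball t₀ δ → s ∈ Metric.ball t₀ δ → r ≤ s →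
      ‖(f s - (s : ℂ) • g t₀) - (f r - (r : ℂ) • g t₀)‖ ≤ ε * (s - r) := by
    intro r s hr hs hrs
    have hsub : Icc r s ⊆ Metric.ball t₀ δ := hconv.ordConnected.out hr hs
    have hder : ∀ t ∈ Icc r s, ∀ l,
        HasDerivAt (fun t => (f t - (t : ℂ) • g t₀) l) ((g t - g t₀) l) t := by
      intro t ht l
      have h2 : HasDerivAt (fun t : ℝ => (t : ℂ) • g t₀ l) (g t₀ l) t := by
        have h3 := (Complex.ofRealCLM.hasDerivAt (x := t)).smul_const (g t₀ l)
        rw [Complex.ofRealCLM_apply, Complex.ofReal_one, one_smul] at h3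
        exact h3
      exact (hd t (hball t (hsub ht)).2 l).sub h2
    refine (SobolevLE.sub_of_hasDerivAt (a := 0) (b := 1) (k := 0)
      (f := fun t => f t - (t : ℂ) • g t₀) (g := fun t => g t - g t₀) hrs hε.le ?_ ?_ ?_).norm_le
    · exact fun l t ht => (hder t ht l).continuousAt.continuousWithinAt
    · exact fun t ht l => hder t (Ioo_subset_Icc_self ht) l
    · exact fun t ht => SobolevLE.of_norm_le (hball t (hsub (Ioo_subset_Icc_self ht))).1
  have hmem : t₀ ∈ Metric.ball t₀ δ := Metric.mem_ball_self hδ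
  filter_upwards [Metric.ball_mem_nhds t₀ hδ] with t ht
  have e : f t - f t₀ - (t - t₀) • g t₀
      = (f t - (t : ℂ) • g t₀) - (f t₀ - (t₀ : ℂ) • g t₀) := by
    have : (t - t₀) • g t₀ = (((t - t₀ : ℝ)) : ℂ) • g t₀ := rfl
    rw [this, Complex.ofReal_sub, sub_smul]
    abel
  rw [e, Real.norm_eq_abs]
  rcases le_total t₀ t with h | h
  · rw [abs_of_nonneg (sub_nonneg.2 h)]
    exact key t₀ t hmem ht h
  · rw [norm_sub_rev, abs_of_nonpos (sub_nonpos.2 h), neg_sub]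
    exact key t t₀ ht hmem h

end Calculus

end DiracTSFP
end

noncomputable section
namespace DiracTSFP

/-! ### The local error of the Strang splitting -/

section LocalError

open Filter Topology

variable {a b : ℝ} {G : ellTwo Spinor →L[ℂ] ellTwo Spinor} {C : ℝ}

/-- The operator `e^{isT} G e^{-isT}`. -/
def conjOp (a b : ℝ) (G : ellTwo Spinor →L[ℂ] ellTwo Spinor) (s : ℝ) :
    ellTwo Spinor →L[ℂ] ellTwo Spinor :=
  propagator a b (-s) ∘L G ∘L propagator a b s

lemma conjOp_apply (s : ℝ) (v : ellTwo Spinor) :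
    conjOp a b G s v = propagator a b (-s) (G (propagator a b s v)) := rfl

lemma SobolevLE.conjOp {k : ℕ}
    (hG : ∀ v B, SobolevLE a b k v B → SobolevLE a b k (G v) (C * B)) {v : ellTwo Spinor} {B : ℝ}
    (h : SobolevLE a b k v B) (s : ℝ) : SobolevLE a b k (conjOp a b G s v) (C * B) :=
  (hG _ _ (h.propagator s)).propagator (-s)

lemma SobolevLE.conjOp_sub {k : ℕ}
    (hG : ∀ v B, SobolevLE a b k v B → SobolevLE a b k (G v) (C * B))
    (hG' : ∀ v B, SobolevLE a b (k + 1) v B → SobolevLE a b (k + 1) (G v) (C * B))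
    {v : ellTwo Spinor} {B : ℝ} (h : SobolevLE a b (k + 1) v B) (s : ℝ) :
    SobolevLE a b k (DiracTSFP.conjOp a b G s v - G v) (2 * C * |s| * B) := by
  have h1 := (hG _ _ (h.propagator_sub s)).propagator (-s)
  have h2 := (hG' _ _ h).propagator_sub (-s)
  have e : DiracTSFP.conjOp a b G s v - G v
      = DiracTSFP.propagator a b (-s) (G (DiracTSFP.propagator a b s v - v))
        + (DiracTSFP.propagator a b (-s) (G v) - G v) := by
    rw [conjOp_apply, map_sub, map_sub]
    abel
  rw [e]
  refine (h1.add h2).mono (le_of_eq ?_)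
  rw [abs_neg]
  ring

lemma SobolevLE.propagator_second_diff {k : ℕ} {v : ellTwo Spinor} {B : ℝ}
    (h : SobolevLE a b (k + 1 + 1) v B) (s : ℝ) :
    SobolevLE a b k ((DiracTSFP.propagator a b s v - v) + (DiracTSFP.propagator a b (-s) v - v))
      (s ^ 2 * B) := by
  have h1 := ((h.propagator_sub (-s)).propagator_sub s).neg
  have e : (DiracTSFP.propagator a b s v - v) + (DiracTSFP.propagator a b (-s) v - v)
      = -(DiracTSFP.propagator a b s (DiracTSFP.propagator a b (-s) v - v)
        - (DiracTSFP.propagator a b (-s) v - v)) := by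
    rw [map_sub, ← propagator_add, add_neg_cancel, propagator_zero]
    abel
  rw [e]
  refine h1.mono (le_of_eq ?_)
  rw [abs_neg, ← mul_assoc, abs_mul_abs_self]
  ring

lemma norm_conjOp_second_diff_le (hG : ∀ k ≤ 2, ∀ v B, SobolevLE a b k v B →
      SobolevLE a b k (G v) (C * B)) {v : ellTwo Spinor} {B : ℝ} (h : SobolevLE a b 2 v B) (s : ℝ) :
    ‖(conjOp a b G s v - G v) + (conjOp a b G (-s) v - G v)‖ ≤ 4 * C * s ^ 2 * B := by
  have h1 := (hG 2 le_rfl _ _ h).propagator_second_diff (k := 0) s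
  have h2 := hG 0 (by norm_num) _ _ (h.propagator_second_diff (k := 0) s)
  have h3 := (hG 1 (by norm_num) _ _ (h.propagator_sub s)).propagator_sub (k := 0) (-s)
  have h4 := (hG 1 (by norm_num) _ _ (h.propagator_sub (-s))).propagator_sub (k := 0) s
  have e : (conjOp a b G s v - G v) + (conjOp a b G (-s) v - G v)
      = (((propagator a b s (G v) - G v) + (propagator a b (-s) (G v) - G v))
        + G ((propagator a b s v - v) + (propagator a b (-s) v - v)))
        + ((propagator a b (-s) (G (propagator a b s v - v)) - G (propagator a b s v - v))
        + (propagator a b s (G (propagator a b (-s) v - v)) - G (propagator a b (-s) v - v))) := by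
    simp only [conjOp_apply, map_sub, map_add, neg_neg]
    abel
  rw [e]
  refine ((h1.add h2).add (h3.add h4)).norm_le.trans (le_of_eq ?_)
  rw [abs_neg]
  have := abs_mul_abs_self s
  linear_combination 2 * C * B * this

lemma conjOp_sub_conjOp (r s : ℝ) (v : ellTwo Spinor) :
    conjOp a b G r v - conjOp a b G s v
      = propagator a b (-s) (conjOp a b G (r - s) (propagator a b s v)
        - G (propagator a b s v)) := by
  rw [map_sub]
  congr 1
  rw [conjOp_apply, conjOp_apply, ← propagator_add, ← propagator_add, sub_add_cancel]
  congr 2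
  ring

lemma norm_expI_sub_one_le (hC : 0 ≤ C) (hG : ‖G‖ ≤ C) {r s : ℝ} (hr : |r| ≤ |s|) (hs : |s| ≤ 1)
    (v : ellTwo Spinor) : ‖expI G r v - v‖ ≤ |s| * (C * Real.exp C) * ‖v‖ := by
  have h := norm_exp_sub_one_le ((-(Complex.I * r)) • G)
  have hn : ‖(-(Complex.I * r)) • G‖ ≤ |s| * C := by
    rw [norm_smul, norm_neg, norm_mul, Complex.norm_I, one_mul, Complex.norm_real]
    exact mul_le_mul hr hG (norm_nonneg _) (abs_nonneg s)
  have hn' : |s| * C ≤ C := mul_le_of_le_one_left hC hs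
  refine ((expI G r - 1).le_opNorm v).trans ?_
  gcongr
  refine h.trans ?_
  rw [← mul_assoc]
  gcongr
  exact hn.trans hn'

/-- The constant in the local error of the Strang splitting. -/
def localConst (C : ℝ) : ℝ :=
  (1 + C * Real.exp C) * (4 * C ^ 2 * Real.exp C + 4 * C + 4 * C ^ 2)

lemma localConst_nonneg (hC : 0 ≤ C) : 0 ≤ localConst C := by
  unfold localConst
  positivity

variable {c : ℝ → ellTwo Spinor} {p τ ε K : ℝ}

lemma hasDerivAt_interaction {t₀ s : ℝ} {l : ℤ}
    (hd : HasDerivAt (fun t => c t l) (-(Complex.I • matOp (gammaMat a b l) (c (t₀ + s) l))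
      - (Complex.I * ε) • G (c (t₀ + s)) l) (t₀ + s)) :
    HasDerivAt (fun s => propagator a b (-s) (c (t₀ + s)) l)
      ((-(Complex.I * ε)) • conjOp a b G s (propagator a b (-s) (c (t₀ + s))) l) s := by
  have h1 : HasDerivAt (fun s => freeMode a b (-s) l)
      (Complex.I • (freeMode a b (-s) l * matOp (gammaMat a b l))) s := by
    have h := (hasDerivAt_expI (matOp (gammaMat a b l)) (-s)).scomp s (hasDerivAt_neg s)
    rw [neg_one_smul, neg_neg] at h
    exact h
  have h2 : HasDerivAt (fun s => c (t₀ + s) l) _ s := hd.comp_const_add t₀ s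
  have h3 := hasDerivAt_clm_apply_complex h1 h2
  simp only [propagator_apply]
  refine h3.congr_deriv ?_
  have e1 : propagator a b s (propagator a b (-s) (c (t₀ + s))) = c (t₀ + s) := by
    rw [← propagator_add, add_neg_cancel, propagator_zero]
  rw [conjOp_apply, e1, propagator_apply]
  change Complex.I • freeMode a b (-s) l (matOp (gammaMat a b l) (c (t₀ + s) l)) + _ = _
  rw [map_sub, map_neg, map_smul, map_smul, neg_smul]
  abel

lemma continuousOn_interaction {t₀ σ : ℝ} {l : ℤ}
    (hc : ContinuousOn (fun t => c t l) (Icc (t₀ - σ) (t₀ + σ))) :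
    ContinuousOn (fun s => propagator a b (-s) (c (t₀ + s)) l) (Icc (-σ) σ) := by
  have h2 : ContinuousOn (fun s => c (t₀ + s) l) (Icc (-σ) σ) :=
    hc.comp (continuous_const.add continuous_id).continuousOn fun s hs =>
      ⟨by change t₀ - σ ≤ t₀ + s; linarith [hs.1], by change t₀ + s ≤ t₀ + σ; linarith [hs.2]⟩
  have h1 : Continuous fun s => (freeMode a b (-s) l) :=
    (continuous_iff_continuousAt.2 fun s =>
      (hasDerivAt_expI (matOp (gammaMat a b l)) s).continuousAt).comp continuous_neg
  simp only [propagator_apply]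
  exact h1.continuousOn.clm_apply h2

set_option maxHeartbeats 1000000 in
/-- The Strang splitting is locally of order three, with an additional factor `ε`. -/
lemma norm_strang_local_error_le (hC : 0 ≤ C)
    (hG : ∀ k ≤ 2, ∀ v B, SobolevLE a b k v B → SobolevLE a b k (G v) (C * B))
    (hτ : 0 < τ) (hτ1 : τ ≤ 1) (hε : 0 < ε) (hε1 : ε ≤ 1)
    (hc : ∀ l, ContinuousOn (fun t => c t l) (Icc p (p + τ)))
    (hd : ∀ t ∈ Ioo p (p + τ), ∀ l, HasDerivAt (fun t => c t l)
      (-(Complex.I • matOp (gammaMat a b l) (c t l)) - (Complex.I * ε) • G (c t) l) t)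
    (hK : ∀ t ∈ Icc p (p + τ), SobolevLE a b 2 (c t) K) :
    ‖c (p + τ) - propagator a b (τ / 2) (expI G (ε * τ) (propagator a b (τ / 2) (c p)))‖
      ≤ localConst C * K * (ε * τ ^ 3) := by
  have hK0 : 0 ≤ K := (hK p (left_mem_Icc.2 (by linarith))).1
  have hGn : ‖G‖ ≤ C := ContinuousLinearMap.opNorm_le_bound _ hC fun v =>
    (hG 0 (by norm_num) v _ (SobolevLE.of_norm_le le_rfl)).norm_le
  obtain ⟨σ, rfl⟩ : ∃ σ, τ = 2 * σ := ⟨τ / 2, by ring⟩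
  have hσ : 0 < σ := by linarith
  set t₀ := p + σ with ht₀
  set w : ℝ → ellTwo Spinor := fun s => propagator a b (-s) (c (t₀ + s)) with hw
  have hI : Icc (t₀ - σ) (t₀ + σ) = Icc p (p + 2 * σ) := by
    rw [ht₀]; congr 1 <;> ring
  have hmem : ∀ s ∈ Icc (-σ) σ, t₀ + s ∈ Icc p (p + 2 * σ) := fun s hs =>
    ⟨by linarith [hs.1], by linarith [hs.2]⟩
  have hwK : ∀ s ∈ Icc (-σ) σ, SobolevLE a b 2 (w s) K := fun s hs =>
    (hK _ (hmem s hs)).propagator (-s)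
  have hwc : ∀ l, ContinuousOn (fun s => w s l) (Icc (-σ) σ) := fun l =>
    continuousOn_interaction (by rw [hI]; exact hc l)
  have hwd : ∀ s ∈ Ioo (-σ) σ, ∀ l, HasDerivAt (fun s => w s l)
      (((-(Complex.I * ε)) • conjOp a b G s (w s) : ellTwo Spinor) l) s := fun s hs l =>
    hasDerivAt_interaction (hd _ ⟨by linarith [hs.1], by linarith [hs.2]⟩ l)
  have hnorm : ‖(-(Complex.I * (ε : ℂ)))‖ = ε := by
    rw [norm_neg, norm_mul, Complex.norm_I, one_mul, Complex.norm_real, Real.norm_of_nonneg hε.le]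
  have hlip : ∀ r s, r ∈ Icc (-σ) σ → s ∈ Icc (-σ) σ →
      SobolevLE a b 2 (w s - w r) (ε * (C * K) * |s - r|) := by
    have h1 : ∀ r s, r ∈ Icc (-σ) σ → s ∈ Icc (-σ) σ → r ≤ s →
        SobolevLE a b 2 (w s - w r) (ε * (C * K) * (s - r)) := by
      intro r s hr hs hrs
      refine SobolevLE.sub_of_hasDerivAt hrs (by positivity)
        (fun l => (hwc l).mono (Icc_subset_Icc hr.1 hs.2))
        (fun t ht => hwd t ⟨hr.1.trans_lt ht.1, ht.2.trans_le hs.2⟩) fun t ht => ?_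
      have := ((hwK t ⟨hr.1.trans ht.1.le, ht.2.le.trans hs.2⟩).conjOp (hG 2 le_rfl) t).smul
        (-(Complex.I * (ε : ℂ)))
      rwa [hnorm] at this
    intro r s hr hs
    rcases le_total r s with h | h
    · rw [abs_of_nonneg (sub_nonneg.2 h)]
      exact h1 r s hr hs h
    · rw [abs_of_nonpos (sub_nonpos.2 h), neg_sub, ← neg_sub (w r)]
      exact (h1 s r hs hr h).neg
  have hconj : ∀ r s, r ∈ Icc (-σ) σ → s ∈ Icc (-σ) σ →
      ‖conjOp a b G r (w r) - conjOp a b G s (w s)‖ ≤ (C * (ε * (C * K)) + 2 * C * K) * |r - s| := by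
    intro r s hr hs
    have e : conjOp a b G r (w r) - conjOp a b G s (w s)
        = conjOp a b G r (w r - w s) + (conjOp a b G r (w s) - conjOp a b G s (w s)) := by
      rw [map_sub]; abel
    have h1 := ((hlip s r hs hr).conjOp (hG 2 le_rfl) r).norm_le
    have h2 := ((((hwK s hs).of_order_le one_le_two).propagator s).conjOp_sub (k := 0)
      (hG 0 (by norm_num)) (hG 1 (by norm_num)) (r - s)).norm_le
    rw [e, conjOp_sub_conjOp]
    refine (norm_add_le _ _).trans ?_
    rw [norm_propagator]
    refine (add_le_add h1 h2).trans (le_of_eq (by ring))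
  have hwD : ∀ s ∈ Ioo (-σ) σ,
      HasDerivAt w ((-(Complex.I * ε)) • conjOp a b G s (w s)) s := by
    intro s hs
    refine hasDerivAt_of_forall_apply
      (g := fun s => (-(Complex.I * ε)) • conjOp a b G s (w s)) hs hwd ?_
    suffices h : ContinuousAt (fun s => conjOp a b G s (w s)) s from
      h.const_smul (-(Complex.I * (ε : ℂ)))
    refine tendsto_iff_norm_sub_tendsto_zero.2 ?_
    have hlim : Tendsto (fun r => (C * (ε * (C * K)) + 2 * C * K) * |r - s|) (𝓝 s) (𝓝 0) := by
      have : Continuous fun r => (C * (ε * (C * K)) + 2 * C * K) * |r - s| := by fun_prop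
      simpa using this.tendsto s
    refine squeeze_zero' (Eventually.of_forall fun _ => norm_nonneg _) ?_ hlim
    filter_upwards [Ioo_mem_nhds hs.1 hs.2] with r hr
    exact hconj r s (Ioo_subset_Icc_self hr) (Ioo_subset_Icc_self hs)
  set z : ℝ → ellTwo Spinor := fun s => expI G (-(ε * s)) (w s) with hz
  set P : ℝ → ellTwo Spinor := fun s => G (w s) - conjOp a b G s (w s) with hP
  have hzD : ∀ s ∈ Ioo (-σ) σ,
      HasDerivAt z ((Complex.I * ε) • expI G (-(ε * s)) (P s)) s := by
    intro s hs
    have h1 : HasDerivAt (fun s => expI G (-(ε * s)))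
        ((Complex.I * ε) • (expI G (-(ε * s)) * G)) s := by
      have hin : HasDerivAt (fun s : ℝ => -(ε * s)) (-ε) s := by
        have := ((hasDerivAt_id s).const_mul ε).neg
        rwa [mul_one] at this
      have h := (hasDerivAt_expI G (-(ε * s))).scomp s hin
      refine h.congr_deriv ?_
      rw [smul_neg, neg_smul, neg_neg, mul_comm Complex.I, mul_smul]
      rfl
    refine (hasDerivAt_clm_apply_complex h1 (hwD s hs)).congr_deriv ?_
    change (Complex.I * ε) • expI G (-(ε * s)) (G (w s)) + _ = _
    rw [hP, map_sub, smul_sub, map_smul, neg_smul, sub_eq_add_neg]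
  have hexpc : Continuous (expI G) :=
    continuous_iff_continuousAt.2 fun s => (hasDerivAt_expI G s).continuousAt
  have hwcont : ContinuousOn w (Icc (-σ) σ) := by
    intro s hs
    refine tendsto_iff_norm_sub_tendsto_zero.2 ?_
    have hlim : Tendsto (fun r => (ε * (C * K)) * |r - s|) (𝓝[Icc (-σ) σ] s) (𝓝 0) := by
      have : Continuous fun r => (ε * (C * K)) * |r - s| := by fun_prop
      have h2 := this.tendsto s
      simp only [sub_self, abs_zero, mul_zero] at h2
      exact h2.mono_left nhdsWithin_le_nhds
    refine squeeze_zero' (Eventually.of_forall fun _ => norm_nonneg _) ?_ hlim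
    filter_upwards [self_mem_nhdsWithin] with r hr
    exact (hlip s r hs hr).norm_le
  have hzcont : ContinuousOn z (Icc (-σ) σ) :=
    (hexpc.comp (by fun_prop : Continuous fun s : ℝ => -(ε * s))).continuousOn.clm_apply hwcont
  have hσ1 : σ ≤ 1 := by linarith
  have hPn : ∀ s ∈ Icc (-σ) σ, ‖P s‖ ≤ 2 * C * |s| * K := by
    intro s hs
    rw [hP, norm_sub_rev]
    exact (((hwK s hs).of_order_le one_le_two).conjOp_sub (k := 0)
      (hG 0 (by norm_num)) (hG 1 (by norm_num)) s).norm_le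
  set C₁ := (4 * C ^ 2 * Real.exp C + 4 * C + 4 * C ^ 2) with hC₁
  have hbound : ∀ s ∈ Ioo 0 σ,
      ‖expI G (-(ε * s)) (P s) + expI G (-(ε * -s)) (P (-s))‖ ≤ C₁ * K * σ ^ 2 := by
    intro s hs
    have hsI : s ∈ Icc (-σ) σ := ⟨by linarith [hs.1], hs.2.le⟩
    have hsI' : -s ∈ Icc (-σ) σ := ⟨by linarith [hs.2], by linarith [hs.1]⟩
    have hs1 : |s| ≤ 1 := by rw [abs_of_pos hs.1]; linarith [hs.2]
    have hεs : ∀ r, |r| = |s| → |-(ε * r)| ≤ |s| := fun r hr => by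
      rw [abs_neg, abs_mul, hr, abs_of_pos hε]
      exact mul_le_of_le_one_left (abs_nonneg _) hε1
    have e : expI G (-(ε * s)) (P s) + expI G (-(ε * -s)) (P (-s))
        = ((expI G (-(ε * s)) (P s) - P s) + (expI G (-(ε * -s)) (P (-s)) - P (-s)))
        + (-((conjOp a b G s (w s) - G (w s)) + (conjOp a b G (-s) (w s) - G (w s)))
        + -(conjOp a b G (-s) (w (-s) - w s) - G (w (-s) - w s))) := by
      simp only [hP, map_sub]
      abel
    have h1 := norm_expI_sub_one_le hC hGn (hεs s rfl) hs1 (P s)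
    have h2 := norm_expI_sub_one_le hC hGn (hεs (-s) (abs_neg s)) hs1 (P (-s))
    have h3 := norm_conjOp_second_diff_le hG (hwK s hsI) s
    have h4 := (((hlip s (-s) hsI hsI').of_order_le one_le_two).conjOp_sub (k := 0)
      (hG 0 (by norm_num)) (hG 1 (by norm_num)) (-s)).norm_le
    have hp1 := hPn s hsI
    have hp2 := hPn (-s) hsI'
    rw [abs_neg] at hp2
    rw [e]
    have hCe : 0 ≤ C * Real.exp C := by positivity
    have h1' : ‖expI G (-(ε * s)) (P s) - P s‖ ≤ |s| * (C * Real.exp C) * (2 * C * |s| * K) :=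
      h1.trans (by gcongr)
    have h2' : ‖expI G (-(ε * -s)) (P (-s)) - P (-s)‖
        ≤ |s| * (C * Real.exp C) * (2 * C * |s| * K) := h2.trans (by gcongr)
    have h4' : ‖conjOp a b G (-s) (w (-s) - w s) - G (w (-s) - w s)‖
        ≤ 4 * C ^ 2 * K * s ^ 2 := by
      refine h4.trans ?_
      have e1 : |-s - s| = 2 * s := by
        rw [show -s - s = -(2 * s) by ring, abs_neg, abs_of_pos (by linarith [hs.1])]
      rw [e1, abs_neg, abs_of_pos hs.1]
      calc 2 * C * s * (ε * (C * K) * (2 * s)) = ε * (4 * C ^ 2 * K * s ^ 2) := by ring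
        _ ≤ 1 * (4 * C ^ 2 * K * s ^ 2) := by gcongr
        _ = _ := one_mul _
    have hsum := (norm_add_le_of_le (norm_add_le_of_le h1' h2')
      (norm_add_le_of_le ((norm_neg _).trans_le h3) ((norm_neg _).trans_le h4')))
    refine hsum.trans ?_
    have hss : s ^ 2 ≤ σ ^ 2 := pow_le_pow_left₀ hs.1.le hs.2.le 2
    have hCK : 0 ≤ C₁ * K := by positivity
    calc _ = C₁ * K * s ^ 2 := by rw [abs_of_pos hs.1, hC₁]; ring
      _ ≤ _ := by gcongr
  have hy : ‖z σ - z (-σ)‖ ≤ ε * (C₁ * K * σ ^ 2) * σ := by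
    have h := norm_sub_le_of_hasDerivAt_Ioo (f := fun s => z s - z (-s))
      (f' := fun s => (Complex.I * ε) •
        (expI G (-(ε * s)) (P s) + expI G (-(ε * -s)) (P (-s)))) (B := ε * (C₁ * K * σ ^ 2))
      hσ.le ?_ ?_ ?_
    · simpa using h
    · refine (hzcont.mono (Icc_subset_Icc (by linarith) le_rfl)).sub
        (hzcont.comp continuous_neg.continuousOn fun s hs => ⟨?_, ?_⟩)
      · linarith [hs.2]
      · linarith [hs.1]
    · intro s hs
      have h1 := hzD s ⟨by linarith [hs.1], hs.2⟩
      have h2 := (hzD (-s) ⟨by linarith [hs.2], by linarith [hs.1]⟩).scomp s (hasDerivAt_neg s)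
      refine (h1.sub h2).congr_deriv ?_
      rw [neg_one_smul, sub_neg_eq_add, smul_add]
    · intro s hs
      rw [norm_smul, ← norm_neg (Complex.I * (ε : ℂ)), hnorm]
      gcongr
      exact hbound s hs
  have e1 : c (p + 2 * σ) = propagator a b σ (expI G (ε * σ) (z σ)) := by
    have h1 : expI G (ε * σ) (z σ) = w σ := by
      have := DFunLike.congr_fun (expI_add G (ε * σ) (-(ε * σ))) (w σ)
      rw [add_neg_cancel, expI_zero] at this
      exact this.symm
    rw [h1, hw]
    simp only
    rw [← propagator_add, add_neg_cancel, propagator_zero, ht₀]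
    congr 1
    ring
  have e2 : propagator a b (2 * σ / 2) (expI G (ε * (2 * σ)) (propagator a b (2 * σ / 2) (c p)))
      = propagator a b σ (expI G (ε * σ) (z (-σ))) := by
    have h1 : 2 * σ / 2 = σ := by ring
    have h2 : w (-σ) = propagator a b σ (c p) := by
      simp only [hw, neg_neg]
      congr 2
      rw [ht₀]
      ring
    have h3 := DFunLike.congr_fun (expI_add G (ε * σ) (ε * σ)) (w (-σ))
    rw [h1, ← h2, show ε * (2 * σ) = ε * σ + ε * σ by ring]
    have h4 : z (-σ) = expI G (ε * σ) (w (-σ)) := by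
      simp only [hz]
      rw [mul_neg, neg_neg]
    rw [h4]
    exact congrArg _ h3
  rw [e1, e2, ← map_sub, norm_propagator, ← map_sub]
  have h5 := norm_expI_sub_one_le hC hGn (r := ε * σ) (s := 1)
    (by rw [abs_one, abs_of_pos (by positivity)]; nlinarith) (by simp) (z σ - z (-σ))
  rw [abs_one, one_mul] at h5
  have h6 : ‖expI G (ε * σ) (z σ - z (-σ))‖ ≤ (1 + C * Real.exp C) * ‖z σ - z (-σ)‖ := by
    have := norm_le_norm_add_norm_sub' (expI G (ε * σ) (z σ - z (-σ))) (z σ - z (-σ))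
    linarith
  have hCe : 0 ≤ C * Real.exp C := by positivity
  calc _ ≤ (1 + C * Real.exp C) * (ε * (C₁ * K * σ ^ 2) * σ) := h6.trans (by gcongr)
    _ = localConst C * K * (ε * σ ^ 3) := by rw [localConst, hC₁]; ring
    _ ≤ localConst C * K * (ε * (2 * σ) ^ 3) := by
      have := localConst_nonneg hC
      gcongr
      linarith

end LocalError

end DiracTSFP
end

noncomputable section
namespace DiracTSFP

/-! ### The discrete Fourier transform -/

section Discrete

variable {a b : ℝ} {M : ℕ}

lemma sum_root_of_unity (hM : 0 < M) (d : ℤ) :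
    ∑ j : Fin M, Complex.exp (2 * Real.pi * Complex.I * d / M * (j : ℕ))
      = if (M : ℤ) ∣ d then (M : ℂ) else 0 := by
  have hM' : (M : ℂ) ≠ 0 := Nat.cast_ne_zero.2 hM.ne'
  set ζ := Complex.exp (2 * Real.pi * Complex.I * d / M) with hζ
  have hpow : ∀ j : ℕ, Complex.exp (2 * Real.pi * Complex.I * d / M * j) = ζ ^ j := fun j => by
    rw [hζ, ← Complex.exp_nat_mul, mul_comm]
  simp_rw [hpow]
  rw [Fin.sum_univ_eq_sum_range (fun j => ζ ^ j)]
  split_ifs with h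
  · obtain ⟨n, rfl⟩ := h
    have : ζ = 1 := by
      rw [hζ, Complex.exp_eq_one_iff]
      refine ⟨n, ?_⟩
      push_cast
      field_simp
    simp [this]
  · have hζ1 : ζ ≠ 1 := by
      intro h1
      rw [hζ, Complex.exp_eq_one_iff] at h1
      obtain ⟨n, hn⟩ := h1
      apply h
      refine ⟨n, ?_⟩
      have hpi := Complex.two_pi_I_ne_zero
      rw [div_eq_iff hM'] at hn
      have h2 : (2 * Real.pi * Complex.I) * ((d : ℂ) - M * n) = 0 := by linear_combination hn
      have h3 : (d : ℂ) = M * n := sub_eq_zero.1 ((mul_eq_zero.1 h2).resolve_left hpi)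
      exact_mod_cast h3
    have hζM : ζ ^ M = 1 := by
      rw [← hpow, Complex.exp_eq_one_iff]
      exact ⟨d, by field_simp⟩
    have := geom_sum_mul ζ M
    rw [hζM, sub_self] at this
    exact (mul_eq_zero.1 this).resolve_right (sub_ne_zero.2 hζ1)

lemma mode_gridPoint (hab : a < b) (hM : 0 < M) (k : ℤ) (j : ℕ) :
    mode a b k (gridPoint a b M j) = Complex.exp (2 * Real.pi * Complex.I * k / M * j) := by
  have hM' : (M : ℂ) ≠ 0 := Nat.cast_ne_zero.2 hM.ne'
  have hba : ((b : ℂ) - a) ≠ 0 := by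
    rw [← Complex.ofReal_sub]
    exact Complex.ofReal_ne_zero.2 (sub_pos.2 hab).ne'
  rw [mode, freq, gridPoint, mesh]
  congr 1
  push_cast
  rw [add_sub_cancel_left]
  field_simp

lemma sum_exp_mul_mode (hab : a < b) (hM : 0 < M) (k l : ℤ) :
    (1 / (M : ℂ)) * ∑ j : Fin M,
      Complex.exp (-(2 * Complex.I * ((j : ℕ) : ℂ) * (l : ℂ) * (Real.pi : ℂ) / (M : ℂ))) *
        mode a b k (gridPoint a b M (j : ℕ)) = if (M : ℤ) ∣ k - l then 1 else 0 := by
  have hM' : (M : ℂ) ≠ 0 := Nat.cast_ne_zero.2 hM.ne'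
  have h : ∀ j : Fin M,
      Complex.exp (-(2 * Complex.I * ((j : ℕ) : ℂ) * (l : ℂ) * (Real.pi : ℂ) / (M : ℂ))) *
        mode a b k (gridPoint a b M (j : ℕ))
      = Complex.exp (2 * Real.pi * Complex.I * ((k - l : ℤ) : ℂ) / M * (j : ℕ)) := fun j => by
    rw [mode_gridPoint hab hM, ← Complex.exp_add]
    congr 1
    push_cast
    ring
  simp_rw [h]
  rw [sum_root_of_unity hM]
  split_ifs
  · field_simp
  · rw [mul_zero]

/-- The sequence which agrees with `u` on `s` and vanishes elsewhere. -/
def truncSeq (s : Finset ℤ) (u : ℤ → Spinor) : ellTwo Spinor :=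
  ⟨fun l => if l ∈ s then u l else 0, memℓp_two_of_summable (summable_of_ne_finset_zero (s := s)
    fun l hl => by simp [hl])⟩

lemma truncSeq_apply (s : Finset ℤ) (u : ℤ → Spinor) (l : ℤ) :
    truncSeq s u l = if l ∈ s then u l else 0 := rfl

lemma norm_sq_truncSeq (s : Finset ℤ) (u : ℤ → Spinor) :
    ‖truncSeq s u‖ ^ 2 = ∑ l ∈ s, ‖u l‖ ^ 2 := by
  rw [← (truncSeq s u).hasSum_sq.tsum_eq, tsum_eq_sum (s := s)]
  · refine Finset.sum_congr rfl fun l hl => ?_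
    rw [truncSeq_apply, if_pos hl]
  · intro l hl
    rw [truncSeq_apply, if_neg hl, norm_zero, zero_pow two_ne_zero]

lemma truncSeq_sub (s : Finset ℤ) (u v : ℤ → Spinor) :
    truncSeq s u - truncSeq s v = truncSeq s (u - v) := by
  refine ellTwo.ext fun l => ?_
  rw [ellTwo.sub_apply, truncSeq_apply, truncSeq_apply, truncSeq_apply]
  split_ifs <;> simp

lemma norm_truncSeq_le (s : Finset ℤ) (v : ellTwo Spinor) : ‖truncSeq s v‖ ≤ ‖v‖ :=
  ellTwo.norm_mono fun l => by
    rw [truncSeq_apply]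
    split_ifs <;> simp

lemma summable_norm_truncSeq (s : Finset ℤ) (u : ℤ → Spinor) :
    Summable fun l => ‖truncSeq s u l‖ :=
  summable_of_ne_finset_zero (s := s) fun l hl => by simp [truncSeq_apply, hl]

lemma SobolevLE.truncSeq {k : ℕ} {v : ellTwo Spinor} {B : ℝ} (h : SobolevLE a b k v B)
    (s : Finset ℤ) : SobolevLE a b k (truncSeq s v) B := by
  simpa using h.of_le (k' := k) (v' := DiracTSFP.truncSeq s v) zero_le_one fun l => by
    have := weight_pos a b l
    rw [truncSeq_apply, one_mul]
    split_ifs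
    · exact le_rfl
    · rw [norm_zero, mul_zero]
      positivity

/-- The discrete Fourier coefficients of a grid function, as a sequence. -/
def discSeq (M : ℕ) (U : Fin (M + 1) → Spinor) : ellTwo Spinor :=
  truncSeq (modes M) (discreteCoef M U)

/-- The values on the grid of a Fourier series. -/
def gridEval (a b : ℝ) (M : ℕ) (v : ellTwo Spinor) : Fin (M + 1) → Spinor :=
  fun j => evalSeries a b (gridPoint a b M j) v

lemma discreteCoef_sub (U W : Fin (M + 1) → Spinor) (l : ℤ) :
    discreteCoef M (U - W) l = discreteCoef M U l - discreteCoef M W l := by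
  simp only [discreteCoef, Pi.sub_apply, smul_sub, Finset.sum_sub_distrib]

lemma discSeq_sub (U W : Fin (M + 1) → Spinor) :
    discSeq M (U - W) = discSeq M U - discSeq M W := by
  rw [discSeq, discSeq, discSeq, truncSeq_sub]
  congr 1
  funext l
  exact discreteCoef_sub U W l

lemma gridEval_sub {v w : ellTwo Spinor} (hv : Summable fun l => ‖v l‖)
    (hw : Summable fun l => ‖w l‖) : gridEval a b M (v - w) = gridEval a b M v - gridEval a b M w := by
  funext j
  have h := (hasSum_evalSeries a b (gridPoint a b M j) hv).sub
    (hasSum_evalSeries a b (gridPoint a b M j) hw)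
  rw [Pi.sub_apply, gridEval, gridEval, gridEval, ← h.tsum_eq]
  exact tsum_congr fun l => by rw [ellTwo.sub_apply, smul_sub]

/-- The aliasing formula. -/
lemma hasSum_discreteCoef_gridEval (hab : a < b) (hM : 0 < M) {v : ellTwo Spinor}
    (hv : Summable fun l => ‖v l‖) (l : ℤ) :
    HasSum (fun p : ℤ => v (l + p * M)) (discreteCoef M (gridEval a b M v) l) := by
  have hMz : (M : ℤ) ≠ 0 := Int.natCast_ne_zero.2 hM.ne'
  have hinj : Function.Injective fun p : ℤ => l + p * M := fun p q h => by
    have : p * (M : ℤ) = q * M := add_left_cancel h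
    exact mul_right_cancel₀ hMz this
  have h1 : HasSum (fun k : ℤ => if (M : ℤ) ∣ k - l then v k else 0)
      (discreteCoef M (gridEval a b M v) l) := by
    have h2 := (hasSum_sum fun (j : Fin M) (_ : j ∈ Finset.univ) =>
      (hasSum_evalSeries a b (gridPoint a b M (j : ℕ)) hv).const_smul
        (Complex.exp (-(2 * Complex.I * ((j : ℕ) : ℂ) * (l : ℂ) * (Real.pi : ℂ) / (M : ℂ))))).const_smul
        (1 / (M : ℂ))
    have e : ∀ k : ℤ, (1 / (M : ℂ)) • ∑ j : Fin M,
        Complex.exp (-(2 * Complex.I * ((j : ℕ) : ℂ) * (l : ℂ) * (Real.pi : ℂ) / (M : ℂ))) •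
          mode a b k (gridPoint a b M (j : ℕ)) • v k = if (M : ℤ) ∣ k - l then v k else 0 := by
      intro k
      simp_rw [smul_smul]
      rw [← Finset.sum_smul, smul_smul, sum_exp_mul_mode hab hM]
      split_ifs <;> simp
    simp only [e] at h2
    exact h2
  rw [← hinj.hasSum_iff] at h1
  · convert h1 using 2 with p
    simp
  · intro k hk
    rw [if_neg]
    rintro ⟨p, hp⟩
    exact hk ⟨p, by simp only; linarith [mul_comm p (M : ℤ)]⟩

lemma eq_zero_of_add_mul_mem_modes (hMe : Even M) {l p : ℤ} (hl : l ∈ modes M)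
    (hp : l + p * M ∈ modes M) : p = 0 := by
  obtain ⟨N, rfl⟩ := hMe
  simp only [modes, Finset.mem_Ico] at hl hp
  push_cast at hl hp
  have e : ((N : ℤ) + N) / 2 = N := by omega
  rw [e] at hl hp
  by_contra h
  rcases lt_or_gt_of_ne h with h | h
  · nlinarith
  · nlinarith

lemma discSeq_gridEval_truncSeq (hab : a < b) (hM : 0 < M) (hMe : Even M) (u : ℤ → Spinor) :
    discSeq M (gridEval a b M (truncSeq (modes M) u)) = truncSeq (modes M) u := by
  refine ellTwo.ext fun l => ?_
  rw [discSeq, truncSeq_apply]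
  split_ifs with hl
  · have h := hasSum_discreteCoef_gridEval hab hM (summable_norm_truncSeq (modes M) u) l
    have h2 := hasSum_single (f := fun p : ℤ => truncSeq (modes M) u (l + p * M)) 0 fun p hp => by
      rw [truncSeq_apply, if_neg]
      exact fun hmem => hp (eq_zero_of_add_mul_mem_modes hMe hl hmem)
    rw [h.unique h2]
    simp
  · rw [truncSeq_apply, if_neg hl]

lemma gridEval_truncSeq (u : ℤ → Spinor) (j : Fin (M + 1)) :
    gridEval a b M (truncSeq (modes M) u) j
      = ∑ l ∈ modes M, mode a b l (gridPoint a b M j) • u l := by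
  rw [gridEval, evalSeries, tsum_eq_sum (s := modes M)]
  · refine Finset.sum_congr rfl fun l hl => ?_
    rw [truncSeq_apply, if_pos hl]
  · intro l hl
    rw [truncSeq_apply, if_neg hl, smul_zero]

/-- The discrete inner product of the grid values of a trigonometric polynomial with a grid
function. -/
lemma sum_inner_gridEval (hab : a < b) (hM : 0 < M) (u : ℤ → Spinor) (U : Fin (M + 1) → Spinor) :
    (1 / (M : ℂ)) * ∑ j : Fin M,
        inner ℂ (gridEval a b M (truncSeq (modes M) u) j.castSucc) (U j.castSucc)
      = ∑ l ∈ modes M, inner ℂ (u l) (discreteCoef M U l) := by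
  simp_rw [gridEval_truncSeq, sum_inner, discreteCoef, inner_smul_right, inner_sum,
    inner_smul_right]
  rw [Finset.sum_comm, Finset.mul_sum]
  refine Finset.sum_congr rfl fun l _ => ?_
  congr 1
  refine Finset.sum_congr rfl fun j _ => ?_
  rw [inner_smul_left]
  congr 1
  rw [Fin.val_castSucc, mode_gridPoint hab hM, ← Complex.exp_conj]
  congr 1
  simp only [map_mul, map_div₀, Complex.conj_ofReal, Complex.conj_I, map_ofNat, map_intCast,
    map_natCast]
  ring

/-- The discrete `L²` norm of a grid function. -/
def gridNorm (M : ℕ) (U : Fin (M + 1) → Spinor) : ℝ :=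
  √((1 / (M : ℝ)) * ∑ j : Fin M, ‖U j.castSucc‖ ^ 2)

lemma gridNorm_sq (M : ℕ) (U : Fin (M + 1) → Spinor) :
    gridNorm M U ^ 2 = (1 / (M : ℝ)) * ∑ j : Fin M, ‖U j.castSucc‖ ^ 2 :=
  Real.sq_sqrt (by positivity)

lemma gridNorm_nonneg (M : ℕ) (U : Fin (M + 1) → Spinor) : 0 ≤ gridNorm M U :=
  Real.sqrt_nonneg _

lemma gridNorm_congr {U W : Fin (M + 1) → Spinor} (h : ∀ j, ‖U j‖ = ‖W j‖) :
    gridNorm M U = gridNorm M W := by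
  simp only [gridNorm, h]

lemma gridNorm_gridEval (hab : a < b) (hM : 0 < M) (hMe : Even M) (u : ℤ → Spinor) :
    gridNorm M (gridEval a b M (truncSeq (modes M) u)) = ‖truncSeq (modes M) u‖ := by
  refine (pow_left_inj₀ (gridNorm_nonneg M _) (norm_nonneg _) two_ne_zero).1 ?_
  rw [gridNorm_sq, norm_sq_truncSeq]
  have h := sum_inner_gridEval hab hM u (gridEval a b M (truncSeq (modes M) u))
  have h2 : ∀ l ∈ modes M, inner ℂ (u l) (discreteCoef M (gridEval a b M (truncSeq (modes M) u)) l)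
      = ((‖u l‖ ^ 2 : ℝ) : ℂ) := by
    intro l hl
    have h3 : discSeq M (gridEval a b M (truncSeq (modes M) u)) l = truncSeq (modes M) u l := by
      rw [discSeq_gridEval_truncSeq hab hM hMe]
    rw [discSeq, truncSeq_apply, truncSeq_apply, if_pos hl, if_pos hl] at h3
    rw [h3, inner_self_eq_norm_sq_to_K]
    norm_cast
  rw [Finset.sum_congr rfl h2] at h
  simp only [inner_self_eq_norm_sq_to_K, Complex.coe_algebraMap] at h
  refine Complex.ofReal_injective ?_
  push_cast at h ⊢
  exact h

lemma norm_discSeq_le (hab : a < b) (hM : 0 < M) (hMe : Even M) (U : Fin (M + 1) → Spinor) :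
    ‖discSeq M U‖ ≤ gridNorm M U := by
  have h := sum_inner_gridEval hab hM (discreteCoef M U) U
  have h1 : ∑ l ∈ modes M, inner ℂ (discreteCoef M U l) (discreteCoef M U l)
      = ((‖discSeq M U‖ ^ 2 : ℝ) : ℂ) := by
    rw [discSeq, norm_sq_truncSeq]
    simp only [inner_self_eq_norm_sq_to_K, Complex.coe_algebraMap]
    norm_cast
  rw [h1] at h
  set W := gridEval a b M (truncSeq (modes M) (discreteCoef M U)) with hW
  have hWn : gridNorm M W = ‖discSeq M U‖ := gridNorm_gridEval hab hM hMe _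
  have h2 : ‖discSeq M U‖ ^ 2 ≤ (1 / (M : ℝ)) * ∑ j : Fin M, ‖W j.castSucc‖ * ‖U j.castSucc‖ := by
    have h3 := congrArg norm h
    rw [Complex.norm_real, Real.norm_of_nonneg (by positivity), norm_mul] at h3
    rw [← h3]
    have : ‖(1 / (M : ℂ))‖ = 1 / (M : ℝ) := by simp
    rw [this]
    gcongr
    refine (norm_sum_le _ _).trans ?_
    gcongr with j
    exact norm_inner_le_norm _ _
  have h4 : (1 / (M : ℝ)) * ∑ j : Fin M, ‖W j.castSucc‖ * ‖U j.castSucc‖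
      ≤ gridNorm M W * gridNorm M U := by
    have hcs := Finset.sum_mul_sq_le_sq_mul_sq Finset.univ (fun j : Fin M => ‖W j.castSucc‖)
      fun j => ‖U j.castSucc‖
    refine abs_le_of_sq_le_sq' ?_ (mul_nonneg (gridNorm_nonneg M W) (gridNorm_nonneg M U)) |>.2
    rw [mul_pow, mul_pow, gridNorm_sq, gridNorm_sq]
    calc _ ≤ (1 / (M : ℝ)) ^ 2 * ((∑ j : Fin M, ‖W j.castSucc‖ ^ 2) *
          ∑ j : Fin M, ‖U j.castSucc‖ ^ 2) := by gcongr
      _ = _ := by ring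
  rw [hWn] at h4
  rcases (norm_nonneg (discSeq M U)).eq_or_lt with h0 | h0
  · rw [← h0]
    exact gridNorm_nonneg M U
  · have h5 : ‖discSeq M U‖ * ‖discSeq M U‖ ≤ ‖discSeq M U‖ * gridNorm M U := by
      rw [← sq]
      exact h2.trans h4
    exact le_of_mul_le_mul_left h5 h0

end Discrete

end DiracTSFP
end

noncomputable section
namespace DiracTSFP

/-! ### Truncation and aliasing errors -/

section Aliasing

variable {a b : ℝ} {M : ℕ}

lemma mesh_pos (hab : a < b) (hM : 0 < M) : 0 < mesh a b M :=
  div_pos (sub_pos.2 hab) (Nat.cast_pos.2 hM)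

lemma le_mesh_mul_weight (hab : a < b) (hM : 0 < M) {q : ℝ} {l : ℤ}
    (h : q * M ≤ 2 * |(l : ℝ)|) : q ≤ mesh a b M * weight a b l := by
  have hba : 0 < b - a := sub_pos.2 hab
  have hM' : (0 : ℝ) < M := Nat.cast_pos.2 hM
  have h1 := abs_freq_le_weight a b l
  have e : |freq a b l| = Real.pi * (2 * |(l : ℝ)|) / (b - a) := by
    rw [freq, abs_div, abs_mul, abs_mul, abs_of_pos hba, abs_of_pos Real.pi_pos,
      abs_of_pos (two_pos : (0 : ℝ) < 2)]
    ring
  have h2 : 2 * |(l : ℝ)| / (b - a) ≤ weight a b l := by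
    refine le_trans ?_ h1
    rw [e]
    refine div_le_div_of_nonneg_right ?_ hba.le
    nlinarith [Real.pi_gt_three, abs_nonneg (l : ℝ)]
  calc q ≤ 2 * |(l : ℝ)| / M := (le_div_iff₀ hM').2 h
    _ = mesh a b M * (2 * |(l : ℝ)| / (b - a)) := by
        rw [mesh]; field_simp
    _ ≤ _ := by
        have := mesh_pos hab hM
        gcongr

lemma one_le_mesh_mul_weight (hab : a < b) (hM : 0 < M) (hMe : Even M) {l : ℤ}
    (hl : l ∉ modes M) : 1 ≤ mesh a b M * weight a b l := by
  refine le_mesh_mul_weight hab hM ?_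
  have h : (M : ℤ) ≤ 2 * |l| := by
    obtain ⟨N, rfl⟩ := hMe
    simp only [modes, Finset.mem_Ico, not_and_or, not_le, not_lt] at hl
    push_cast at hl ⊢
    rcases hl with h | h
    · rw [abs_of_neg (by omega)]; omega
    · rw [abs_of_nonneg (by omega)]; omega
  rw [one_mul]
  exact_mod_cast h

lemma abs_le_mesh_mul_weight (hab : a < b) (hM : 0 < M) (hMe : Even M) {l p : ℤ}
    (hl : l ∈ modes M) (hp : p ≠ 0) : |(p : ℝ)| ≤ mesh a b M * weight a b (l + p * M) := by
  refine le_mesh_mul_weight hab hM ?_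
  have h : |p| * (M : ℤ) ≤ 2 * |l + p * M| := by
    obtain ⟨N, rfl⟩ := hMe
    simp only [modes, Finset.mem_Ico] at hl
    push_cast at hl ⊢
    have e : ((N : ℤ) + N) / 2 = N := by omega
    rw [e] at hl
    have h1 : |p * ((N : ℤ) + N)| ≤ |l + p * (N + N)| + |l| := by
      have := abs_sub (l + p * ((N : ℤ) + N)) l
      rwa [add_sub_cancel_left] at this
    have h2 : |l| ≤ N := abs_le.2 ⟨hl.1, hl.2.le⟩
    have h3 : |p * ((N : ℤ) + N)| = |p| * (N + N) := by
      rw [abs_mul, abs_of_nonneg (by positivity : (0 : ℤ) ≤ (N : ℤ) + N)]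
    have h4 : 1 ≤ |p| := Int.one_le_abs hp
    nlinarith
  exact_mod_cast h

lemma SobolevLE.norm_sub_truncSeq_le (hab : a < b) (hM : 0 < M) (hMe : Even M) {m : ℕ}
    {v : ellTwo Spinor} {B : ℝ} (h : SobolevLE a b m v B) :
    ‖v - DiracTSFP.truncSeq (modes M) v‖ ≤ mesh a b M ^ m * B := by
  have hm := mesh_pos hab hM
  refine (h.of_le (k' := 0) (by positivity) fun l => ?_).norm_le
  rw [ellTwo.sub_apply, truncSeq_apply, pow_zero, one_mul, ← mul_assoc, ← mul_pow]
  split_ifs with hl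
  · rw [sub_self, norm_zero]
    have := weight_pos a b l
    positivity
  · rw [sub_zero]
    exact le_mul_of_one_le_left (norm_nonneg _)
      (one_le_pow₀ (one_le_mesh_mul_weight hab hM hMe hl))

/-- The constant in the aliasing error. -/
def aliasConst : ℝ := √(∑' p : ℤ, 1 / (p : ℝ) ^ 2)

lemma aliasConst_nonneg : 0 ≤ aliasConst := Real.sqrt_nonneg _

lemma norm_sq_sub_discreteCoef_le (hab : a < b) (hM : 0 < M) (hMe : Even M) {m : ℕ} (hm : 1 ≤ m)
    {v : ellTwo Spinor} {B : ℝ} (h : SobolevLE a b m v B) {l : ℤ} (hl : l ∈ modes M)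
    (hs : Summable fun p : ℤ => (weight a b (l + p * M) ^ m * ‖v (l + p * M)‖) ^ 2) :
    ‖v l - discreteCoef M (gridEval a b M v) l‖ ^ 2 ≤ (aliasConst * mesh a b M ^ m) ^ 2 *
      ∑' p : ℤ, (weight a b (l + p * M) ^ m * ‖v (l + p * M)‖) ^ 2 := by
  have hh := mesh_pos hab hM
  have hsum := hasSum_discreteCoef_gridEval hab hM (h.summable_norm hab hm) l
  have hκ : Summable fun p : ℤ => 1 / (p : ℝ) ^ 2 := Real.summable_one_div_int_pow.2 one_lt_two
  have h1 : HasSum (fun p : ℤ => if p = 0 then 0 else v (l + p * M))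
      (discreteCoef M (gridEval a b M v) l - v l) := by
    have := hsum.sub (hasSum_ite_eq (0 : ℤ) (v l))
    refine this.congr_fun ?_ |> fun h => h
    intro p
    split_ifs with hp
    · simp [hp]
    · simp
  rw [norm_sub_rev]
  have hS0 : 0 ≤ ∑' p : ℤ, (weight a b (l + p * M) ^ m * ‖v (l + p * M)‖) ^ 2 :=
    tsum_nonneg fun p => sq_nonneg _
  refine le_of_tendsto ((h1.norm).pow 2) (Filter.Eventually.of_forall fun s => ?_)
  have hcs := Finset.sum_mul_sq_le_sq_mul_sq s
    (fun p : ℤ => mesh a b M ^ m * (1 / |(p : ℝ)|))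
    fun p => weight a b (l + p * M) ^ m * ‖v (l + p * M)‖
  have hterm : ‖∑ p ∈ s, if p = 0 then 0 else v (l + p * M)‖
      ≤ ∑ p ∈ s, (mesh a b M ^ m * (1 / |(p : ℝ)|)) *
        (weight a b (l + p * M) ^ m * ‖v (l + p * M)‖) := by
    refine (norm_sum_le _ _).trans (Finset.sum_le_sum fun p _ => ?_)
    have hw := weight_pos a b (l + p * M)
    split_ifs with hp
    · rw [norm_zero]
      positivity
    · have hp1 : (1 : ℝ) ≤ |(p : ℝ)| := by exact_mod_cast Int.one_le_abs hp
      have hpw := abs_le_mesh_mul_weight hab hM hMe hl hp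
      have h2 : |(p : ℝ)| ≤ (mesh a b M * weight a b (l + p * M)) ^ m :=
        calc |(p : ℝ)| ≤ |(p : ℝ)| ^ m := le_self_pow₀ hp1 (by omega)
          _ ≤ _ := by gcongr
      have h3 : 1 ≤ (mesh a b M * weight a b (l + p * M)) ^ m * (1 / |(p : ℝ)|) := by
        rw [mul_one_div, one_le_div (by positivity)]
        exact h2
      calc ‖v (l + p * M)‖ ≤ ((mesh a b M * weight a b (l + p * M)) ^ m * (1 / |(p : ℝ)|)) *
            ‖v (l + p * M)‖ := le_mul_of_one_le_left (norm_nonneg _) h3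
        _ = _ := by rw [mul_pow]; ring
  calc ‖∑ p ∈ s, if p = 0 then 0 else v (l + p * M)‖ ^ 2 ≤ _ :=
        pow_le_pow_left₀ (norm_nonneg _) hterm 2
    _ ≤ _ := hcs
    _ ≤ _ := by
      gcongr
      · calc ∑ p ∈ s, (mesh a b M ^ m * (1 / |(p : ℝ)|)) ^ 2
            = (mesh a b M ^ m) ^ 2 * ∑ p ∈ s, 1 / (p : ℝ) ^ 2 := by
              rw [Finset.mul_sum]
              refine Finset.sum_congr rfl fun p _ => ?_
              rw [mul_pow, div_pow, sq_abs, one_pow]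
          _ ≤ (mesh a b M ^ m) ^ 2 * ∑' p : ℤ, 1 / (p : ℝ) ^ 2 := by
              gcongr
              exact hκ.sum_le_tsum s fun p _ => by positivity
          _ = _ := by
              rw [mul_pow, aliasConst, Real.sq_sqrt (tsum_nonneg fun p => by positivity)]
              ring
      · exact hs.sum_le_tsum s fun p _ => sq_nonneg _

lemma SobolevLE.norm_truncSeq_sub_discSeq_le (hab : a < b) (hM : 0 < M) (hMe : Even M) {m : ℕ}
    (hm : 1 ≤ m) {v : ellTwo Spinor} {B : ℝ} (h : SobolevLE a b m v B) :
    ‖DiracTSFP.truncSeq (modes M) v - discSeq M (gridEval a b M v)‖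
      ≤ aliasConst * mesh a b M ^ m * B := by
  have hh := mesh_pos hab hM
  have hc := aliasConst_nonneg
  have hB := h.1
  let f : ℤ → ℝ := fun k => (weight a b k ^ m * ‖v k‖) ^ 2
  have hf : Summable f := summable_of_sum_le (fun k => sq_nonneg _) h.2
  have hfB : ∑' k, f k ≤ B ^ 2 := hf.tsum_le_of_sum_le h.2
  let φ : modes M × ℤ → ℤ := fun q => q.1 + q.2 * M
  have hφ : Function.Injective φ := by
    rintro ⟨⟨l, hl⟩, p⟩ ⟨⟨l', hl'⟩, p'⟩ hq
    have hq' : l + p * M = l' + p' * M := hq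
    have h0 : l' + (p' - p) * M = l := by linarith
    have hpp : p' - p = 0 :=
      eq_zero_of_add_mul_mem_modes hMe hl' (by rw [h0]; exact hl)
    have hp : p = p' := by omega
    subst hp
    have : l = l' := by linarith
    subst this
    rfl
  have hfφ : Summable fun q => f (φ q) := hf.comp_injective hφ
  have hsl : ∀ l : modes M, Summable fun p : ℤ => f ((l : ℤ) + p * M) := fun l =>
    hfφ.prod_factor l
  rw [discSeq, truncSeq_sub]
  refine abs_le_of_sq_le_sq' ?_ (by positivity) |>.2
  rw [norm_sq_truncSeq]
  calc ∑ l ∈ modes M, ‖(⇑v - discreteCoef M (gridEval a b M v)) l‖ ^ 2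
      ≤ ∑ l ∈ modes M, (aliasConst * mesh a b M ^ m) ^ 2 * ∑' p : ℤ, f (l + p * M) :=
        Finset.sum_le_sum fun l hl =>
          norm_sq_sub_discreteCoef_le hab hM hMe hm h hl (hsl ⟨l, hl⟩)
    _ = (aliasConst * mesh a b M ^ m) ^ 2 * ∑' q, f (φ q) := by
        rw [hfφ.tsum_prod, tsum_fintype, ← Finset.mul_sum, ← Finset.sum_coe_sort (modes M)]
    _ ≤ (aliasConst * mesh a b M ^ m) ^ 2 * B ^ 2 := by
        gcongr
        exact (tsum_comp_le_tsum_of_inj hf (fun k => sq_nonneg _) hφ).trans hfB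
    _ = _ := by ring

end Aliasing

end DiracTSFP
end

noncomputable section
namespace DiracTSFP

/-! ### The error of the fully discrete scheme -/

section Scheme

variable {a b : ℝ} {V A₁ : ℝ → ℝ} {ε τ : ℝ} {M : ℕ}

/-- The matrix potential `G(x) = V(x) I₂ - A₁(x) σ₁`. -/
def potMat (V A₁ : ℝ → ℝ) (x : ℝ) : Matrix (Fin 2) (Fin 2) ℂ :=
  (V x : ℂ) • (1 : Matrix (Fin 2) (Fin 2) ℂ) - (A₁ x : ℂ) • sigma1

lemma potMat_isHermitian (V A₁ : ℝ → ℝ) (x : ℝ) : (potMat V A₁ x).IsHermitian := by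
  refine Matrix.IsHermitian.sub ?_ ?_
  · rw [Matrix.IsHermitian, Matrix.conjTranspose_smul, Matrix.conjTranspose_one]
    simp
  · rw [Matrix.IsHermitian, Matrix.conjTranspose_smul, sigma1_isHermitian.eq]
    simp

lemma potentialStep_apply (U : Fin (M + 1) → Spinor) (j : Fin (M + 1)) :
    potentialStep a b V A₁ ε τ M U j
      = expI (matOp (potMat V A₁ (gridPoint a b M j))) (ε * τ) (U j) := by
  rw [← matOp_expI, potentialStep, act_eq_matOp]
  simp only [potMat]
  rw [Complex.ofReal_mul, ← mul_assoc]

lemma norm_potentialStep_sub (U W : Fin (M + 1) → Spinor) (j : Fin (M + 1)) :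
    ‖(potentialStep a b V A₁ ε τ M U - potentialStep a b V A₁ ε τ M W) j‖ = ‖(U - W) j‖ := by
  rw [Pi.sub_apply, potentialStep_apply, potentialStep_apply, ← map_sub]
  exact norm_expI_apply (isSelfAdjoint_matOp (potMat_isHermitian V A₁ _)) _ _

lemma potentialStep_zero : potentialStep a b V A₁ ε τ M 0 = 0 := by
  funext j
  rw [potentialStep_apply, Pi.zero_apply, map_zero]

lemma propagator_truncSeq (s : ℝ) (t : Finset ℤ) (u : ℤ → Spinor) :
    propagator a b s (truncSeq t u) = truncSeq t fun l => freeMode a b s l (u l) := by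
  refine ellTwo.ext fun l => ?_
  rw [propagator_apply, truncSeq_apply, truncSeq_apply]
  split_ifs
  · rfl
  · rw [map_zero]

lemma propagator_truncSeq_coe (s : ℝ) (t : Finset ℤ) (v : ellTwo Spinor) :
    propagator a b s (truncSeq t v) = truncSeq t (propagator a b s v) := by
  rw [propagator_truncSeq]
  congr 1
  funext l
  rw [propagator_apply]

lemma matOp_freeMode (τ : ℝ) (l : ℤ) :
    matOp (NormedSpace.exp (-(Complex.I * (τ : ℂ) / 2) • gammaMat a b l))
      = freeMode a b (τ / 2) l := by
  rw [freeMode, ← matOp_expI]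
  congr 4
  push_cast
  ring

lemma freeHalfStep_eq (U : Fin (M + 1) → Spinor) :
    freeHalfStep a b τ M U = gridEval a b M (propagator a b (τ / 2) (discSeq M U)) := by
  funext j
  rw [discSeq, propagator_truncSeq, gridEval_truncSeq, freeHalfStep]
  refine Finset.sum_congr rfl fun l _ => ?_
  rw [act_eq_matOp, matOp_freeMode]
  rfl

lemma discSeq_freeHalfStep (hab : a < b) (hM : 0 < M) (hMe : Even M) (U : Fin (M + 1) → Spinor) :
    discSeq M (freeHalfStep a b τ M U) = propagator a b (τ / 2) (discSeq M U) := by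
  rw [freeHalfStep_eq, discSeq, discSeq, propagator_truncSeq]
  exact discSeq_gridEval_truncSeq hab hM hMe _

/-- One step of the scheme, on discrete Fourier coefficients. -/
lemma discSeq_tsfp_succ (hab : a < b) (hM : 0 < M) (hMe : Even M) (Φ₀ : ℝ → Spinor) (n : ℕ) :
    discSeq M (tsfp a b V A₁ ε τ M Φ₀ (n + 1))
      = propagator a b (τ / 2) (discSeq M (potentialStep a b V A₁ ε τ M
          (gridEval a b M (propagator a b (τ / 2) (discSeq M (tsfp a b V A₁ ε τ M Φ₀ n)))))) := by
  rw [tsfp, discSeq_freeHalfStep hab hM hMe, freeHalfStep_eq]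

lemma norm_discSeq_potentialStep_sub_le (hab : a < b) (hM : 0 < M) (hMe : Even M)
    (u w : ℤ → Spinor) :
    ‖discSeq M (potentialStep a b V A₁ ε τ M (gridEval a b M (truncSeq (modes M) u)))
      - discSeq M (potentialStep a b V A₁ ε τ M (gridEval a b M (truncSeq (modes M) w)))‖
      ≤ ‖truncSeq (modes M) u - truncSeq (modes M) w‖ := by
  rw [← discSeq_sub]
  refine (norm_discSeq_le hab hM hMe _).trans (le_of_eq ?_)
  rw [gridNorm_congr (norm_potentialStep_sub _ _),
    ← gridEval_sub (summable_norm_truncSeq _ _) (summable_norm_truncSeq _ _), truncSeq_sub,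
    gridNorm_gridEval hab hM hMe]

lemma norm_discSeq_tsfp_succ_le (hab : a < b) (hM : 0 < M) (hMe : Even M) (Φ₀ : ℝ → Spinor)
    (n : ℕ) : ‖discSeq M (tsfp a b V A₁ ε τ M Φ₀ (n + 1))‖
      ≤ ‖discSeq M (tsfp a b V A₁ ε τ M Φ₀ n)‖ := by
  have hz : gridEval a b M (truncSeq (modes M) 0) = 0 := by
    funext j
    simp [gridEval_truncSeq]
  have hd : discSeq M (0 : Fin (M + 1) → Spinor) = 0 := by
    have := discSeq_sub (0 : Fin (M + 1) → Spinor) 0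
    simpa using this
  have h0 : truncSeq (modes M) 0 = 0 := ellTwo.ext fun l => by
    rw [truncSeq_apply]
    simp
  rw [discSeq_tsfp_succ hab hM hMe, norm_propagator]
  have h := norm_discSeq_potentialStep_sub_le (a := a) (b := b) (V := V) (A₁ := A₁) (ε := ε)
    (τ := τ) hab hM hMe
    (fun l => freeMode a b (τ / 2) l (discreteCoef M (tsfp a b V A₁ ε τ M Φ₀ n) l)) 0
  rw [hz, potentialStep_zero, hd, sub_zero, h0, sub_zero, ← propagator_truncSeq,
    norm_propagator] at h
  exact h

lemma norm_discSeq_tsfp_le (hab : a < b) (hM : 0 < M) (hMe : Even M) (Φ₀ : ℝ → Spinor)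
    (n : ℕ) : ‖discSeq M (tsfp a b V A₁ ε τ M Φ₀ n)‖
      ≤ ‖discSeq M (tsfp a b V A₁ ε τ M Φ₀ 0)‖ := by
  induction n with
  | zero => exact le_rfl
  | succ n ih => exact (norm_discSeq_tsfp_succ_le hab hM hMe Φ₀ n).trans ih

variable {g : ℤ → Spinor →L[ℂ] Spinor} {C : ℝ} {m : ℕ}

lemma gridPoint_mem_Icc (hab : a < b) (hM : 0 < M) (j : Fin (M + 1)) :
    gridPoint a b M j ∈ Icc a b := by
  have hh := mesh_pos hab hM
  have hj : ((j : ℕ) : ℝ) ≤ M := by exact_mod_cast Nat.lt_succ_iff.1 j.2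
  have hM' : (M : ℝ) ≠ 0 := Nat.cast_ne_zero.2 hM.ne'
  have e : (M : ℝ) * mesh a b M = b - a := by rw [mesh]; field_simp
  have h1 : 0 ≤ ((j : ℕ) : ℝ) * mesh a b M := by positivity
  have h2 : ((j : ℕ) : ℝ) * mesh a b M ≤ M * mesh a b M := by gcongr
  rw [gridPoint]
  exact ⟨by linarith, by linarith⟩

lemma gridEval_expI (hab : a < b) (hM : 0 < M) (hm : 1 ≤ m) (hg : Summable fun j => ‖g j‖)
    (hgV : ∀ x ∈ Icc a b, opValue a b x g = matOp (potMat V A₁ x))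
    (hG : ∀ v B, SobolevLE a b m v B → SobolevLE a b m (convOp g v) (C * B))
    {v : ellTwo Spinor} {B : ℝ} (h : SobolevLE a b m v B) :
    gridEval a b M (expI (convOp g) (ε * τ) v)
      = potentialStep a b V A₁ ε τ M (gridEval a b M v) := by
  funext j
  rw [potentialStep_apply, ← hgV _ (gridPoint_mem_Icc hab hM j)]
  exact evalSeries_exp_convOp hab hm _ hg hG _ h

lemma SobolevLE.expI_sub (hC : 0 ≤ C)
    (hG : ∀ v B, SobolevLE a b m v B → SobolevLE a b m (DiracTSFP.convOp g v) (C * B))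
    (hετ : 0 ≤ ε * τ) (hετ1 : ε * τ ≤ 1) {v : ellTwo Spinor} {B : ℝ} (h : SobolevLE a b m v B) :
    SobolevLE a b m (expI (DiracTSFP.convOp g) (ε * τ) v - v) (ε * τ * (C * Real.exp C) * B) := by
  have hB := h.1
  have hn : ‖-(Complex.I * ((ε * τ : ℝ) : ℂ))‖ = ε * τ := by
    rw [norm_neg, norm_mul, Complex.norm_I, one_mul, Complex.norm_real, Real.norm_of_nonneg hετ]
  have h1 := h.exp_sub_one hC hG (-(Complex.I * ((ε * τ : ℝ) : ℂ)))
  rw [hn] at h1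
  refine h1.mono ?_
  rw [mul_assoc (ε * τ)]
  gcongr
  exact mul_le_of_le_one_left hC hετ1

/-- The error of one step of the scheme. -/
lemma norm_step_error_le (hab : a < b) (hM : 0 < M) (hMe : Even M) (hm : 1 ≤ m)
    (hg : Summable fun j => ‖g j‖)
    (hgV : ∀ x ∈ Icc a b, opValue a b x g = matOp (potMat V A₁ x)) (hC : 0 ≤ C)
    (hG : ∀ v B, SobolevLE a b m v B → SobolevLE a b m (convOp g v) (C * B))
    (hG0 : ∀ v B, SobolevLE a b 0 v B → SobolevLE a b 0 (convOp g v) (C * B))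
    (hετ : 0 ≤ ε * τ) (hετ1 : ε * τ ≤ 1) {c₀ c₁ : ellTwo Spinor} {K δ : ℝ}
    (hK : SobolevLE a b m c₀ K)
    (hδ : ‖c₁ - propagator a b (τ / 2) (expI (convOp g) (ε * τ) (propagator a b (τ / 2) c₀))‖ ≤ δ)
    (u : ℤ → Spinor) :
    ‖truncSeq (modes M) c₁ - propagator a b (τ / 2) (discSeq M (potentialStep a b V A₁ ε τ M
        (gridEval a b M (propagator a b (τ / 2) (truncSeq (modes M) u)))))‖
      ≤ ‖truncSeq (modes M) c₀ - truncSeq (modes M) u‖ + δ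
        + ε * τ * ((C * Real.exp C) * (1 + aliasConst)) * mesh a b M ^ m * K := by
  have hh := mesh_pos hab hM
  set E := expI (convOp g) (ε * τ) with hE
  set ψ := propagator a b (τ / 2) c₀ with hψ
  set T : ellTwo Spinor → ellTwo Spinor := fun v => truncSeq (modes M) v with hT
  set Pψ := T ψ with hPψ
  have hψK : SobolevLE a b m ψ K := hK.propagator _
  have hPψK : SobolevLE a b m Pψ K := hψK.truncSeq _
  have hTsub : ∀ v w : ellTwo Spinor, T (v - w) = T v - T w := fun v w =>
    (truncSeq_sub _ _ _).symm
  have hBP := hPψK.expI_sub hC hG hετ hετ1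
  set D : ellTwo Spinor := discSeq M (potentialStep a b V A₁ ε τ M
        (gridEval a b M (propagator a b (τ / 2) (truncSeq (modes M) u)))) with hD
  have hTT : T Pψ = Pψ := ellTwo.ext fun l => by
    simp only [hT, hPψ, truncSeq_apply]
    split_ifs <;> rfl
  have hgE : gridEval a b M (E Pψ) = potentialStep a b V A₁ ε τ M (gridEval a b M Pψ) :=
    gridEval_expI hab hM hm hg hgV hG hPψK
  have hEPψ : SobolevLE a b m (E Pψ) (ε * τ * (C * Real.exp C) * K + K) := by
    simpa using hBP.add hPψK
  have hDR : discSeq M (gridEval a b M (E Pψ - Pψ))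
      = discSeq M (potentialStep a b V A₁ ε τ M (gridEval a b M Pψ)) - Pψ := by
    rw [gridEval_sub (hEPψ.summable_norm hab hm) (hPψK.summable_norm hab hm), discSeq_sub, hgE]
    congr 1
    exact discSeq_gridEval_truncSeq hab hM hMe _
  have e : T c₁ - propagator a b (τ / 2) D
      = T (c₁ - propagator a b (τ / 2) (E ψ)) + propagator a b (τ / 2)
        ((T (E (ψ - Pψ) - (ψ - Pψ)) + (T (E Pψ - Pψ) - discSeq M (gridEval a b M (E Pψ - Pψ))))
        + (discSeq M (potentialStep a b V A₁ ε τ M (gridEval a b M Pψ)) - D)) := by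
    rw [hDR]
    simp only [hTsub, map_sub, map_add, hTT]
    have : T (propagator a b (τ / 2) (E ψ)) = propagator a b (τ / 2) (T (E ψ)) :=
      (propagator_truncSeq_coe _ _ _).symm
    rw [this, ← hPψ]
    abel
  have n1 : ‖T (c₁ - propagator a b (τ / 2) (E ψ))‖ ≤ δ := (norm_truncSeq_le _ _).trans hδ
  have hψP : SobolevLE a b 0 (ψ - Pψ) (mesh a b M ^ m * K) :=
    SobolevLE.of_norm_le (hψK.norm_sub_truncSeq_le hab hM hMe)
  have n2 : ‖T (E (ψ - Pψ) - (ψ - Pψ))‖ ≤ ε * τ * (C * Real.exp C) * (mesh a b M ^ m * K) :=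
    (norm_truncSeq_le _ _).trans (hψP.expI_sub hC hG0 hετ hετ1).norm_le
  have n3 : ‖T (E Pψ - Pψ) - discSeq M (gridEval a b M (E Pψ - Pψ))‖
      ≤ aliasConst * mesh a b M ^ m * (ε * τ * (C * Real.exp C) * K) :=
    hBP.norm_truncSeq_sub_discSeq_le hab hM hMe hm
  have n4 : ‖discSeq M (potentialStep a b V A₁ ε τ M (gridEval a b M Pψ)) - D‖
      ≤ ‖truncSeq (modes M) c₀ - truncSeq (modes M) u‖ := by
    have h := norm_discSeq_potentialStep_sub_le (a := a) (b := b) (V := V) (A₁ := A₁) (ε := ε)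
      (τ := τ) hab hM hMe ψ (fun l => freeMode a b (τ / 2) l (u l))
    rw [← propagator_truncSeq] at h
    refine h.trans (le_of_eq ?_)
    rw [hψ, ← propagator_truncSeq_coe, ← map_sub, norm_propagator]
  rw [e]
  refine (norm_add_le_of_le n1 ((norm_propagator _ _ _ _).trans_le
    (norm_add_le_of_le (norm_add_le_of_le n2 n3) n4))).trans (le_of_eq ?_)
  ring

end Scheme

end DiracTSFP
end

noncomputable section
namespace DiracTSFP

/-! ### Accumulation of the local errors -/

section Global

variable {a b : ℝ} {V A₁ : ℝ → ℝ} {ε τ : ℝ} {M : ℕ} {g : ℤ → Spinor →L[ℂ] Spinor} {C K S : ℝ}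
  {m : ℕ} {c : ℝ → ellTwo Spinor} {Φ₀ : ℝ → Spinor}

lemma norm_truncSeq_sub_discSeq_tsfp_le (hab : a < b) (hM : 0 < M) (hMe : Even M) (hm : 2 ≤ m)
    (hg : Summable fun j => ‖g j‖)
    (hgV : ∀ x ∈ Icc a b, opValue a b x g = matOp (potMat V A₁ x)) (hC : 0 ≤ C)
    (hG : ∀ k ≤ m, ∀ v B, SobolevLE a b k v B → SobolevLE a b k (convOp g v) (C * B))
    (hτ : 0 < τ) (hτ1 : τ ≤ 1) (hε : 0 < ε) (hε1 : ε ≤ 1)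
    (hc : ∀ l, ContinuousOn (fun t => c t l) (Icc 0 S))
    (hd : ∀ t ∈ Ioo 0 S, ∀ l, HasDerivAt (fun t => c t l)
      (-(Complex.I • matOp (gammaMat a b l) (c t l)) - (Complex.I * ε) • convOp g (c t) l) t)
    (hK : ∀ t ∈ Icc 0 S, SobolevLE a b m (c t) K)
    (h0 : discSeq M (tsfp a b V A₁ ε τ M Φ₀ 0) = discSeq M (gridEval a b M (c 0)))
    (n : ℕ) (hn : n * τ ≤ S) :
    ‖truncSeq (modes M) (c (n * τ)) - discSeq M (tsfp a b V A₁ ε τ M Φ₀ n)‖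
      ≤ aliasConst * mesh a b M ^ m * K + n * (localConst C * K * (ε * τ ^ 3)
        + ε * τ * ((C * Real.exp C) * (1 + aliasConst)) * mesh a b M ^ m * K) := by
  induction n with
  | zero =>
    have hS : (0 : ℝ) ≤ S := by simpa using hn
    rw [h0]
    simpa using (hK 0 ⟨le_rfl, hS⟩).norm_truncSeq_sub_discSeq_le hab hM hMe (by omega)
  | succ n ih =>
    push_cast at hn ⊢
    have hp0 : 0 ≤ n * τ := by positivity
    have hpS : n * τ + τ ≤ S := by linarith
    have hsub : Icc (n * τ) (n * τ + τ) ⊆ Icc 0 S := Icc_subset_Icc hp0 hpS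
    have hstrang := norm_strang_local_error_le (G := convOp g) (p := n * τ) (K := K) hC
      (fun k hk => hG k (hk.trans hm)) hτ hτ1 hε hε1
      (fun l => (hc l).mono hsub) (fun t ht => hd t (Ioo_subset_Ioo hp0 hpS ht))
      (fun t ht => (hK t (hsub ht)).of_order_le hm)
    have hstep := norm_step_error_le (V := V) (A₁ := A₁) hab hM hMe (by omega) hg hgV hC
      (hG m le_rfl) (hG 0 (by omega)) (by positivity) (mul_le_one₀ hε1 hτ.le hτ1)
      (hK (n * τ) ⟨hp0, by linarith⟩) hstrang
      (discreteCoef M (tsfp a b V A₁ ε τ M Φ₀ n))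
    rw [discSeq_tsfp_succ hab hM hMe, add_one_mul]
    refine hstep.trans ?_
    have := ih (by linarith)
    rw [discSeq] at this
    linarith

/-- The global error of the scheme, on Fourier coefficients. -/
theorem norm_sub_discSeq_tsfp_le (hab : a < b) (hM : 0 < M) (hMe : Even M) (hm : 2 ≤ m)
    (hg : Summable fun j => ‖g j‖)
    (hgV : ∀ x ∈ Icc a b, opValue a b x g = matOp (potMat V A₁ x)) (hC : 0 ≤ C)
    (hG : ∀ k ≤ m, ∀ v B, SobolevLE a b k v B → SobolevLE a b k (convOp g v) (C * B))
    (hτ : 0 < τ) (hε : 0 < ε) (hε1 : ε ≤ 1)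
    (hc : ∀ l, ContinuousOn (fun t => c t l) (Icc 0 S))
    (hd : ∀ t ∈ Ioo 0 S, ∀ l, HasDerivAt (fun t => c t l)
      (-(Complex.I • matOp (gammaMat a b l) (c t l)) - (Complex.I * ε) • convOp g (c t) l) t)
    (hK : ∀ t ∈ Icc 0 S, SobolevLE a b m (c t) K)
    (h0 : discSeq M (tsfp a b V A₁ ε τ M Φ₀ 0) = discSeq M (gridEval a b M (c 0)))
    (n : ℕ) (hn : n * τ ≤ S) :
    ‖c (n * τ) - discSeq M (tsfp a b V A₁ ε τ M Φ₀ n)‖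
      ≤ ((2 + aliasConst) * K + (localConst C + (C * Real.exp C) * (1 + aliasConst)) * K * ε
        * (n * τ)) * (mesh a b M ^ m + τ ^ 2) := by
  have hh := mesh_pos hab hM
  have hα := aliasConst_nonneg
  have hL := localConst_nonneg hC
  have ht : n * τ ∈ Icc 0 S := ⟨by positivity, hn⟩
  have hKt := hK _ ht
  have hK0 : 0 ≤ K := hKt.1
  have hE := Real.exp_pos C
  set H := mesh a b M ^ m with hH
  have hHp : 0 < H := by positivity
  rcases le_or_gt τ 1 with hτ1 | hτ1
  · have h1 := norm_truncSeq_sub_discSeq_tsfp_le hab hM hMe hm hg hgV hC hG hτ hτ1 hε hε1 hc hd hK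
      h0 n hn
    have h2 := hKt.norm_sub_truncSeq_le hab hM hMe
    have h3 := norm_add_le_of_le h2 h1
    rw [sub_add_sub_cancel] at h3
    refine h3.trans ?_
    have p1 : 0 ≤ (1 + aliasConst) * K * τ ^ 2 := by positivity
    have p2 : 0 ≤ K * (H + τ ^ 2) := by positivity
    have p3 : 0 ≤ localConst C * K * ε * (n * τ) * H := by positivity
    have p4 : 0 ≤ C * Real.exp C * (1 + aliasConst) * K * ε * (n * τ) * τ ^ 2 := by positivity
    linear_combination p1 + p2 + p3 + p4
  · have h1 := norm_discSeq_tsfp_le (V := V) (A₁ := A₁) (ε := ε) (τ := τ) hab hM hMe Φ₀ n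
    have hK00 := hK 0 ⟨le_rfl, ht.1.trans ht.2⟩
    have h2 := hK00.norm_truncSeq_sub_discSeq_le hab hM hMe (by omega)
    have h3 := (norm_truncSeq_le (modes M) (c 0)).trans hK00.norm_le
    have h4 : ‖discSeq M (gridEval a b M (c 0))‖ ≤ K + aliasConst * H * K := by
      have := norm_sub_le (truncSeq (modes M) (c 0))
        (truncSeq (modes M) (c 0) - discSeq M (gridEval a b M (c 0)))
      rw [sub_sub_cancel] at this
      linarith
    have h5 := norm_sub_le (c (n * τ)) (discSeq M (tsfp a b V A₁ ε τ M Φ₀ n))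
    have h6 := hKt.norm_le
    rw [h0] at h1
    have h7 : ‖c (n * τ) - discSeq M (tsfp a b V A₁ ε τ M Φ₀ n)‖ ≤ 2 * K + aliasConst * H * K := by
      linarith
    refine h7.trans ?_
    have q : 0 ≤ 2 * K * (τ ^ 2 - 1) := by
      have : 1 ≤ τ ^ 2 := one_le_pow₀ hτ1.le
      have : 0 ≤ τ ^ 2 - 1 := by linarith
      positivity
    have p1 : 0 ≤ aliasConst * K * τ ^ 2 + 2 * K * H := by positivity
    have p3 : 0 ≤ (localConst C + (C * Real.exp C) * (1 + aliasConst)) * K * ε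
        * (n * τ) * (H + τ ^ 2) := by positivity
    linear_combination q + p1 + p3

end Global

end DiracTSFP
end

noncomputable section
namespace DiracTSFP

set_option linter.unusedSectionVars false

/-! ### Fourier coefficients of functions on `(a, b)` -/

section Coefficients

variable {E F : Type*} [NormedAddCommGroup E] [NormedSpace ℂ E] [NormedAddCommGroup F]
  [NormedSpace ℂ F] {a b : ℝ}

lemma mode_neg (a b : ℝ) (l : ℤ) (x : ℝ) :
    mode a b (-l) x = Complex.exp (-(Complex.I * (freq a b l : ℂ) * ((x - a : ℝ) : ℂ))) := by
  rw [mode]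
  congr 1
  simp only [freq]
  push_cast
  ring

lemma mode_zero (a b x : ℝ) : mode a b 0 x = 1 := by
  simp [mode, freq]

lemma hasDerivAt_mode (a b : ℝ) (l : ℤ) (x : ℝ) :
    HasDerivAt (mode a b l) (Complex.I * freq a b l * mode a b l x) x := by
  have h1 : HasDerivAt (fun y : ℝ => ((y - a : ℝ) : ℂ)) 1 x := by
    simpa using ((hasDerivAt_id x).sub_const a).ofReal_comp
  have h2 := (h1.const_mul (Complex.I * (freq a b l : ℂ))).cexp
  rw [mul_one, mul_comm (Complex.exp _)] at h2
  exact h2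

lemma continuous_mode (a b : ℝ) (l : ℤ) : Continuous (mode a b l) :=
  continuous_iff_continuousAt.2 fun x => (hasDerivAt_mode a b l x).continuousAt

lemma mode_left (a b : ℝ) (l : ℤ) : mode a b l a = 1 := by simp [mode]

lemma mode_right (hab : a < b) (l : ℤ) : mode a b l b = 1 := by
  have h : ((b - a : ℝ) : ℂ) ≠ 0 := Complex.ofReal_ne_zero.2 (sub_pos.2 hab).ne'
  rw [mode, ← Complex.exp_int_mul_two_pi_mul_I l]
  congr 1
  rw [freq, Complex.ofReal_div, mul_assoc, div_mul_cancel₀ _ h]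
  push_cast
  ring

/-- The Fourier coefficients of a function on `(a, b)` with values in a Banach space. -/
def coef (a b : ℝ) (u : ℝ → E) (l : ℤ) : E :=
  ((1 / (b - a) : ℝ) : ℂ) • ∫ x in Ioo a b, mode a b (-l) x • u x

lemma fourierCoef_eq_coef (hab : a < b) (U : ℝ → Spinor) : fourierCoef a b U = coef a b U := by
  funext l
  rw [fourierCoef, coef, intervalIntegral.integral_of_le hab.le, integral_Ioc_eq_integral_Ioo]
  simp_rw [mode_neg]

lemma coef_congr {u v : ℝ → E} (h : EqOn u v (Ioo a b)) (l : ℤ) : coef a b u l = coef a b v l := by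
  rw [coef, coef]
  congr 1
  exact setIntegral_congr_fun measurableSet_Ioo fun x hx => by simp only [h hx]

lemma integrableOn_mode_smul {u : ℝ → E} (hu : IntegrableOn u (Ioo a b)) (l : ℤ) :
    IntegrableOn (fun x => mode a b l x • u x) (Ioo a b) :=
  Integrable.bdd_smul hu 1 (continuous_mode a b l).aestronglyMeasurable
    (Filter.Eventually.of_forall fun x => (norm_mode a b l x).le)

lemma memLp_of_continuousOn {u : ℝ → E} (hu : ContinuousOn u (Icc a b)) {p : ℝ≥0∞} :
    MemLp u p (volume.restrict (Ioo a b)) := by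
  obtain ⟨C, hC⟩ := isCompact_Icc.exists_bound_of_continuousOn hu
  refine MemLp.of_bound ((hu.mono Ioo_subset_Icc_self).aestronglyMeasurable measurableSet_Ioo) C ?_
  exact (ae_restrict_mem measurableSet_Ioo).mono fun x hx => hC x (Ioo_subset_Icc_self hx)

lemma coef_sub {u v : ℝ → E} (hu : IntegrableOn u (Ioo a b)) (hv : IntegrableOn v (Ioo a b))
    (l : ℤ) : coef a b (fun x => u x - v x) l = coef a b u l - coef a b v l := by
  simp only [coef, smul_sub]
  rw [integral_sub (integrableOn_mode_smul hu _) (integrableOn_mode_smul hv _), smul_sub]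

lemma clm_coef [CompleteSpace E] [CompleteSpace F] (L : E →L[ℂ] F) {u : ℝ → E}
    (hu : IntegrableOn u (Ioo a b)) (l : ℤ) : L (coef a b u l) = coef a b (fun x => L (u x)) l := by
  rw [coef, coef, map_smul, ← L.integral_comp_comm (integrableOn_mode_smul hu _)]
  simp only [map_smul]

lemma integral_mode (hab : a < b) (k : ℤ) :
    ∫ x in Ioo a b, mode a b k x = if k = 0 then ((b - a : ℝ) : ℂ) else 0 := by
  split_ifs with hk
  · subst hk
    simp [mode_zero, hab.le]
  · have hc : Complex.I * (freq a b k : ℂ) ≠ 0 := by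
      have : freq a b k ≠ 0 := by
        have := (sub_pos.2 hab).ne'
        have := Real.pi_pos.ne'
        rw [freq]
        positivity
      exact mul_ne_zero Complex.I_ne_zero (Complex.ofReal_ne_zero.2 this)
    have hd : ∀ x ∈ uIcc a b,
        HasDerivAt (fun y => (Complex.I * (freq a b k : ℂ))⁻¹ * mode a b k y) (mode a b k x) x :=
      fun x _ => by
        have := (hasDerivAt_mode a b k x).const_mul (Complex.I * (freq a b k : ℂ))⁻¹
        rwa [inv_mul_cancel_left₀ hc] at this
    rw [← integral_Ioc_eq_integral_Ioo, ← intervalIntegral.integral_of_le hab.le,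
      intervalIntegral.integral_eq_sub_of_hasDerivAt hd
        ((continuous_mode a b k).intervalIntegrable _ _), mode_left, mode_right hab, sub_self]

lemma coef_of_hasSum [CompleteSpace E] (hab : a < b) {u : ℝ → E} {v : ℤ → E}
    (hv : Summable fun l => ‖v l‖) (h : ∀ x ∈ Ioo a b, HasSum (fun l => mode a b l x • v l) (u x))
    (l : ℤ) : coef a b u l = v l := by
  have hba : ((b - a : ℝ) : ℂ) ≠ 0 := Complex.ofReal_ne_zero.2 (sub_pos.2 hab).ne'
  have h1 : HasSum (fun k => ∫ x in Ioo a b, mode a b (-l) x • mode a b k x • v k)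
      (∫ x in Ioo a b, mode a b (-l) x • u x) := by
    refine hasSum_integral_of_dominated_convergence (fun k _ => ‖v k‖) (fun k => ?_)
      (fun k => Filter.Eventually.of_forall fun x => ?_) (Filter.Eventually.of_forall fun x => hv)
      (integrable_const _) ?_
    · exact (((continuous_mode a b _).smul ((continuous_mode a b k).smul
        continuous_const))).aestronglyMeasurable
    · rw [norm_smul, norm_smul, norm_mode, norm_mode, one_mul, one_mul]
    · exact (ae_restrict_mem measurableSet_Ioo).mono fun x hx => (h x hx).const_smul _
  have h2 : ∀ k, ∫ x in Ioo a b, mode a b (-l) x • mode a b k x • v k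
      = if k = l then ((b - a : ℝ) : ℂ) • v l else 0 := fun k => by
    simp_rw [smul_smul, ← mode_add]
    rw [integral_smul_const, integral_mode hab]
    by_cases hk : k = l
    · subst hk
      simp
    · rw [if_neg (by omega), if_neg hk, zero_smul]
  simp_rw [h2] at h1
  rw [coef, h1.unique (hasSum_ite_eq l _), smul_smul, one_div, Complex.ofReal_inv,
    inv_mul_cancel₀ hba, one_smul]

lemma norm_coef_eq (hab : a < b) (u : ℝ → ℂ) (l : ℤ) :
    ‖coef a b u l‖ = ‖fourierCoeffOn hab u l‖ := by
  have hba : ((b - a : ℝ) : ℂ) ≠ 0 := Complex.ofReal_ne_zero.2 (sub_pos.2 hab).ne'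
  have e : ∀ x : ℝ, mode a b (-l) x
      = Complex.exp (((freq a b l * a : ℝ) : ℂ) * Complex.I) *
        fourier (-l) (x : AddCircle (b - a)) := fun x => by
    rw [fourier_coe_apply, mode_neg, ← Complex.exp_add, freq]
    congr 1
    push_cast at hba ⊢
    field_simp
    ring
  rw [coef, fourierCoeffOn_eq_integral, intervalIntegral.integral_of_le hab.le,
    integral_Ioc_eq_integral_Ioo]
  simp_rw [e, smul_eq_mul, mul_assoc]
  rw [integral_const_mul, norm_mul, norm_mul, Complex.norm_exp_ofReal_mul_I, one_mul, norm_smul,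
    Complex.norm_real]

lemma hasSum_sq_coef_complex (hab : a < b) {u : ℝ → ℂ} (hu : MemLp u 2 (volume.restrict (Ioo a b))) :
    HasSum (fun l => ‖coef a b u l‖ ^ 2) ((b - a)⁻¹ * ∫ x in Ioo a b, ‖u x‖ ^ 2) := by
  have := hasSum_sq_fourierCoeffOn hab (f := u) (by rwa [← restrict_Ioo_eq_restrict_Ioc])
  simp_rw [← norm_coef_eq] at this
  rwa [intervalIntegral.integral_of_le hab.le, integral_Ioc_eq_integral_Ioo] at this

/-- Parseval's identity. -/
lemma hasSum_sq_coef (hab : a < b) {U : ℝ → Spinor} (hU : MemLp U 2 (volume.restrict (Ioo a b))) :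
    HasSum (fun l => ‖coef a b U l‖ ^ 2) ((b - a)⁻¹ * ∫ x in Ioo a b, ‖U x‖ ^ 2) := by
  let P : Fin 2 → Spinor →L[ℂ] ℂ := fun i => EuclideanSpace.proj i
  have hi : ∀ i, MemLp (fun x => P i (U x)) 2 (volume.restrict (Ioo a b)) := fun i =>
    (P i).comp_memLp' hU
  have h1 := (hasSum_sq_coef_complex hab (hi 0)).add (hasSum_sq_coef_complex hab (hi 1))
  have hint : IntegrableOn U (Ioo a b) := hU.integrable one_le_two
  have hn : ∀ v : Spinor, ‖v‖ ^ 2 = ‖P 0 v‖ ^ 2 + ‖P 1 v‖ ^ 2 := fun v => by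
    rw [EuclideanSpace.norm_sq_eq, Fin.sum_univ_two]
    rfl
  rw [← mul_add, ← integral_add (hi 0).norm.integrable_sq (hi 1).norm.integrable_sq] at h1
  simp_rw [hn, clm_coef (P _) hint]
  exact h1

/-- A continuous function with absolutely summable Fourier coefficients is the sum of its Fourier
series. -/
lemma hasSum_mode_smul_coef [CompleteSpace E] (hab : a < b) {u : ℝ → E}
    (hu : ContinuousOn u (Icc a b)) (hs : Summable fun l => ‖coef a b u l‖) {x : ℝ}
    (hx : x ∈ Icc a b) : HasSum (fun l => mode a b l x • coef a b u l) (u x) := by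
  have hsum : ∀ y, HasSum (fun l => mode a b l y • coef a b u l)
      (∑' l, mode a b l y • coef a b u l) := fun y =>
    (Summable.of_norm_bounded hs fun l => by rw [norm_smul, norm_mode, one_mul]).hasSum
  set w : ℝ → E := fun y => ∑' l, mode a b l y • coef a b u l with hw
  have hwc : Continuous w :=
    continuous_tsum (fun l => (continuous_mode a b l).smul continuous_const) hs fun l y => by
      rw [norm_smul, norm_mode, one_mul]
  have hd : ContinuousOn (fun y => u y - w y) (Icc a b) := hu.sub hwc.continuousOn
  have hui : IntegrableOn u (Ioo a b) := (hu.integrableOn_Icc).mono_set Ioo_subset_Icc_self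
  have hwi : IntegrableOn w (Ioo a b) :=
    (hwc.continuousOn.integrableOn_Icc).mono_set Ioo_subset_Icc_self
  have hz : ∀ l, coef a b (fun y => u y - w y) l = 0 := fun l => by
    rw [coef_sub hui hwi, coef_of_hasSum hab hs (fun y _ => hsum y), sub_self]
  suffices h : u x - w x = 0 by
    rw [sub_eq_zero.1 h]
    exact hsum x
  refine SeparatingDual.eq_zero_of_forall_dual_eq_zero (R := ℂ) fun L => ?_
  have hLc : ContinuousOn (fun y => L (u y - w y)) (Icc a b) := L.continuous.comp_continuousOn hd
  have hLm : MemLp (fun y => L (u y - w y)) 2 (volume.restrict (Ioo a b)) :=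
    memLp_of_continuousOn hLc
  have hP := hasSum_sq_coef_complex hab hLm
  have h0 : ∀ l, coef a b (fun y => L (u y - w y)) l = 0 := fun l => by
    rw [← clm_coef L (u := fun y => u y - w y) (hui.sub hwi) l, hz l, map_zero]
  simp_rw [h0] at hP
  have hI : ∫ y in Ioo a b, ‖L (u y - w y)‖ ^ 2 = 0 := by
    have h := hP.unique (a₂ := 0) (by simp [hasSum_zero])
    exact (mul_eq_zero.1 h).resolve_left (inv_ne_zero (sub_pos.2 hab).ne')
  have hI' : ∫ y in a..b, ‖L (u y - w y)‖ ^ 2 = 0 := by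
    rwa [intervalIntegral.integral_of_le hab.le, integral_Ioc_eq_integral_Ioo]
  by_contra hne
  refine (intervalIntegral.integral_pos hab (hLc.norm.pow 2) (fun y _ => sq_nonneg _)
    ⟨x, hx, pow_pos (norm_pos_iff.2 hne) 2⟩).ne' hI'

end Coefficients

end DiracTSFP
end

noncomputable section
namespace DiracTSFP

/-! ### Weak derivatives of periodic functions -/

section WeakDerivative

variable {a b : ℝ}

lemma exists_bound_deriv_smoothTransition : ∃ L, ∀ x, |deriv Real.smoothTransition x| ≤ L := by
  have hc : Continuous (deriv Real.smoothTransition) :=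
    (Real.smoothTransition.contDiff (n := 1)).continuous_deriv le_rfl
  obtain ⟨L, hL⟩ := (isCompact_Icc (a := (0 : ℝ)) (b := 1)).exists_bound_of_continuousOn
    hc.continuousOn
  have hL0 : 0 ≤ L := (norm_nonneg _).trans (hL 0 ⟨le_rfl, zero_le_one⟩)
  refine ⟨L, fun x => ?_⟩
  by_cases hx : x ∈ Icc (0 : ℝ) 1
  · exact hL x hx
  · have h0 : deriv Real.smoothTransition x = 0 := by
      rw [mem_Icc, not_and_or, not_le, not_le] at hx
      rcases hx with hx | hx
      · have : Real.smoothTransition =ᶠ[nhds x] fun _ => 0 := by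
          filter_upwards [gt_mem_nhds hx] with y hy
          exact Real.smoothTransition.zero_of_nonpos hy.le
        rw [this.deriv_eq, deriv_const]
      · have : Real.smoothTransition =ᶠ[nhds x] fun _ => 1 := by
          filter_upwards [lt_mem_nhds hx] with y hy
          exact Real.smoothTransition.one_of_one_le hy.le
        rw [this.deriv_eq, deriv_const]
    rw [h0, abs_zero]
    exact hL0

/-- A smooth cutoff function for `(a, b)`. -/
def cutoff (a b δ x : ℝ) : ℝ :=
  Real.smoothTransition ((x - a) / δ - 1) * Real.smoothTransition ((b - x) / δ - 1)

lemma contDiff_cutoff (a b δ : ℝ) {n : ℕ∞} : ContDiff ℝ n (cutoff a b δ) := by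
  refine ContDiff.mul ?_ ?_
  · exact Real.smoothTransition.contDiff.comp (by fun_prop)
  · exact Real.smoothTransition.contDiff.comp (by fun_prop)

lemma cutoff_nonneg (a b δ x : ℝ) : 0 ≤ cutoff a b δ x :=
  mul_nonneg (Real.smoothTransition.nonneg _) (Real.smoothTransition.nonneg _)

lemma cutoff_le_one (a b δ x : ℝ) : cutoff a b δ x ≤ 1 :=
  mul_le_one₀ (Real.smoothTransition.le_one _) (Real.smoothTransition.nonneg _)
    (Real.smoothTransition.le_one _)

lemma cutoff_eq_zero {δ x : ℝ} (hδ : 0 < δ) (hx : x ∉ Icc (a + δ) (b - δ)) :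
    cutoff a b δ x = 0 := by
  rw [mem_Icc, not_and_or, not_le, not_le] at hx
  rcases hx with hx | hx
  · rw [cutoff, Real.smoothTransition.zero_of_nonpos, zero_mul]
    rw [sub_nonpos, div_le_one hδ]
    linarith
  · rw [cutoff, mul_comm, Real.smoothTransition.zero_of_nonpos, zero_mul]
    rw [sub_nonpos, div_le_one hδ]
    linarith

lemma cutoff_eq_one {δ x : ℝ} (hδ : 0 < δ) (h1 : a + 2 * δ ≤ x) (h2 : x ≤ b - 2 * δ) :
    cutoff a b δ x = 1 := by
  rw [cutoff, Real.smoothTransition.one_of_one_le, Real.smoothTransition.one_of_one_le, one_mul]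
  · rw [le_sub_iff_add_le, le_div_iff₀ hδ]
    linarith
  · rw [le_sub_iff_add_le, le_div_iff₀ hδ]
    linarith

lemma tsupport_cutoff_subset {δ : ℝ} (hδ : 0 < δ) :
    tsupport (cutoff a b δ) ⊆ Icc (a + δ) (b - δ) :=
  closure_minimal (fun _ hx => by_contra fun h => hx (cutoff_eq_zero hδ h)) isClosed_Icc

lemma deriv_cutoff_eq_zero {δ x : ℝ} (hδ : 0 < δ) (h1 : a + 2 * δ < x) (h2 : x < b - 2 * δ) :
    deriv (cutoff a b δ) x = 0 := by
  have : cutoff a b δ =ᶠ[nhds x] fun _ => 1 := by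
    filter_upwards [lt_mem_nhds h1, gt_mem_nhds h2] with y hy1 hy2
    exact cutoff_eq_one hδ hy1.le hy2.le
  rw [this.deriv_eq, deriv_const]

lemma exists_bound_deriv_cutoff (a b : ℝ) :
    ∃ L, 0 ≤ L ∧ ∀ δ x, 0 < δ → |deriv (cutoff a b δ) x| ≤ L / δ := by
  obtain ⟨L, hL⟩ := exists_bound_deriv_smoothTransition
  have hL0 : 0 ≤ L := (abs_nonneg _).trans (hL 0)
  refine ⟨2 * L, by positivity, fun δ x hδ => ?_⟩
  have hs : ∀ y, HasDerivAt Real.smoothTransition (deriv Real.smoothTransition y) y := fun y =>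
    ((Real.smoothTransition.contDiff (n := 1)).differentiable one_ne_zero y).hasDerivAt
  have h1 : HasDerivAt (fun y => (y - a) / δ - 1) (1 / δ) x :=
    (((hasDerivAt_id x).sub_const a).div_const δ).sub_const 1
  have h2 : HasDerivAt (fun y => (b - y) / δ - 1) (-1 / δ) x :=
    (((hasDerivAt_id x).const_sub b).div_const δ).sub_const 1
  have h3 := ((hs _).comp x h1).mul ((hs _).comp x h2)
  have h4 : deriv (cutoff a b δ) x = _ := h3.deriv
  rw [h4]
  simp only [Function.comp_apply]
  refine (abs_add_le _ _).trans ?_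
  rw [abs_mul, abs_mul, abs_mul, abs_mul, abs_div, abs_div, abs_neg, abs_one, abs_of_pos hδ,
    abs_of_nonneg (Real.smoothTransition.nonneg _), abs_of_nonneg (Real.smoothTransition.nonneg _)]
  have b1 := hL ((x - a) / δ - 1)
  have b2 := hL ((b - x) / δ - 1)
  have c1 := Real.smoothTransition.le_one ((x - a) / δ - 1)
  have c2 := Real.smoothTransition.le_one ((b - x) / δ - 1)
  have c3 := Real.smoothTransition.nonneg ((x - a) / δ - 1)
  have c4 := Real.smoothTransition.nonneg ((b - x) / δ - 1)
  calc _ ≤ L * (1 / δ) * 1 + 1 * (L * (1 / δ)) := by gcongr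
    _ = _ := by ring

lemma integral_deriv_cutoff {δ : ℝ} (hab : a < b) (hδ : 0 < δ) :
    ∫ x in Ioo a b, deriv (cutoff a b δ) x = 0 := by
  have hc := contDiff_cutoff a b δ (n := 1)
  rw [← integral_Ioc_eq_integral_Ioo, ← intervalIntegral.integral_of_le hab.le,
    intervalIntegral.integral_deriv_eq_sub (fun x _ => hc.differentiable one_ne_zero x)
      ((hc.continuous_deriv le_rfl).intervalIntegrable _ _), cutoff_eq_zero hδ, cutoff_eq_zero hδ,
    sub_self]
  · simp [hδ]
  · simp [hδ]

lemma tendsto_integral_deriv_cutoff_mul (hab : a < b) {f : ℝ → ℝ} (hf : ContinuousOn f (Icc a b))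
    (hper : f a = f b) : Filter.Tendsto (fun n : ℕ => ∫ x in Ioo a b,
      deriv (cutoff a b (1 / ((n : ℝ) + 1))) x * f x) Filter.atTop (nhds 0) := by
  obtain ⟨L, hL0, hL⟩ := exists_bound_deriv_cutoff a b
  rw [Metric.tendsto_atTop]
  intro η hη
  obtain ⟨η', hη'0, hη'⟩ : ∃ η' > 0, L * 4 * η' < η := by
    refine ⟨η / (L * 4 + 1), by positivity, ?_⟩
    rw [mul_div_assoc', div_lt_iff₀ (by positivity)]
    nlinarith
  obtain ⟨ρ, hρ0, hρ⟩ := Metric.continuousWithinAt_iff.1 (hf a ⟨le_rfl, hab.le⟩) η' hη'0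
  obtain ⟨ρ', hρ'0, hρ'⟩ := Metric.continuousWithinAt_iff.1 (hf b ⟨hab.le, le_rfl⟩) η' hη'0
  obtain ⟨N, hN⟩ := exists_nat_one_div_lt
    (show 0 < min (min (ρ / 3) (ρ' / 3)) ((b - a) / 4) by
      have := sub_pos.2 hab
      positivity)
  refine ⟨N, fun n hn => ?_⟩
  have hδN : 1 / ((n : ℝ) + 1) ≤ 1 / ((N : ℝ) + 1) := by gcongr
  set δ : ℝ := 1 / ((n : ℝ) + 1) with hδ
  have hδ0 : 0 < δ := by positivity
  have hδ1 := hδN.trans_lt hN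
  rw [lt_min_iff, lt_min_iff] at hδ1
  obtain ⟨⟨d1, d2⟩, d3⟩ := hδ1
  have hdc : Continuous (deriv (cutoff a b δ)) :=
    (contDiff_cutoff a b δ (n := 1)).continuous_deriv le_rfl
  set F : ℝ → ℝ := fun x => deriv (cutoff a b δ) x * (f x - f a) with hF
  have hFc : ContinuousOn F (Icc a b) := hdc.continuousOn.mul (hf.sub continuousOn_const)
  have hFi : ∀ {p q}, a ≤ p → p ≤ q → q ≤ b → IntervalIntegrable F volume p q :=
    fun h1 h2 h3 => (hFc.mono (Icc_subset_Icc h1 h3)).intervalIntegrable_of_Icc h2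
  have e1 : ∫ x in Ioo a b, deriv (cutoff a b δ) x * f x = ∫ x in a..b, F x := by
    rw [intervalIntegral.integral_of_le hab.le, integral_Ioc_eq_integral_Ioo]
    have i1 : IntegrableOn (fun x => deriv (cutoff a b δ) x * f x) (Ioo a b) :=
      (hdc.continuousOn.mul hf).integrableOn_Icc.mono_set Ioo_subset_Icc_self
    have i2 : IntegrableOn (fun x => deriv (cutoff a b δ) x * f a) (Ioo a b) :=
      (hdc.continuousOn.mul continuousOn_const).integrableOn_Icc.mono_set Ioo_subset_Icc_self
    simp only [hF, mul_sub]
    rw [integral_sub i1 i2, integral_mul_const, integral_deriv_cutoff hab hδ0, zero_mul, sub_zero]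
  rw [dist_zero_right, e1,
    ← intervalIntegral.integral_add_adjacent_intervals (b := a + 2 * δ)
      (hFi le_rfl (by linarith) (by linarith)) (hFi (by linarith) (by linarith) le_rfl),
    ← intervalIntegral.integral_add_adjacent_intervals (b := b - 2 * δ)
      (hFi (by linarith) (by linarith) (by linarith)) (hFi (by linarith) (by linarith) le_rfl)]
  have z : ∫ x in (a + 2 * δ)..(b - 2 * δ), F x = 0 := by
    rw [intervalIntegral.integral_of_le (by linarith), integral_Ioc_eq_integral_Ioo]
    refine setIntegral_eq_zero_of_forall_eq_zero fun x hx => ?_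
    simp only [hF]
    rw [deriv_cutoff_eq_zero hδ0 hx.1 hx.2, zero_mul]
  have l1 : ‖∫ x in a..(a + 2 * δ), F x‖ ≤ L / δ * η' * |a + 2 * δ - a| := by
    refine intervalIntegral.norm_integral_le_of_norm_le_const fun x hx => ?_
    rw [uIoc_of_le (by linarith)] at hx
    rw [hF, norm_mul]
    have := hρ (x := x) ⟨hx.1.le, by linarith [hx.2]⟩
      (by rw [Real.dist_eq, abs_of_nonneg (by linarith [hx.1])]; linarith [hx.2])
    rw [Real.dist_eq] at this
    exact mul_le_mul (hL δ x hδ0) this.le (norm_nonneg _) (by positivity)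
  have l2 : ‖∫ x in (b - 2 * δ)..b, F x‖ ≤ L / δ * η' * |b - (b - 2 * δ)| := by
    refine intervalIntegral.norm_integral_le_of_norm_le_const fun x hx => ?_
    rw [uIoc_of_le (by linarith)] at hx
    rw [hF, norm_mul]
    have := hρ' (x := x) ⟨by linarith [hx.1], hx.2⟩
      (by rw [Real.dist_eq, abs_of_nonpos (by linarith [hx.2])]; linarith [hx.1])
    rw [Real.dist_eq, ← hper] at this
    exact mul_le_mul (hL δ x hδ0) this.le (norm_nonneg _) (by positivity)
  have e2 : |a + 2 * δ - a| = 2 * δ := by rw [add_sub_cancel_left, abs_of_pos (by positivity)]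
  have e3 : |b - (b - 2 * δ)| = 2 * δ := by rw [sub_sub_cancel, abs_of_pos (by positivity)]
  rw [e2] at l1
  rw [e3] at l2
  have e4 : L / δ * η' * (2 * δ) = L * 2 * η' := by field_simp
  rw [e4] at l1 l2
  rw [z, zero_add]
  refine (norm_add_le_of_le l1 l2).trans_lt ?_
  linarith

/-- The weak derivative of a periodic function may be tested against smooth periodic functions. -/
lemma IsWeakDeriv.integral_mul_add_eq_zero (hab : a < b) {u v : ℝ → ℝ}
    (h : IsWeakDeriv a b u v) (hu : ContinuousOn u (Icc a b)) (hper : u a = u b)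
    (hv : IntegrableOn v (Ioo a b)) {e : ℝ → ℝ} (he : ContDiff ℝ ∞ e) (heper : e a = e b) :
    ∫ x in Ioo a b, (deriv e x * u x + e x * v x) = 0 := by
  have hec : Continuous e := he.continuous
  have hec' : Continuous (deriv e) := he.continuous_deriv (by simp)
  have hfc : ContinuousOn (fun x => e x * u x) (Icc a b) := hec.continuousOn.mul hu
  have hlim := tendsto_integral_deriv_cutoff_mul hab hfc (by simp only [heper, hper])
  have hui : IntegrableOn u (Ioo a b) := hu.integrableOn_Icc.mono_set Ioo_subset_Icc_self
  have hmul : ∀ {k w : ℝ → ℝ}, Continuous k → IntegrableOn w (Ioo a b) →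
      IntegrableOn (fun x => k x * w x) (Ioo a b) := fun {k w} hk hw => by
    obtain ⟨B, hB⟩ := isCompact_Icc.exists_bound_of_continuousOn (hk.continuousOn (s := Icc a b))
    exact Integrable.bdd_mul hw hk.aestronglyMeasurable
      ((ae_restrict_mem measurableSet_Ioo).mono fun x hx => hB x (Ioo_subset_Icc_self hx))
  have hFi : IntegrableOn (fun x => deriv e x * u x + e x * v x) (Ioo a b) :=
    (hmul hec' hui).add (hmul hec hv)
  have hlim2 : Filter.Tendsto (fun n : ℕ => ∫ x in Ioo a b, cutoff a b (1 / ((n : ℝ) + 1)) x *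
      (deriv e x * u x + e x * v x)) Filter.atTop
      (nhds (∫ x in Ioo a b, (deriv e x * u x + e x * v x))) := by
    refine tendsto_integral_of_dominated_convergence
      (fun x => ‖deriv e x * u x + e x * v x‖) (fun n => ?_) hFi.norm (fun n => ?_) ?_
    · exact (hmul (contDiff_cutoff a b _ (n := 0)).continuous hFi).aestronglyMeasurable
    · refine Filter.Eventually.of_forall fun x => ?_
      rw [norm_mul, Real.norm_of_nonneg (cutoff_nonneg _ _ _ _)]
      exact mul_le_of_le_one_left (norm_nonneg _) (cutoff_le_one _ _ _ _)
    · refine (ae_restrict_mem measurableSet_Ioo).mono fun x hx => ?_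
      refine tendsto_const_nhds.congr' ?_
      obtain ⟨N, hN⟩ := exists_nat_one_div_lt
        (show 0 < min ((x - a) / 2) ((b - x) / 2) by
          have := sub_pos.2 hx.1
          have := sub_pos.2 hx.2
          positivity)
      filter_upwards [Filter.eventually_ge_atTop N] with n hn
      have hδN : 1 / ((n : ℝ) + 1) ≤ 1 / ((N : ℝ) + 1) := by gcongr
      have h1 := hδN.trans_lt hN
      rw [lt_min_iff] at h1
      rw [cutoff_eq_one (by positivity) (by linarith [h1.1]) (by linarith [h1.2]), one_mul]
  have hsum := hlim.add hlim2
  rw [zero_add] at hsum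
  refine tendsto_nhds_unique hsum (tendsto_const_nhds.congr fun n => ?_)
  set δ : ℝ := 1 / ((n : ℝ) + 1) with hδ
  have hδ0 : 0 < δ := by positivity
  have hcd := contDiff_cutoff a b δ (n := ⊤)
  have hts : tsupport (fun x => cutoff a b δ x * e x) ⊆ Icc (a + δ) (b - δ) :=
    (tsupport_mul_subset_left).trans (tsupport_cutoff_subset hδ0)
  have hw := h (fun x => cutoff a b δ x * e x) (hcd.mul he)
    (isCompact_Icc.of_isClosed_subset (isClosed_tsupport _) hts)
    (hts.trans (Icc_subset_Ioo (by linarith) (by linarith)))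
  have hcc : Continuous (cutoff a b δ) := hcd.continuous
  have hcc' : Continuous (deriv (cutoff a b δ)) := hcd.continuous_deriv (by simp)
  have hder : ∀ x, deriv (fun x => cutoff a b δ x * e x) x
      = deriv (cutoff a b δ) x * e x + cutoff a b δ x * deriv e x := fun x =>
    deriv_fun_mul (hcd.differentiable (by simp) x) (he.differentiable (by simp) x)
  simp only [hder, smul_eq_mul] at hw
  rw [← integral_add (hmul hcc' (hfc.integrableOn_Icc.mono_set Ioo_subset_Icc_self))
    (hmul hcc hFi), eq_comm]
  have i1 : IntegrableOn (fun x => (deriv (cutoff a b δ) x * e x + cutoff a b δ x * deriv e x) * u x)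
      (Ioo a b) := hmul ((hcc'.mul hec).add (hcc.mul hec')) hui
  have i2 : IntegrableOn (fun x => cutoff a b δ x * e x * v x) (Ioo a b) := hmul (hcc.mul hec) hv
  rw [← add_eq_zero_iff_eq_neg, ← integral_add i1 i2] at hw
  rw [← hw]
  refine integral_congr_ae (Filter.Eventually.of_forall fun x => ?_)
  ring

end WeakDerivative

end DiracTSFP
end

noncomputable section
namespace DiracTSFP

/-! ### Fourier coefficients of the potentials -/

section Potential

variable {a b : ℝ} {m : ℕ}

lemma IsWeakDeriv.coef_eq (hab : a < b) {u v : ℝ → ℝ}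
    (h : IsWeakDeriv a b u v) (hu : ContinuousOn u (Icc a b)) (hper : u a = u b)
    (hv : IntegrableOn v (Ioo a b)) (l : ℤ) :
    coef a b (fun x => (v x : ℂ)) l
      = Complex.I * freq a b l * coef a b (fun x => (u x : ℂ)) l := by
  set μ := freq a b l with hμ
  have hmode : ∀ x, mode a b (-l) x
      = (Real.cos (μ * (x - a)) : ℂ) - Real.sin (μ * (x - a)) * Complex.I := fun x => by
    have e : mode a b (-l) x = Complex.exp (((-(μ * (x - a)) : ℝ) : ℂ) * Complex.I) := by
      rw [mode_neg]
      congr 1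
      push_cast
      ring
    rw [e, Complex.exp_mul_I, ← Complex.ofReal_cos, ← Complex.ofReal_sin, Real.cos_neg,
      Real.sin_neg]
    push_cast
    ring
  have hμb : ∃ n : ℤ, μ * (b - a) = n * (2 * Real.pi) := by
    refine ⟨l, ?_⟩
    rw [hμ, freq, div_mul_cancel₀ _ (sub_pos.2 hab).ne']
    ring
  obtain ⟨n, hn⟩ := hμb
  have hcos := h.integral_mul_add_eq_zero hab hu hper hv
    (e := fun x => Real.cos (μ * (x - a))) (by fun_prop) (by simp [hn, Real.cos_int_mul_two_pi])
  have hsin := h.integral_mul_add_eq_zero hab hu hper hv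
    (e := fun x => Real.sin (μ * (x - a))) (by fun_prop) (by
      have := Real.sin_periodic.int_mul n 0
      simp only [zero_add, Real.sin_zero] at this
      simp [hn, this])
  have hid : ∀ x, HasDerivAt (fun y => μ * (y - a)) μ x := fun x => by
    simpa using ((hasDerivAt_id x).sub_const a).const_mul μ
  have dcos : ∀ x, deriv (fun x => Real.cos (μ * (x - a))) x = -Real.sin (μ * (x - a)) * μ :=
    fun x => (hid x).cos.deriv
  have dsin : ∀ x, deriv (fun x => Real.sin (μ * (x - a))) x = Real.cos (μ * (x - a)) * μ :=
    fun x => (hid x).sin.deriv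
  simp only [dcos] at hcos
  simp only [dsin] at hsin
  have huc : IntegrableOn (fun x => (u x : ℂ)) (Ioo a b) :=
    (hu.integrableOn_Icc.mono_set Ioo_subset_Icc_self).ofReal
  have hvc : IntegrableOn (fun x => (v x : ℂ)) (Ioo a b) := hv.ofReal
  have i1 := integrableOn_mode_smul hvc (-l)
  have i2 := (integrableOn_mode_smul huc (-l)).const_mul (Complex.I * (μ : ℂ))
  have key : ∫ x in Ioo a b, (mode a b (-l) x • (v x : ℂ)
      - Complex.I * μ * (mode a b (-l) x • (u x : ℂ))) = 0 := by
    rw [← integral_re_add_im (f := fun x => mode a b (-l) x • (v x : ℂ)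
      - Complex.I * μ * (mode a b (-l) x • (u x : ℂ))) (i1.sub i2)]
    have r1 : ∀ x, RCLike.re (mode a b (-l) x • (v x : ℂ)
        - Complex.I * μ * (mode a b (-l) x • (u x : ℂ)))
        = -Real.sin (μ * (x - a)) * μ * u x + Real.cos (μ * (x - a)) * v x := fun x => by
      rw [hmode]
      generalize Real.cos (μ * (x - a)) = p
      generalize Real.sin (μ * (x - a)) = q
      simp
      ring
    have r2 : ∀ x, RCLike.im (mode a b (-l) x • (v x : ℂ)
        - Complex.I * μ * (mode a b (-l) x • (u x : ℂ)))
        = -(Real.cos (μ * (x - a)) * μ * u x + Real.sin (μ * (x - a)) * v x) := fun x => by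
      rw [hmode]
      generalize Real.cos (μ * (x - a)) = p
      generalize Real.sin (μ * (x - a)) = q
      simp
      ring
    simp only [r1, r2, hcos, integral_neg, hsin]
    simp
  rw [integral_sub i1 i2, integral_const_mul, sub_eq_zero] at key
  rw [coef, coef, key, smul_eq_mul, smul_eq_mul]
  ring

lemma MemSobolevPer.continuousOn {V : ℝ → ℝ} {p : ℝ≥0∞} (hm : 1 ≤ m)
    (hV : MemSobolevPer m p a b V) : ContinuousOn V (Icc a b) := by
  obtain ⟨g, h0, -, -, hc⟩ := hV
  exact (hc 0 (by omega)).1.congr h0.symm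

lemma MemSobolevPer.summable_weight_mul_coef (hab : a < b) {V : ℝ → ℝ}
    (hV : MemSobolevPer m ∞ a b V) :
    Summable fun l => (weight a b l ^ m * ‖coef a b (fun x => (V x : ℂ)) l‖) ^ 2 := by
  obtain ⟨g, h0, hL, hw, hc⟩ := hV
  have hL2 : ∀ k ≤ m, MemLp (g k) 2 (volume.restrict (Ioo a b)) := fun k hk =>
    (hL k hk).mono_exponent le_top
  have hs : ∀ k ≤ m, Summable fun l => ‖coef a b (fun x => (g k x : ℂ)) l‖ ^ 2 := fun k hk =>
    (hasSum_sq_coef_complex hab (hL2 k hk).ofReal).summable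
  have hk : ∀ k ≤ m, ∀ l, ‖coef a b (fun x => (g k x : ℂ)) l‖
      = |freq a b l| ^ k * ‖coef a b (fun x => (g 0 x : ℂ)) l‖ := by
    intro k
    induction k with
    | zero => simp
    | succ k ih =>
      intro hkm l
      obtain ⟨hck, hpk⟩ := hc k (by omega)
      rw [(hw k (by omega)).coef_eq hab hck hpk ((hL2 (k + 1) hkm).integrable one_le_two), norm_mul,
        norm_mul, Complex.norm_I, one_mul, Complex.norm_real, Real.norm_eq_abs, ih (by omega),
        pow_succ]
      ring
  have e0 : ∀ l, coef a b (fun x => (V x : ℂ)) l = coef a b (fun x => (g 0 x : ℂ)) l := fun l =>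
    coef_congr (fun x hx => by simp only [h0 (Ioo_subset_Icc_self hx)]) l
  refine Summable.of_nonneg_of_le (fun l => sq_nonneg _) (fun l => ?_)
    (((hs 0 (by omega)).add (hs m le_rfl)).mul_left (2 ^ (m - 1)))
  rw [e0, hk m le_rfl l, mul_pow, mul_pow, ← pow_mul, ← pow_mul, mul_comm m 2, pow_mul, pow_mul,
    weight_sq, sq_abs]
  have h1 := add_pow_le zero_le_one (sq_nonneg (freq a b l)) m
  rw [one_pow] at h1
  calc (1 + freq a b l ^ 2) ^ m * ‖coef a b (fun x => (g 0 x : ℂ)) l‖ ^ 2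
      ≤ 2 ^ (m - 1) * (1 + (freq a b l ^ 2) ^ m) * ‖coef a b (fun x => (g 0 x : ℂ)) l‖ ^ 2 := by
        gcongr
    _ = _ := by ring

lemma exists_sobolevLE_of_summable {E : Type*} [NormedAddCommGroup E] [NormedSpace ℂ E]
    {f : ℤ → E} (hf : Summable fun l => (weight a b l ^ m * ‖f l‖) ^ 2) :
    ∃ (v : ellTwo E) (B : ℝ), (∀ l, v l = f l) ∧ SobolevLE a b m v B := by
  have h2 : Memℓp f 2 := memℓp_two_of_summable <|
    Summable.of_nonneg_of_le (fun l => sq_nonneg _) (fun l => by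
      have := one_le_weight a b l
      gcongr
      exact le_mul_of_one_le_left (norm_nonneg _) (one_le_pow₀ this)) hf
  refine ⟨⟨f, h2⟩, √(∑' l, (weight a b l ^ m * ‖f l‖) ^ 2), fun l => rfl, Real.sqrt_nonneg _,
    fun s => ?_⟩
  rw [Real.sq_sqrt (tsum_nonneg fun l => sq_nonneg _)]
  exact hf.sum_le_tsum s fun l _ => sq_nonneg _

/-- Multiplication by a function with Fourier coefficients `g`, bounded on `H^k` for `k ≤ m`. -/
lemma exists_sobolevLE_convOp {E : Type*} [NormedAddCommGroup E] [NormedSpace ℂ E]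
    [CompleteSpace E] (hab : a < b) (hm : 1 ≤ m) {g : ℤ → E →L[ℂ] E}
    (hg : Summable fun l => (weight a b l ^ m * ‖g l‖) ^ 2) :
    (Summable fun l => ‖g l‖) ∧ ∃ C, 0 ≤ C ∧ ∀ k ≤ m, ∀ v B,
      SobolevLE a b k v B → SobolevLE a b k (convOp g v) (C * B) := by
  obtain ⟨w, D, hw, hwD⟩ := exists_sobolevLE_of_summable hg
  have hgs : Summable fun l => ‖g l‖ := by
    simpa only [hw] using hwD.summable_norm hab hm
  have hD := hwD.1
  have hN : 0 ≤ ∑' l, ‖g l‖ := tsum_nonneg fun l => norm_nonneg _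
  have he := embConst_nonneg a b
  refine ⟨hgs, 2 ^ m * (∑' l, ‖g l‖ + embConst a b * D), by positivity, fun k hk v B h => ?_⟩
  have hB := h.1
  rcases Nat.eq_zero_or_pos k with rfl | hk1
  · refine SobolevLE.of_norm_le ?_
    calc ‖convOp g v‖ ≤ (∑' l, ‖g l‖) * B :=
          ContinuousLinearMap.le_of_opNorm_le_of_le _ (norm_convOp_le hgs) h.norm_le
      _ ≤ (1 * (∑' l, ‖g l‖ + embConst a b * D)) * B := by
          rw [one_mul]
          gcongr
          exact le_add_of_nonneg_right (by positivity)
      _ ≤ _ := by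
          gcongr
          exact one_le_pow₀ one_le_two
  · have hwk := hwD.of_order_le hk
    have hγ2 : Memℓp (fun l => ((weight a b l ^ k * ‖g l‖ : ℝ) : ℂ)) 2 :=
      memℓp_two_of_sum_le (C := D ^ 2) fun s => by
        simpa only [hw, Complex.norm_real, Real.norm_eq_abs, sq_abs] using hwk.2 s
    have hγ : ∀ l, ‖(⟨_, hγ2⟩ : ellTwo ℂ) l‖ = weight a b l ^ k * ‖g l‖ := fun l => by
      have := weight_pos a b l
      exact (Complex.norm_real _).trans (Real.norm_of_nonneg (by positivity))
    have hγD : ‖(⟨_, hγ2⟩ : ellTwo ℂ)‖ ≤ D := ellTwo.norm_le_of_sum_sq_le hD fun s => by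
      simp_rw [hγ]
      simpa only [hw] using hwk.2 s
    refine (h.convOp hab hk1 hgs hγ).mono ?_
    gcongr
    exact one_le_two

lemma norm_smul_sub_smul_le {F : Type*} [NormedAddCommGroup F] [NormedSpace ℂ F] (x y : ℂ)
    (A B : F) : ‖x • A - y • B‖ ≤ ‖A‖ * ‖x‖ + ‖B‖ * ‖y‖ := by
  refine (norm_sub_le _ _).trans (le_of_eq ?_)
  rw [norm_smul, norm_smul, mul_comm, mul_comm ‖y‖]

lemma summable_weight_mul_smul_sub {F : Type*} [NormedAddCommGroup F] [NormedSpace ℂ F]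
    {x y : ℤ → ℂ} (hx : Summable fun l => (weight a b l ^ m * ‖x l‖) ^ 2)
    (hy : Summable fun l => (weight a b l ^ m * ‖y l‖) ^ 2) (A B : F) :
    Summable fun l => (weight a b l ^ m * ‖x l • A - y l • B‖) ^ 2 := by
  refine Summable.of_nonneg_of_le (fun l => sq_nonneg _) (fun l => ?_)
    ((hx.mul_left (2 * ‖A‖ ^ 2)).add (hy.mul_left (2 * ‖B‖ ^ 2)))
  have h := norm_smul_sub_smul_le (x l) (y l) A B
  have hw := weight_pos a b l
  calc (weight a b l ^ m * ‖x l • A - y l • B‖) ^ 2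
      ≤ (weight a b l ^ m * (‖A‖ * ‖x l‖ + ‖B‖ * ‖y l‖)) ^ 2 := by gcongr
    _ ≤ _ := by
      nlinarith [sq_nonneg (weight a b l ^ m * (‖A‖ * ‖x l‖ - ‖B‖ * ‖y l‖))]

lemma hasSum_smul_sub_smul {F : Type*} [NormedAddCommGroup F] [NormedSpace ℂ F] {x y e : ℤ → ℂ}
    {p q : ℂ} (hx : HasSum (fun l => e l • x l) p) (hy : HasSum (fun l => e l • y l) q) (A B : F) :
    HasSum (fun l => e l • (x l • A - y l • B)) (p • A - q • B) := by
  refine ((hx.smul_const A).sub (hy.smul_const B)).congr_fun ?_ |> fun h => h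
  intro l
  rw [smul_sub, smul_smul, smul_smul, smul_eq_mul, smul_eq_mul]

lemma matOp_potMat (V A₁ : ℝ → ℝ) (x : ℝ) :
    matOp (potMat V A₁ x) = (V x : ℂ) • ContinuousLinearMap.id ℂ Spinor
      - (A₁ x : ℂ) • matOp sigma1 := by
  rw [potMat, matOp, map_sub, map_smul, map_smul, map_one]
  rfl

/-- The multiplication operator by `V I₂ - A₁ σ₁` in Fourier space. -/
lemma exists_potential_symbol (hab : a < b) (hm : 1 ≤ m) {V A₁ : ℝ → ℝ}
    (hV : MemSobolevPer m ∞ a b V) (hA : MemSobolevPer m ∞ a b A₁) :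
    ∃ g : ℤ → Spinor →L[ℂ] Spinor, (Summable fun l => ‖g l‖) ∧
      (∀ x ∈ Icc a b, opValue a b x g = matOp (potMat V A₁ x)) ∧
      ∃ C, 0 ≤ C ∧ ∀ k ≤ m, ∀ v B,
        SobolevLE a b k v B → SobolevLE a b k (convOp g v) (C * B) := by
  have sV := hV.summable_weight_mul_coef hab
  have sA := hA.summable_weight_mul_coef hab
  have hg := summable_weight_mul_smul_sub sV sA (ContinuousLinearMap.id ℂ Spinor) (matOp sigma1)
  obtain ⟨hgs, hC⟩ := exists_sobolevLE_convOp hab hm hg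
  refine ⟨_, hgs, fun x hx => ?_, hC⟩
  have key : ∀ {W : ℝ → ℝ}, MemSobolevPer m ∞ a b W →
      HasSum (fun l => mode a b l x • coef a b (fun x => (W x : ℂ)) l) (W x : ℂ) := fun {W} hW => by
    obtain ⟨w, D, hw, hwD⟩ := exists_sobolevLE_of_summable (hW.summable_weight_mul_coef hab)
    have hs := hwD.summable_norm hab hm
    simp only [hw] at hs
    exact hasSum_mode_smul_coef hab
      (Complex.continuous_ofReal.comp_continuousOn (hW.continuousOn hm)) hs hx
  rw [matOp_potMat]
  exact (hasSum_opValue a b x hgs).unique (hasSum_smul_sub_smul (key hV) (key hA) _ _)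

end Potential

end DiracTSFP
end

noncomputable section
namespace DiracTSFP

/-! ### The Dirac equation on Fourier coefficients -/

section Series

variable {E : Type*} [NormedAddCommGroup E] [NormedSpace ℂ E] [CompleteSpace E] {a b K : ℝ}

lemma hasDerivAt_evalSeries (hab : a < b) {v : ellTwo E} (hv : SobolevLE a b 2 v K) (x : ℝ) :
    HasDerivAt (fun y => evalSeries a b y v)
      (∑' l, mode a b l x • (Complex.I * freq a b l) • v l) x := by
  have h0 : Summable fun l => mode a b l x • v l :=
    (hasSum_evalSeries a b x (hv.summable_norm hab one_le_two)).summable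
  have hu : Summable fun l => weight a b l ^ 1 * ‖v l‖ := hv.summable_weight_mul_norm hab
  refine hasDerivAt_tsum (g := fun l y => mode a b l y • v l)
    (g' := fun l y => mode a b l y • (Complex.I * freq a b l) • v l) hu (fun l y => ?_)
    (fun l y => ?_) h0 x
  · have := (hasDerivAt_mode a b l y).smul_const (v l)
    rw [smul_smul, mul_comm (mode a b l y)]
    exact this
  · rw [norm_smul, norm_mode, one_mul, norm_smul, norm_mul, Complex.norm_I, one_mul,
      Complex.norm_real, pow_one]
    gcongr
    exact abs_freq_le_weight a b l

lemma summable_mode_smul_deriv (hab : a < b) {v : ellTwo E} (hv : SobolevLE a b 2 v K) (x : ℝ) :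
    Summable fun l => mode a b l x • (Complex.I * freq a b l) • v l := by
  refine Summable.of_norm_bounded (hv.summable_weight_mul_norm hab) fun l => ?_
  rw [norm_smul, norm_mode, one_mul, norm_smul, norm_mul, Complex.norm_I, one_mul,
    Complex.norm_real, pow_one]
  gcongr
  exact abs_freq_le_weight a b l

end Series

section Dirac

variable {a b : ℝ} {m : ℕ} {V A₁ : ℝ → ℝ} {ε S K C : ℝ} {Φ₀ : ℝ → Spinor} {Φ : ℝ → ℝ → Spinor}
  {g : ℤ → Spinor →L[ℂ] Spinor}

open scoped Classical in
/-- The square-summable sequence of Fourier coefficients of a square-integrable function. -/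
def coefSeq (a b : ℝ) (U : ℝ → Spinor) : ellTwo Spinor :=
  if h : Memℓp (coef a b U) 2 then ⟨coef a b U, h⟩ else 0

lemma coefSeq_apply (hab : a < b) {U : ℝ → Spinor} (hU : ContinuousOn U (Icc a b)) (l : ℤ) :
    coefSeq a b U l = coef a b U l := by
  have h : Memℓp (coef a b U) 2 :=
    memℓp_two_of_summable (hasSum_sq_coef hab (memLp_of_continuousOn hU)).summable
  rw [coefSeq, dif_pos h]

lemma IsDiracSolution.continuousOn_space (h : IsDiracSolution a b V A₁ ε S Φ₀ Φ) {t : ℝ}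
    (ht : t ∈ Icc 0 S) : ContinuousOn (Φ t) (Icc a b) :=
  h.continuousOn.comp (continuousOn_const.prodMk continuousOn_id) fun _ hx => ⟨ht, hx⟩

lemma IsDiracSolution.continuousOn_coef (h : IsDiracSolution a b V A₁ ε S Φ₀ Φ) (l : ℤ) :
    ContinuousOn (fun t => coef a b (Φ t) l) (Icc 0 S) := by
  obtain ⟨B, hB⟩ := (isCompact_Icc.prod isCompact_Icc).exists_bound_of_continuousOn h.continuousOn
  suffices hI : ContinuousOn (fun t => ∫ x in Ioo a b, mode a b (-l) x • Φ t x) (Icc 0 S) from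
    hI.const_smul ((1 / (b - a) : ℝ) : ℂ)
  refine continuousOn_of_dominated (bound := fun _ => B) (fun t ht => ?_) (fun t ht => ?_)
    (integrable_const _) ?_
  · exact (integrableOn_mode_smul ((h.continuousOn_space ht).integrableOn_Icc.mono_set
      Ioo_subset_Icc_self) _).aestronglyMeasurable
  · refine (ae_restrict_mem measurableSet_Ioo).mono fun x hx => ?_
    rw [norm_smul, norm_mode, one_mul]
    exact hB (t, x) ⟨ht, Ioo_subset_Icc_self hx⟩
  · refine (ae_restrict_mem measurableSet_Ioo).mono fun x hx => ?_
    have hc : ContinuousOn (fun t => Φ t x) (Icc 0 S) :=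
      h.continuousOn.comp (continuousOn_id.prodMk continuousOn_const)
        fun _ ht => ⟨ht, Ioo_subset_Icc_self hx⟩
    exact hc.const_smul (mode a b (-l) x)

lemma sum_sq_coef_le_of_sobolevNorm_le (hab : a < b) {U : ℝ → Spinor}
    (h : sobolevNorm a b m U ≤ ENNReal.ofReal K) (s : Finset ℤ) :
    ∑ l ∈ s, (weight a b l ^ m * ‖coef a b U l‖) ^ 2 ≤ max K 0 ^ 2 := by
  have e : ∀ l, (weight a b l ^ m * ‖coef a b U l‖) ^ 2
      = (1 + freq a b l ^ 2) ^ m * ‖fourierCoef a b U l‖ ^ 2 := fun l => by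
    rw [fourierCoef_eq_coef hab, mul_pow, ← pow_mul, mul_comm m 2, pow_mul, weight_sq]
  rw [sobolevNorm, ← ENNReal.rpow_le_rpow_iff (two_pos : (0 : ℝ) < 2), ← ENNReal.rpow_mul] at h
  norm_num at h
  have h1 := (ENNReal.sum_le_tsum s).trans h
  have eK : ENNReal.ofReal K = ENNReal.ofReal (max K 0) := by
    rcases le_total K 0 with hK | hK
    · rw [max_eq_right hK, ENNReal.ofReal_of_nonpos hK, ENNReal.ofReal_zero]
    · rw [max_eq_left hK]
  rw [← ENNReal.ofReal_sum_of_nonneg fun l _ => by positivity, eK,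
    ← ENNReal.ofReal_pow (le_max_right _ _), ENNReal.ofReal_le_ofReal_iff (by positivity)] at h1
  simp_rw [e]
  exact h1

lemma IsDiracSolution.sobolevLE (hab : a < b) (hS : 0 < S)
    (h : IsDiracSolution a b V A₁ ε S Φ₀ Φ) (hB : SobolevBound a b m S K Φ) {t : ℝ}
    (ht : t ∈ Icc 0 S) : SobolevLE a b m (coefSeq a b (Φ t)) (max K 0) := by
  refine ⟨le_max_right _ _, fun s => ?_⟩
  simp_rw [coefSeq_apply hab (h.continuousOn_space ht)]
  set f : ℝ → ℝ := fun t => ∑ l ∈ s, (weight a b l ^ m * ‖coef a b (Φ t) l‖) ^ 2 with hf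
  have hfc : ContinuousOn f (Icc 0 S) := continuousOn_finsetSum _ fun l _ =>
    (continuousOn_const.mul (h.continuousOn_coef l).norm).pow 2
  have hae : (fun t => max (f t) (max K 0 ^ 2)) =ᵐ[volume.restrict (Icc 0 S)]
      fun _ => max K 0 ^ 2 :=
    hB.mono fun t ht => max_eq_right (sum_sq_coef_le_of_sobolevNorm_le hab ht.2 s)
  have := Measure.eqOn_Icc_of_ae_eq volume hS.ne hae
    (hfc.sup continuousOn_const) continuousOn_const ht
  exact max_eq_right_iff.1 this

lemma IsDiracSolution.hasSum_mode_smul (hab : a < b) (hm : 1 ≤ m)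
    (h : IsDiracSolution a b V A₁ ε S Φ₀ Φ) {t : ℝ} (ht : t ∈ Icc 0 S)
    (hB : SobolevLE a b m (coefSeq a b (Φ t)) K) {x : ℝ} (hx : x ∈ Icc a b) :
    HasSum (fun l => mode a b l x • coefSeq a b (Φ t) l) (Φ t x) := by
  have hc := h.continuousOn_space ht
  have hs := hB.summable_norm hab hm
  simp_rw [coefSeq_apply hab hc] at hs ⊢
  exact hasSum_mode_smul_coef hab hc hs hx

/-- The Dirac vector field on Fourier coefficients. -/
def diracField (a b ε : ℝ) (g : ℤ → Spinor →L[ℂ] Spinor) (v : ellTwo Spinor) (l : ℤ) : Spinor :=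
  -(Complex.I • matOp (gammaMat a b l) (v l)) - (Complex.I * ε) • convOp g v l

lemma diracField_eq (v : ellTwo Spinor) (l : ℤ) : diracField a b ε g v l
    = -matOp sigma1 ((Complex.I * freq a b l) • v l) - Complex.I • matOp sigma3 (v l)
      - (Complex.I * ε) • convOp g v l := by
  have e : matOp (gammaMat a b l) (v l) = (freq a b l : ℂ) • matOp sigma1 (v l)
      + matOp sigma3 (v l) := by
    rw [gammaMat, matOp, map_add, map_smul]
    rfl
  rw [diracField, e, map_smul, smul_add, smul_smul]
  abel

lemma norm_diracField_le (hε : 0 ≤ ε) (hε1 : ε ≤ 1) (v : ellTwo Spinor) (l : ℤ) :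
    ‖diracField a b ε g v l‖ ≤ weight a b l ^ 1 * ‖v l‖ + weight a b l ^ 1 * ‖convOp g v l‖ := by
  have h1 := one_le_weight a b l
  rw [diracField]
  refine (norm_sub_le _ _).trans ?_
  rw [norm_neg, norm_smul, norm_smul, norm_mul, Complex.norm_I, one_mul, one_mul,
    norm_gammaMat_apply, Complex.norm_real, Real.norm_of_nonneg hε, pow_one]
  gcongr
  exact hε1.trans h1

lemma summable_norm_diracField (hab : a < b) (hε : 0 ≤ ε) (hε1 : ε ≤ 1) {v : ellTwo Spinor}
    (hv : SobolevLE a b 2 v K) (hGv : SobolevLE a b 2 (convOp g v) C) :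
    (Summable fun l => ‖diracField a b ε g v l‖) ∧
      ∑' l, ‖diracField a b ε g v l‖ ≤ embConst a b * K + embConst a b * C := by
  have hs := Summable.of_nonneg_of_le (fun l => norm_nonneg _)
    (norm_diracField_le (g := g) hε hε1 v)
    ((hv.summable_weight_mul_norm hab).add (hGv.summable_weight_mul_norm hab))
  refine ⟨hs, hs.tsum_le_of_sum_le fun s => ?_⟩
  refine (Finset.sum_le_sum fun l _ => norm_diracField_le hε hε1 v l).trans ?_
  rw [Finset.sum_add_distrib]
  exact add_le_add (hv.sum_weight_mul_norm_le hab s) (hGv.sum_weight_mul_norm_le hab s)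

lemma IsDiracSolution.hasSum_deriv_time (hab : a < b)
    (h : IsDiracSolution a b V A₁ ε S Φ₀ Φ) (hg : Summable fun j => ‖g j‖)
    (hgV : ∀ x ∈ Icc a b, opValue a b x g = matOp (potMat V A₁ x))
    {t : ℝ} (ht : t ∈ Ioo 0 S) (hB : SobolevLE a b 2 (coefSeq a b (Φ t)) K)
    (hGB : SobolevLE a b 2 (convOp g (coefSeq a b (Φ t))) C)
    {x : ℝ} (hx : x ∈ Ioo a b) :
    HasSum (fun l => mode a b l x • diracField a b ε g (coefSeq a b (Φ t)) l)
      (deriv (fun s => Φ s x) t) := by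
  set c := coefSeq a b (Φ t) with hc
  have hval : ∀ y ∈ Icc a b, evalSeries a b y c = Φ t y := fun y hy =>
    (h.hasSum_mode_smul hab one_le_two (Ioo_subset_Icc_self ht) hB hy).tsum_eq
  have h0 : HasSum (fun l => mode a b l x • c l) (Φ t x) :=
    h.hasSum_mode_smul hab one_le_two (Ioo_subset_Icc_self ht) hB (Ioo_subset_Icc_self hx)
  have hev : (fun y => Φ t y) =ᶠ[nhds x] fun y => evalSeries a b y c := by
    filter_upwards [Ioo_mem_nhds hx.1 hx.2] with y hy
    exact (hval y (Ioo_subset_Icc_self hy)).symm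
  have h1 : HasSum (fun l => mode a b l x • (Complex.I * freq a b l) • c l)
      (deriv (fun y => Φ t y) x) := by
    rw [hev.deriv_eq, (hasDerivAt_evalSeries hab hB x).deriv]
    exact (summable_mode_smul_deriv hab hB x).hasSum
  have h2 : HasSum (fun l => mode a b l x • convOp g c l) (matOp (potMat V A₁ x) (Φ t x)) := by
    rw [← hgV x (Ioo_subset_Icc_self hx), ← hval x (Ioo_subset_Icc_self hx),
      ← evalSeries_convOp a b x hg (hB.summable_norm hab one_le_two)]
    exact hasSum_evalSeries a b x (hGB.summable_norm hab one_le_two)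
  have heq := h.equation t ht x hx
  have e : deriv (fun s => Φ s x) t = -matOp sigma1 (deriv (fun y => Φ t y) x)
      - Complex.I • matOp sigma3 (Φ t x) - (Complex.I * ε) • matOp (potMat V A₁ x) (Φ t x) := by
    have h3 := congrArg (fun w => (-Complex.I) • w) heq
    simp only [smul_smul, smul_add, smul_neg, neg_mul, Complex.I_mul_I, neg_neg, one_smul,
      act_eq_matOp] at h3
    rw [h3]
    simp only [potMat, neg_smul]
    abel
  rw [e]
  have h4 := (((h1.mapL (matOp sigma1)).neg).sub ((h0.mapL (matOp sigma3)).const_smul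
    Complex.I)).sub (h2.const_smul (Complex.I * ε))
  refine h4.congr_fun ?_ |> fun h => h
  intro l
  rw [diracField_eq, map_smul (matOp sigma1) (mode a b l x), map_smul (matOp sigma3) (mode a b l x),
    smul_sub, smul_sub, smul_neg, smul_comm Complex.I, smul_comm (Complex.I * (ε : ℂ))]

lemma IsDiracSolution.hasDerivAt_coefSeq (hab : a < b) (hm : 2 ≤ m) (hε : 0 ≤ ε) (hε1 : ε ≤ 1)
    (h : IsDiracSolution a b V A₁ ε S Φ₀ Φ) (hg : Summable fun j => ‖g j‖)
    (hgV : ∀ x ∈ Icc a b, opValue a b x g = matOp (potMat V A₁ x))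
    (hG : ∀ k ≤ m, ∀ v B, SobolevLE a b k v B → SobolevLE a b k (convOp g v) (C * B))
    (hB : ∀ t ∈ Icc 0 S, SobolevLE a b m (coefSeq a b (Φ t)) K)
    {t : ℝ} (ht : t ∈ Ioo 0 S) (l : ℤ) :
    HasDerivAt (fun t => coefSeq a b (Φ t) l) (diracField a b ε g (coefSeq a b (Φ t)) l) t := by
  have hB2 : ∀ s ∈ Ioo 0 S, SobolevLE a b 2 (coefSeq a b (Φ s)) K := fun s hs =>
    (hB s (Ioo_subset_Icc_self hs)).of_order_le hm
  have hGB : ∀ s ∈ Ioo 0 S, SobolevLE a b 2 (convOp g (coefSeq a b (Φ s))) (C * K) := fun s hs =>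
    hG 2 hm _ _ (hB2 s hs)
  have hsum : ∀ s ∈ Ioo 0 S, ∀ x ∈ Ioo a b, HasSum (fun l => mode a b l x •
      diracField a b ε g (coefSeq a b (Φ s)) l) (deriv (fun s => Φ s x) s) := fun s hs x hx =>
    h.hasSum_deriv_time hab hg hgV hs (hB2 s hs) (hGB s hs) hx
  have hd := fun s hs => summable_norm_diracField (g := g) hab hε hε1 (hB2 s hs) (hGB s hs)
  have hnhds : Ioo 0 S ∈ nhds t := Ioo_mem_nhds ht.1 ht.2
  have hmeas : ∀ s ∈ Ioo 0 S, IntegrableOn (fun x => mode a b (-l) x • Φ s x) (Ioo a b) :=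
    fun s hs => integrableOn_mode_smul ((h.continuousOn_space
      (Ioo_subset_Icc_self hs)).integrableOn_Icc.mono_set Ioo_subset_Icc_self) _
  have key := hasDerivAt_integral_of_dominated_loc_of_deriv_le (μ := volume.restrict (Ioo a b))
    (F := fun s x => mode a b (-l) x • Φ s x)
    (F' := fun s x => mode a b (-l) x • deriv (fun s => Φ s x) s) (x₀ := t)
    (bound := fun _ => embConst a b * K + embConst a b * (C * K)) hnhds
    (by filter_upwards [hnhds] with s hs using (hmeas s hs).aestronglyMeasurable)
    (hmeas t ht) ?_ ?_ (integrable_const _) ?_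
  · have hcoef := coef_of_hasSum hab (hd t ht).1 (hsum t ht) l
    rw [← hcoef, coef]
    refine (key.2.const_smul ((1 / (b - a) : ℝ) : ℂ)).congr_of_eventuallyEq ?_
    filter_upwards [hnhds] with s hs
    rw [coefSeq_apply hab (h.continuousOn_space (Ioo_subset_Icc_self hs)), coef]
    rfl
  · have hc : Continuous fun x => ∑' k, mode a b k x • diracField a b ε g (coefSeq a b (Φ t)) k :=
      continuous_tsum (fun k => (continuous_mode a b k).smul continuous_const) (hd t ht).1
        fun k x => by rw [norm_smul, norm_mode, one_mul]
    refine ((continuous_mode a b (-l)).smul hc).aestronglyMeasurable.congr ?_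
    refine (ae_restrict_mem measurableSet_Ioo).mono fun x hx => ?_
    exact congrArg (fun w => mode a b (-l) x • w) (hsum t ht x hx).tsum_eq
  · refine (ae_restrict_mem measurableSet_Ioo).mono fun x hx s hs => ?_
    rw [norm_smul, norm_mode, one_mul, ← (hsum s hs x hx).tsum_eq]
    refine le_trans ?_ (hd s hs).2
    refine tsum_of_norm_bounded (hd s hs).1.hasSum fun k => ?_
    rw [norm_smul, norm_mode, one_mul]
  · refine (ae_restrict_mem measurableSet_Ioo).mono fun x hx s hs => ?_
    exact (h.differentiable_time s hs x hx).hasDerivAt.const_smul (mode a b (-l) x)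

end Dirac

end DiracTSFP
end

noncomputable section
namespace DiracTSFP

/-! ### The error in physical space -/

section Physical

variable {a b : ℝ}

lemma hasSum_mode_smul_discSeq (M : ℕ) (U : Fin (M + 1) → Spinor) (x : ℝ) :
    HasSum (fun l => mode a b l x • discSeq M U l) (interp a b M U x) := by
  have h : interp a b M U x = ∑ l ∈ modes M, mode a b l x • discSeq M U l :=
    Finset.sum_congr rfl fun l hl => by
      rw [discSeq, truncSeq_apply, if_pos hl]
      rfl
  rw [h]
  refine hasSum_sum_of_ne_finset_zero fun l hl => ?_
  rw [discSeq, truncSeq_apply, if_neg hl, smul_zero]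

lemma continuous_interp (M : ℕ) (U : Fin (M + 1) → Spinor) : Continuous (interp a b M U) :=
  continuous_finsetSum _ fun l _ => (continuous_mode a b l).smul continuous_const

lemma coef_interp (hab : a < b) (M : ℕ) (U : Fin (M + 1) → Spinor) (l : ℤ) :
    coef a b (interp a b M U) l = discSeq M U l :=
  coef_of_hasSum hab (summable_norm_truncSeq _ _) (fun x _ => hasSum_mode_smul_discSeq M U x) l

lemma eLpNorm_eq_of_coef_eq (hab : a < b) {U : ℝ → Spinor} (hU : ContinuousOn U (Icc a b))
    {v : ellTwo Spinor} (h : ∀ l, coef a b U l = v l) :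
    eLpNorm U 2 (volume.restrict (Ioo a b)) = ENNReal.ofReal (√(b - a) * ‖v‖) := by
  have hba := sub_pos.2 hab
  have hL : MemLp U 2 (volume.restrict (Ioo a b)) := memLp_of_continuousOn hU
  have h1 := hasSum_sq_coef hab hL
  simp_rw [h] at h1
  have h2 := h1.unique v.hasSum_sq
  have h3 : ∫ x in Ioo a b, ‖U x‖ ^ 2 = (b - a) * ‖v‖ ^ 2 := by
    rw [← h2, mul_inv_cancel_left₀ hba.ne']
  rw [hL.eLpNorm_eq_integral_rpow_norm two_ne_zero ENNReal.ofNat_ne_top]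
  simp only [ENNReal.toReal_ofNat, Real.rpow_ofNat]
  rw [h3, ← one_div, ← Real.sqrt_eq_rpow, Real.sqrt_mul hba.le, Real.sqrt_sq (norm_nonneg _)]

lemma eLpNorm_sub_interp (hab : a < b) {U : ℝ → Spinor} (hU : ContinuousOn U (Icc a b)) (M : ℕ)
    (W : Fin (M + 1) → Spinor) :
    eLpNorm (fun x => U x - interp a b M W x) 2 (volume.restrict (Ioo a b))
      = ENNReal.ofReal (√(b - a) * ‖coefSeq a b U - discSeq M W‖) := by
  have hi := (continuous_interp (a := a) (b := b) M W).continuousOn (s := Icc a b)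
  refine eLpNorm_eq_of_coef_eq hab (U := fun x => U x - interp a b M W x) (hU.sub hi) fun l => ?_
  rw [coef_sub (hU.integrableOn_Icc.mono_set Ioo_subset_Icc_self)
    (hi.integrableOn_Icc.mono_set Ioo_subset_Icc_self), coef_interp hab, ellTwo.sub_apply,
    coefSeq_apply hab hU]

end Physical

end DiracTSFP
end


theorem theorem3p2
    (a b : ℝ) (hab : a < b) (m : ℕ) (hm : 2 ≤ m) (V A₁ : ℝ → ℝ)
    (hV : MemSobolevPer m ∞ a b V) (hA₁ : MemSobolevPer m ∞ a b A₁) (K : ℝ) :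
    ∃ C₀ C₁ : ℝ, 0 < C₀ ∧ 0 < C₁ ∧
      ∀ T ε : ℝ, 0 < T → 0 < ε → ε ≤ 1 →
      ∀ (Φ₀ : ℝ → Spinor) (Φ : ℝ → ℝ → Spinor),
        IsDiracSolution a b V A₁ ε (T / ε) Φ₀ Φ →
        SobolevBound a b m (T / ε) K Φ →
      ∀ (M : ℕ) (τ : ℝ), 0 < M → Even M → 0 < τ →
      ∀ n : ℕ, (n : ℝ) ≤ T / ε / τ →
        eLpNorm (fun x => Φ (n * τ) x - interp a b M (tsfp a b V A₁ ε τ M Φ₀ n) x) 2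
            (volume.restrict (Ioo a b))
          ≤ ENNReal.ofReal ((C₀ + C₁ * ε * (n * τ)) * (mesh a b M ^ m + τ ^ 2)) ∧
        C₀ + C₁ * ε * (n * τ) ≤ C₀ + C₁ * T := by
  obtain ⟨g, hg, hgV, C, hC, hG⟩ := exists_potential_symbol hab (by omega) hV hA₁
  have hα := aliasConst_nonneg
  have hL := localConst_nonneg hC
  have hE := Real.exp_pos C
  have hK0 : 0 ≤ max K 0 := le_max_right _ _
  set P := (2 + aliasConst) * max K 0 with hP
  set Q := (localConst C + (C * Real.exp C) * (1 + aliasConst)) * max K 0 with hQ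
  have hP0 : 0 ≤ P := by positivity
  have hQ0 : 0 ≤ Q := by positivity
  have hs : 0 ≤ √(b - a) := Real.sqrt_nonneg _
  refine ⟨√(b - a) * P + 1, √(b - a) * Q + 1, by positivity, by positivity, ?_⟩
  intro T ε hT hε hε1 Φ₀ Φ hD hB M τ hM hMe hτ n hn
  have hS : 0 < T / ε := by positivity
  have hnS : n * τ ≤ T / ε := (le_div_iff₀ hτ).1 hn
  have ht : n * τ ∈ Icc 0 (T / ε) := ⟨by positivity, hnS⟩
  have hSob : ∀ t ∈ Icc 0 (T / ε), SobolevLE a b m (coefSeq a b (Φ t)) (max K 0) := fun t ht =>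
    hD.sobolevLE hab hS hB ht
  refine ⟨?_, ?_⟩
  · have hc : ∀ l, ContinuousOn (fun t => coefSeq a b (Φ t) l) (Icc 0 (T / ε)) := fun l =>
      (hD.continuousOn_coef l).congr fun t ht => coefSeq_apply hab (hD.continuousOn_space ht) l
    have h0 : discSeq M (tsfp a b V A₁ ε τ M Φ₀ 0)
        = discSeq M (gridEval a b M (coefSeq a b (Φ 0))) := by
      have h00 : (0 : ℝ) ∈ Icc 0 (T / ε) := ⟨le_rfl, hS.le⟩
      congr 1
      funext j
      have hj := gridPoint_mem_Icc hab hM j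
      refine (hD.initial _ hj).symm.trans ?_
      exact (hD.hasSum_mode_smul hab (by omega) h00 (hSob 0 h00) hj).tsum_eq.symm
    have hmain := norm_sub_discSeq_tsfp_le hab hM hMe hm hg hgV hC hG hτ hε hε1 hc
      (fun t ht l => hD.hasDerivAt_coefSeq hab hm hε.le hε1 hg hgV hG hSob ht l) hSob h0 n hnS
    rw [eLpNorm_sub_interp hab (hD.continuousOn_space ht)]
    refine ENNReal.ofReal_le_ofReal ?_
    have hh := (mesh_pos hab hM).le
    have hr : 0 ≤ mesh a b M ^ m + τ ^ 2 := by positivity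
    calc √(b - a) * ‖coefSeq a b (Φ (n * τ)) - discSeq M (tsfp a b V A₁ ε τ M Φ₀ n)‖
        ≤ √(b - a) * ((P + Q * ε * (n * τ)) * (mesh a b M ^ m + τ ^ 2)) := by gcongr
      _ = (√(b - a) * P + √(b - a) * Q * ε * (n * τ)) * (mesh a b M ^ m + τ ^ 2) := by ring
      _ ≤ _ := by
        gcongr
        · linarith
        · linarith
  · have h1 : ε * (n * τ) ≤ T := by
      rw [mul_comm]
      exact (le_div_iff₀ hε).1 hnS
    rw [mul_assoc]
    gcongr
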